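/- Let $0<\lambda<\infty$, $\mu<1$ and $0<\theta<\pi$ with $\lambda\theta<2\pi$, and let $f$ be an entire function. Write $p_n(z)=\sum_{k=0}^{n}\frac{f^{(k)}(0)}{k!}z^k$ and $r_n=(n/\lambda)^{1/\lambda}$; all powers, logarithms and arguments are principal. We say that $f$ has a single direction of maximal growth if, for some $a,b\in\mathbb{C}$, as $|z|\to\infty$, $f(z)=z^a(\log z)^b\exp(z^\lambda)[1+o(1)]$ uniformly for $|\arg z|\le\theta$ and $f(z)=O(\exp(\mu|z|^\lambda))$ uniformly for $|\arg z|>\theta$. We say that $f$ has $m+1\ge 2$ directions of maximal growth if there are $a=b_0,b_1,\dots,b_m\in\mathbb{C}$, $A_0=1$, $A_1,\dots,A_m\in\mathbb{C}$ and $\zeta_0=1$, $\zeta_1,\dots,\zeta_m$ on the unit circle such that the sectors $|\arg(z/\zeta_k)|\le\theta$ $(z\ne0,\ 0\le k\le m)$ are pairwise disjoint and, as $|z|\to\infty$, $f(z)=A_k(z/\zeta_k)^{b_k}\exp((z/\zeta_k)^\lambda)[1+o(1)]$ uniformly for $|\arg(z/\zeta_k)|\le\theta$, $k=0,\dots,m$,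 and $f(z)=O(\exp(\mu|z|^\lambda))$ uniformly outside these sectors. For an infinite set $M$ of positive integers, an integer $k\ge1$, a real $\varphi$ and a sequence $(\rho_n)$, say that $W(M,k,\varphi,\rho)$ holds if $\rho_n>0$ for $n\in M$, $\rho_n\to\infty$ and $\rho_n=O(n^{2/(\lambda k)})$ as $n\to\infty$, $n\in M$, and for every fixed $\varepsilon>0$ the number of distinct zeros of $p_{n-1}$ in the disk $|z-\rho_ne^{i\varphi}|\le\rho_n n^{-1/k+\varepsilon}$ tends to infinity as $n\to\infty$, $n\in M$. (The case $k=1$ is the condition in part (a) of the Modified Saff–Varga Width Conjecture; $k\ge2$ is the condition in part (b).) Let $S=\{z\in\mathbb{C}: |z^\lambda\exp(1-z^\lambda)|=1,\ |z|\le1\}$. Say that part (a) holds along $M$ if for every $\varphi$ with $0<|\varphi|<\theta$ there is exactly one $\xi\in S$ with $\arg\xi=\varphi$, and $W(M,1,\varphi,\rho)$ holds with $\rho_n=|\xi|r_n$. Say that part (b) holds along $M$ at the exceptional argument $0$ if $W(M,2,0,\rho)$ holds with $\rho_n=r_n$. 1. If $f$ has a single direction of maximal growth, then part (a) and part (b)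 (at the argument $0$) both hold along the set of all positive integers. 2. If $f$ has $m+1\ge2$ directions of maximal growth, then there is an infinite set $M$ of positive integers, the same for all $0<|\varphi|<\theta$, such that part (a) holds along $M$. If moreover one of $\operatorname{Re}b_0,\dots,\operatorname{Re}b_m$ is strictly larger than all the others, then part (a) holds along the set of all positive integers. If $\operatorname{Re}b_k-\operatorname{Re}a<\lambda/2$ for $k=1,\dots,m$, then part (b) holds along the set of all positive integers at the argument $0$. -/

import Mathlib

open Filter Asymptotics

noncomputable section

namespace SaffVarga

/-- The partial sum `p_n(z) = ∑_{k ≤ n} f^{(k)}(0) / k! * z ^ k` of the Maclaurin series of `f`. -/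
def partialSum (f : ℂ → ℂ) (n : ℕ) (z : ℂ) : ℂ :=
  ∑ k ∈ Finset.range (n + 1), iteratedDeriv k f 0 / (k.factorial : ℂ) * z ^ k

/-- The scaling sequence `r_n = (n / lam) ^ (1 / lam)`. -/
def scale (lam : ℝ) (n : ℕ) : ℝ := ((n : ℝ) / lam) ^ (1 / lam)

/-- The closed sector `|arg (z / ζ)| ≤ θ` about the direction `ζ`, with its vertex removed. -/
def sector (θ : ℝ) (ζ : ℂ) : Set ℂ := {z | z ≠ 0 ∧ |(z / ζ).arg| ≤ θ}

/-- `f(z) = g(z) (1 + o(1))` as `|z| → ∞`, uniformly in `S`. -/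
def AsympIn (S : Set ℂ) (f g : ℂ → ℂ) : Prop :=
  IsEquivalent (Bornology.cobounded ℂ ⊓ 𝓟 S) f g

/-- `f(z) = O(exp(mu |z| ^ lam))` as `|z| → ∞`, uniformly in `S`. -/
def ExpBoundIn (S : Set ℂ) (f : ℂ → ℂ) (mu lam : ℝ) : Prop :=
  f =O[Bornology.cobounded ℂ ⊓ 𝓟 S] (fun z : ℂ => Real.exp (mu * ‖z‖ ^ lam))

/-- The entire function `f` has a single direction of maximal exponential growth, the positive
real axis:
`f(z) = z ^ a (log z) ^ b exp(z ^ lam) (1 + o(1))` for `|arg z| ≤ θ`, and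
`f(z) = O(exp(mu |z| ^ lam))` for `|arg z| > θ`. All powers and logarithms are principal. -/
structure OneDirection (f : ℂ → ℂ) (a b : ℂ) (lam mu θ : ℝ) : Prop where
  entire : Differentiable ℂ f
  main : AsympIn (sector θ 1) f
    (fun z => z ^ a * (Complex.log z) ^ b * Complex.exp (z ^ (lam : ℂ)))
  other : ExpBoundIn (sector θ 1)ᶜ f mu lam

/-- The entire function `f` has the `m + 1` directions of maximal exponential growth
`ζ 0 = 1, ζ 1, …, ζ m`:
`f(z) = A k (z / ζ k) ^ (b k) exp((z / ζ k) ^ lam) (1 + o(1))` for `|arg (z / ζ k)| ≤ θ`, where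
`A 0 = 1`, these sectors are pairwise disjoint, and `f(z) = O(exp(mu |z| ^ lam))` elsewhere. The
exponent of the subexponential factor in the direction of the positive real axis is `b 0`. -/
structure ManyDirections (f : ℂ → ℂ) {m : ℕ} (A b ζ : Fin (m + 1) → ℂ) (lam mu θ : ℝ) :
    Prop where
  entire : Differentiable ℂ f
  coeff_zero : A 0 = 1
  dir_zero : ζ 0 = 1
  dir_norm : ∀ k, ‖ζ k‖ = 1
  disjoint : ∀ j k, j ≠ k → Disjoint (sector θ (ζ j)) (sector θ (ζ k))
  main : ∀ k, AsympIn (sector θ (ζ k)) f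
    (fun z => A k * (z / ζ k) ^ (b k) * Complex.exp ((z / ζ k) ^ (lam : ℂ)))
  other : ExpBoundIn (⋃ k, sector θ (ζ k))ᶜ f mu lam

/-- The limit curve `|z ^ lam exp(1 - z ^ lam)| = 1`, `|z| ≤ 1`. -/
def limitCurve (lam : ℝ) : Set ℂ :=
  {z | ‖z ^ (lam : ℂ) * Complex.exp (1 - z ^ (lam : ℂ))‖ = 1 ∧ ‖z‖ ≤ 1}

/-- The number of distinct zeros of `p` in the closed disk with centre `c` and radius `R`. -/
def zeroCount (p : ℂ → ℂ) (c : ℂ) (R : ℝ) : ℕ :=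
  Set.ncard {z : ℂ | p z = 0 ∧ ‖z - c‖ ≤ R}

/-- The condition of the Modified Width Conjecture at the argument `φ`, for the partial sums
`p_{n-1}` of `f` with indices `n ∈ M`, centres `ρ_n e ^ (i φ)` and the integer `k`: the sequence
`ρ` is positive, tends to infinity, is `O(n ^ (2 / (lam k)))`, and for every `ε > 0` the number of
zeros of `p_{n-1}` in the disk `|z - ρ_n e ^ (i φ)| ≤ ρ_n n ^ (-1 / k + ε)` tends to infinity as
`n → ∞` in `M`. Part (a) of the conjecture is the case `k = 1`; in part (b), `k ≥ 2`. -/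
def WidthCondition (f : ℂ → ℂ) (lam : ℝ) (M : Set ℕ) (k : ℕ) (φ : ℝ) (ρ : ℕ → ℝ) : Prop :=
  (∀ n ∈ M, 0 < ρ n) ∧
  Tendsto ρ (atTop ⊓ 𝓟 M) atTop ∧
  ρ =O[atTop ⊓ 𝓟 M] (fun n : ℕ => (n : ℝ) ^ (2 / (lam * (k : ℝ)))) ∧
  ∀ ε : ℝ, 0 < ε →
    Tendsto
      (fun n : ℕ => zeroCount (partialSum f (n - 1))
        ((ρ n : ℂ) * Complex.exp (Complex.I * (φ : ℂ))) (ρ n * (n : ℝ) ^ (-1 / (k : ℝ) + ε)))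
      (atTop ⊓ 𝓟 M) atTop

/-- Part (a) of the Modified Width Conjecture along `M` at every argument `0 < |φ| < θ`: there is
exactly one point `ξ` of the limit curve with argument `φ`, and `ρ_n = |ξ| r_n` satisfies the
condition. -/
def PartA (f : ℂ → ℂ) (lam θ : ℝ) (M : Set ℕ) : Prop :=
  ∀ φ : ℝ, 0 < |φ| → |φ| < θ →
    ∃ ξ : ℂ, (ξ ∈ limitCurve lam ∧ ξ.arg = φ) ∧
      (∀ η : ℂ, η ∈ limitCurve lam → η.arg = φ → η = ξ) ∧
      WidthCondition f lam M 1 φ (fun n => ‖ξ‖ * scale lam n)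

/-- Part (b) of the Modified Width Conjecture along `M` at the exceptional argument `0`, with
`k = 2` and `ρ_n = r_n`. -/
def PartB (f : ℂ → ℂ) (lam : ℝ) (M : Set ℕ) : Prop :=
  WidthCondition f lam M 2 0 (scale lam)

end SaffVarga

end

open scoped Topology
open Metric

namespace SaffVarga

/-! Rescale `z = r_n s`. Then `f - p_{n-1}` is `s ^ n` times a Cauchy integral `R_n(s)` over the
unit circle (`sub_partialSum`), and the choice of `r_n` makes every direction `ζ_k` a saddle point
of the integrand. Laplace's method (`tendsto_sector_integral`, `Growth.remInt_asymp`) shows that, up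
to the common factor `e^{n/λ} / √(2πλn)` and a negligible error, `R_n(s)` is a combination of the
fractions `1 / (ζ_k - s)` whose coefficients have the size of the subexponential factors at `r_n`,
as long as `√n (1 - |s|) → ∞`. On the other hand, `f(r_n s) / s ^ n` is `e^{n/λ} e^{nΦ(s)}` times a
factor of power size, where `Φ` is `phase`; the nonzero points of `S` are those with `Re Φ = 0` and
`|s| ≤ 1`. So the zeros of `p_{n-1}` occur where `e^{nΦ}` balances a quantity of power size.

Let `σ` be a point where `|f| = |f - p_{n-1}|`, and put `s = σ + v / (n Φ'(σ))`. If `R_n` is nearly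
constant on this scale, then `p_{n-1}` divided by `s ^ n R_n(σ)` is close to `c e^v - 1` with `|c| =
1`, a function with zeros spaced by `2πi`. Hence there are arbitrarily many zeros within a bounded
range of `v` (`Growth.many_zeros`). Such a `σ` is supplied by the intermediate value theorem on a
path along which `n Re Φ` changes sign by more than a logarithm of a power of `n`
(`Growth.exists_balance`).

In part (a), `Φ'(ξ) ≠ 0`, and the danger is that the fractions cancel near `ξ`. By compactness every
sequence of indices has a subsequence along which suitably normalized `R_n`, magnified at the scale
`n^{-1+ε'}`, converge to a nonzero polynomial (`exists_zoom`, `Growth.exists_zoom_remInt`); the path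
is drawn so as to avoid its roots. As every subsequence has a further good one, the zero count tends
to infinity along all `n`.

In part (b), `Φ` has a double zero at `1`, and the path is an arc of radius `n^{-1/2+ε'}` about `1`,
inside the unit disk. There `1 / (1 - s)` has size `n^{1/2-ε'}`, which outweighs the relative sizes
`n^{(Re b_k - Re a)/λ}` of the other terms (`Growth.tendsto_remInt_near_one`).

Uniformity in `s` or `v` is expressed by stating the asymptotics along general filters and using
`atTop ×ˢ 𝓟 K`. -/

/-! ### Subexponential factors and the scaling sequence. -/

/-- The subexponential factor `z ^ b * (log z) ^ c`. -/
noncomputable def slow (b c z : ℂ) : ℂ := z ^ b * Complex.log z ^ c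

lemma ofReal_mul_cpow {r : ℝ} (hr : 0 < r) (s a : ℂ) :
    ((r : ℂ) * s) ^ a = (r : ℂ) ^ a * s ^ a := by
  have hr' : (r : ℂ) ≠ 0 := by exact_mod_cast hr.ne'
  rcases eq_or_ne s 0 with rfl | hs
  · rcases eq_or_ne a 0 with rfl | ha
    · simp
    · simp [Complex.zero_cpow ha]
  · rw [Complex.cpow_def_of_ne_zero (mul_ne_zero hr' hs), Complex.cpow_def_of_ne_zero hr',
      Complex.cpow_def_of_ne_zero hs, Complex.log_ofReal_mul hr hs, ← Complex.exp_add,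
      ← Complex.ofReal_log hr.le, add_mul]

/-- Since `r` and `log r` are positive, both factor out of principal powers without branch
corrections. For `s` with bounded logarithm the last bracket tends to `1`, so rescaling changes the
subexponential factor only by `s ^ b` in the limit. -/
lemma slow_mul {r : ℝ} (hr : 1 < r) {s : ℂ} (hs : s ≠ 0) (b c : ℂ) :
    slow b c (r * s) = slow b c r * (s ^ b * (1 + Complex.log s / (Real.log r : ℂ)) ^ c) := by
  have hr0 : 0 < r := by linarith
  have hl : 0 < Real.log r := Real.log_pos hr
  have hl' : (Real.log r : ℂ) ≠ 0 := by exact_mod_cast hl.ne'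
  have h : Complex.log (r * s) =
      (Real.log r : ℂ) * (1 + Complex.log s / (Real.log r : ℂ)) := by
    rw [Complex.log_ofReal_mul hr0 hs]; field_simp
  unfold slow
  rw [h, ofReal_mul_cpow hr0, ofReal_mul_cpow hl, ← Complex.ofReal_log hr0.le]
  ring

lemma slow_ne_zero {z : ℂ} (hz : 1 < ‖z‖) (b c : ℂ) : slow b c z ≠ 0 := by
  have hz0 : z ≠ 0 := by
    intro h; simp [h] at hz; linarith
  have hl : Complex.log z ≠ 0 := by
    intro h
    have := congrArg Complex.re h
    rw [Complex.log_re] at this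
    exact (Real.log_pos hz).ne' (by simpa using this)
  unfold slow
  exact mul_ne_zero (by simp [Complex.cpow_eq_zero_iff, hz0])
    (by simp [Complex.cpow_eq_zero_iff, hl])

lemma tendsto_one_add_log_div_cpow {ι : Type*} {l : Filter ι} {r : ι → ℝ} {s : ι → ℂ}
    (hr : Tendsto r l atTop) {C : ℝ} (hs : ∀ᶠ i in l, ‖Complex.log (s i)‖ ≤ C) (c : ℂ) :
    Tendsto (fun i => (1 + Complex.log (s i) / (Real.log (r i) : ℂ)) ^ c) l (𝓝 1) := by
  have h0 : Tendsto (fun i => Complex.log (s i) / (Real.log (r i) : ℂ)) l (𝓝 0) := by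
    have h1 : Tendsto (fun i => C / Real.log (r i)) l (𝓝 0) :=
      (Real.tendsto_log_atTop.comp hr).const_div_atTop C
    refine squeeze_zero_norm' ?_ h1
    filter_upwards [hs, hr.eventually_gt_atTop 1] with i hi hr1
    have := Real.log_pos hr1
    rw [norm_div, Complex.norm_real, Real.norm_of_nonneg this.le]
    gcongr
  have h2 : Tendsto (fun i => 1 + Complex.log (s i) / (Real.log (r i) : ℂ)) l (𝓝 1) := by
    simpa using h0.const_add 1
  have h3 : ContinuousAt (fun z : ℂ => z ^ c) 1 :=
    continuousAt_cpow_const (by simp)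
  simpa [Function.comp_def] using h3.tendsto.comp h2

lemma scale_pos {lam : ℝ} (hlam : 0 < lam) {n : ℕ} (hn : 1 ≤ n) : 0 < scale lam n := by
  unfold scale
  have : (0 : ℝ) < n := by exact_mod_cast hn
  positivity

lemma scale_rpow {lam : ℝ} (hlam : 0 < lam) (n : ℕ) : scale lam n ^ lam = n / lam := by
  unfold scale
  rw [← Real.rpow_mul (by positivity), one_div_mul_cancel hlam.ne', Real.rpow_one]

lemma tendsto_scale {lam : ℝ} (hlam : 0 < lam) {ι : Type*} {l : Filter ι} {n : ι → ℕ}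
    (hn : Tendsto n l atTop) : Tendsto (fun i => scale lam (n i)) l atTop := by
  have h1 : Tendsto (fun i => (n i : ℝ) / lam) l atTop :=
    (tendsto_natCast_atTop_atTop.comp hn).atTop_div_const hlam
  exact (tendsto_rpow_atTop (by positivity : 0 < 1 / lam)).comp h1

lemma scale_mul_cpow {lam : ℝ} (hlam : 0 < lam) {n : ℕ} (hn : 1 ≤ n) (s : ℂ) :
    ((scale lam n : ℂ) * s) ^ (lam : ℂ) = (n / lam : ℂ) * s ^ (lam : ℂ) := by
  rw [ofReal_mul_cpow (scale_pos hlam hn), ← Complex.ofReal_cpow (scale_pos hlam hn).le,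
    scale_rpow hlam]
  push_cast
  rfl

/-! ### Quantities of power size. -/

/-- `g` is bounded above and below by powers of `n` along `l`. -/
def Moderate {ι : Type*} (l : Filter ι) (n : ι → ℕ) (g : ι → ℝ) : Prop :=
  ∃ K : ℝ, ∀ᶠ i in l, (n i : ℝ) ^ (-K) ≤ g i ∧ g i ≤ (n i : ℝ) ^ K

namespace Moderate

variable {ι : Type*} {l : Filter ι} {n : ι → ℕ} {g h : ι → ℝ}

lemma pos (hn : Tendsto n l atTop) (hg : Moderate l n g) : ∀ᶠ i in l, 0 < g i := by
  obtain ⟨K, hK⟩ := hg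
  filter_upwards [hK, hn.eventually_ge_atTop 1] with i hi h1
  have : (0 : ℝ) < n i := by exact_mod_cast h1
  exact lt_of_lt_of_le (Real.rpow_pos_of_pos this _) hi.1

lemma mul (hn : Tendsto n l atTop) (hg : Moderate l n g) (hh : Moderate l n h) :
    Moderate l n (fun i => g i * h i) := by
  have hgp := hg.pos hn
  obtain ⟨K, hK⟩ := hg
  obtain ⟨K', hK'⟩ := hh
  refine ⟨K + K', ?_⟩
  filter_upwards [hK, hK', hgp, hn.eventually_ge_atTop 1] with i hi hi' hp h1
  have h0 : (0 : ℝ) < n i := by exact_mod_cast h1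
  rw [neg_add, Real.rpow_add h0, Real.rpow_add h0]
  exact ⟨mul_le_mul hi.1 hi'.1 (by positivity) hp.le, mul_le_mul hi.2 hi'.2
    (le_trans (by positivity) hi'.1) (by positivity)⟩

lemma inv (hn : Tendsto n l atTop) (hg : Moderate l n g) :
    Moderate l n (fun i => (g i)⁻¹) := by
  have hgp := hg.pos hn
  obtain ⟨K, hK⟩ := hg
  refine ⟨K, ?_⟩
  filter_upwards [hK, hgp, hn.eventually_ge_atTop 1] with i hi hp h1
  have h0 : (0 : ℝ) < n i := by exact_mod_cast h1
  constructor
  · rw [Real.rpow_neg h0.le]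
    exact inv_anti₀ hp hi.2
  · rw [← inv_inv ((n i : ℝ) ^ K), ← Real.rpow_neg h0.le]
    exact inv_anti₀ (by positivity) hi.1

lemma div (hn : Tendsto n l atTop) (hg : Moderate l n g) (hh : Moderate l n h) :
    Moderate l n (fun i => g i / h i) := by
  simpa only [div_eq_mul_inv] using hg.mul hn (hh.inv hn)

lemma congr' (hg : Moderate l n g) (he : ∀ᶠ i in l, g i = h i) : Moderate l n h := by
  obtain ⟨K, hK⟩ := hg
  refine ⟨K, ?_⟩
  filter_upwards [hK, he] with i hi he
  rwa [← he]

lemma of_bounds (hn : Tendsto n l atTop) {c C : ℝ} (hc : 0 < c)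
    (hg : ∀ᶠ i in l, c ≤ g i ∧ g i ≤ C) : Moderate l n g := by
  -- Exponent `1` suffices: eventually `n⁻¹ ≤ c` and `C ≤ n`.
  refine ⟨1, ?_⟩
  have hn' : Tendsto (fun i => (n i : ℝ)) l atTop := tendsto_natCast_atTop_atTop.comp hn
  filter_upwards [hg, hn'.eventually_ge_atTop C, hn'.eventually_ge_atTop c⁻¹] with i hi h1 h2
  have h0 : (0 : ℝ) < n i := lt_of_lt_of_le (inv_pos.2 hc) h2
  rw [Real.rpow_neg h0.le, Real.rpow_one]
  exact ⟨le_trans (inv_le_of_inv_le₀ hc h2) hi.1, hi.2.trans h1⟩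

lemma of_tendsto (hn : Tendsto n l atTop) {a : ℝ} (ha : 0 < a) (hg : Tendsto g l (𝓝 a)) :
    Moderate l n g := by
  refine of_bounds hn (half_pos ha) (C := a + 1) ?_
  filter_upwards [Filter.Tendsto.eventually_const_le (half_lt_self ha) hg,
    Filter.Tendsto.eventually_le_const (lt_add_one a) hg] with i h1 h2
  exact ⟨h1, h2⟩

lemma of_between {k : ι → ℝ} (hg : Moderate l n g) (hh : Moderate l n h)
    (hn : Tendsto n l atTop) (hk : ∀ᶠ i in l, g i ≤ k i ∧ k i ≤ h i) : Moderate l n k := by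
  obtain ⟨K, hK⟩ := hg
  obtain ⟨K', hK'⟩ := hh
  refine ⟨max K K', ?_⟩
  filter_upwards [hK, hK', hk, hn.eventually_ge_atTop 1] with i hi hi' hki h1
  have h1' : (1 : ℝ) ≤ n i := by exact_mod_cast h1
  refine ⟨le_trans (le_trans ?_ hi.1) hki.1, le_trans (le_trans hki.2 hi'.2) ?_⟩
  · exact Real.rpow_le_rpow_of_exponent_le h1' (by simp)
  · exact Real.rpow_le_rpow_of_exponent_le h1' (by simp)

lemma natCast_rpow (hn : Tendsto n l atTop) (x : ℝ) : Moderate l n (fun i => (n i : ℝ) ^ x) := by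
  refine ⟨|x|, ?_⟩
  filter_upwards [hn.eventually_ge_atTop 1] with i h1
  have h1' : (1 : ℝ) ≤ n i := by exact_mod_cast h1
  exact ⟨Real.rpow_le_rpow_of_exponent_le h1' (neg_abs_le x),
    Real.rpow_le_rpow_of_exponent_le h1' (le_abs_self x)⟩

lemma rpow (hn : Tendsto n l atTop) (hg : Moderate l n g) (x : ℝ) :
    Moderate l n (fun i => g i ^ x) := by
  wlog hx : 0 ≤ x generalizing x
  · have h1 := (this (-x) (by linarith)).inv hn
    refine h1.congr' ?_
    filter_upwards [hg.pos hn] with i hi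
    rw [Real.rpow_neg hi.le, inv_inv]
  have hgp := hg.pos hn
  obtain ⟨K, hK⟩ := hg
  refine ⟨K * x, ?_⟩
  filter_upwards [hK, hgp] with i hi hp
  rw [← neg_mul, Real.rpow_mul (Nat.cast_nonneg _), Real.rpow_mul (Nat.cast_nonneg _)]
  exact ⟨Real.rpow_le_rpow (by positivity) hi.1 hx, Real.rpow_le_rpow hp.le hi.2 hx⟩

lemma comp {κ : Type*} {l' : Filter κ} {u : κ → ι} (hg : Moderate l n g) (hu : Tendsto u l' l) :
    Moderate l' (n ∘ u) (g ∘ u) := by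
  obtain ⟨K, hK⟩ := hg
  exact ⟨K, hu.eventually hK⟩

lemma scale {lam : ℝ} (hlam : 0 < lam) (hn : Tendsto n l atTop) :
    Moderate l n (fun i => scale lam (n i)) := by
  have h1 : Moderate l n (fun i => (n i : ℝ) / lam) := by
    have := (natCast_rpow hn 1).mul hn (of_tendsto hn (inv_pos.2 hlam) tendsto_const_nhds)
    simpa [div_eq_mul_inv] using this
  exact h1.rpow hn (1 / lam)

lemma slow {lam : ℝ} (hlam : 0 < lam) (hn : Tendsto n l atTop) (b c : ℂ) :
    Moderate l n (fun i => ‖slow b c (SaffVarga.scale lam (n i))‖) := by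
  have hr := tendsto_scale hlam hn
  have h1 := Moderate.scale hlam hn
  -- The logarithm is squeezed between `1` and the scale itself, so it needs no estimate of its own.
  have h2 : Moderate l n (fun i => Real.log (SaffVarga.scale lam (n i))) := by
    refine of_between (of_tendsto hn one_pos tendsto_const_nhds) h1 hn ?_
    filter_upwards [(Real.tendsto_log_atTop.comp hr).eventually_ge_atTop 1,
      hr.eventually_gt_atTop 0] with i hi h0
    exact ⟨hi, (Real.log_le_sub_one_of_pos h0).trans (by linarith)⟩
  refine ((h1.rpow hn b.re).mul hn (h2.rpow hn c.re)).congr' ?_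
  filter_upwards [hr.eventually_gt_atTop 1] with i hi
  unfold SaffVarga.slow
  rw [norm_mul, ← Complex.ofReal_log (by linarith),
    Complex.norm_cpow_eq_rpow_re_of_pos (by linarith),
    Complex.norm_cpow_eq_rpow_re_of_pos (Real.log_pos hi)]

end Moderate


/-! ### The remainder as a Cauchy integral. -/

/-- The integrand of the scaled remainder, as a function of `w` on the unit circle. -/
noncomputable def kernel (f : ℂ → ℂ) (r : ℝ) (n : ℕ) (s w : ℂ) : ℂ :=
  f (r * w) * w / (w ^ n * (w - s))

/-- The scaled remainder `(f - p_{n-1})(r s) / s ^ n` of the Maclaurin series as an integral. -/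
noncomputable def remInt (f : ℂ → ℂ) (r : ℝ) (n : ℕ) (s : ℂ) : ℂ :=
  (2 * Real.pi : ℂ)⁻¹ * ∫ t in (0 : ℝ)..2 * Real.pi, kernel f r n s (circleMap 0 1 t)

/-- With `g(w) = f(r w)`, the Cauchy power series of `g(w) / w ^ n` on the unit circle has as its
`k`-th coefficient the `(k + n)`-th Taylor coefficient of `g`. It therefore sums to the Taylor tail
from degree `n` on, divided by `s ^ n`; this is why the index is `n - 1`. -/
theorem sub_partialSum {f : ℂ → ℂ} (hf : Differentiable ℂ f) (r : ℝ) {n : ℕ} (hn : 1 ≤ n)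
    {s : ℂ} (hs : ‖s‖ < 1) :
    f (r * s) - partialSum f (n - 1) (r * s) = s ^ n * remInt f r n s := by
  set g : ℂ → ℂ := fun w => f (r * w) with hg
  have hgd : Differentiable ℂ g := by fun_prop
  have hpi : (2 * Real.pi * Complex.I : ℂ) ≠ 0 := by simp
  have hcirc : CircleIntegrable (fun w => g w / w ^ n) 0 1 := by
    refine ContinuousOn.circleIntegrable zero_le_one ?_
    refine hgd.continuous.continuousOn.div (by fun_prop) ?_
    intro w hw
    have : w ≠ 0 := by
      rintro rfl; simp at hw
    exact pow_ne_zero _ this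
  have h1 := hasSum_two_pi_I_cauchyPowerSeries_integral hcirc hs
  have hterm : ∀ k : ℕ, (∮ z in C(0, 1), (s / (z - 0)) ^ k • (z - 0)⁻¹ • (g z / z ^ n)) =
      2 * Real.pi * Complex.I * (s ^ k * (((k + n).factorial : ℂ)⁻¹ * iteratedDeriv (k + n) g 0)) := by
    intro k
    have h := DiffContOnCl.circleIntegral_one_div_sub_center_pow_smul (c := 0) one_pos (k + n)
      (hgd.diffContOnCl (s := ball 0 1))
    have h' : (∮ z in C(0, 1), (s / (z - 0)) ^ k • (z - 0)⁻¹ • (g z / z ^ n)) =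
        s ^ k * ∮ z in C(0, 1), (1 / (z - 0) ^ (k + n + 1)) • g z := by
      rw [← circleIntegral.integral_const_mul]
      congr 1
      ext z
      simp only [sub_zero, smul_eq_mul]
      -- The point `z = 0` is off the circle, but the integrands are compared everywhere; there both
      -- sides are `0` by the convention on inverses.
      rcases eq_or_ne z 0 with rfl | hz
      · simp
      · rw [div_pow, pow_succ, pow_add]
        field_simp
    rw [h', h, smul_eq_mul]
    field_simp
  simp only [hterm] at h1
  have h2 : HasSum (fun k : ℕ => ((k.factorial : ℂ)⁻¹ • (s - 0) ^ k • iteratedDeriv k g 0)) (g s) :=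
    Complex.hasSum_taylorSeries_of_entire hgd 0 s
  have h3 := (hasSum_nat_add_iff' n).2 h2
  have h4 : HasSum (fun k : ℕ =>
      (((k + n).factorial : ℂ)⁻¹ • (s - 0) ^ (k + n) • iteratedDeriv (k + n) g 0))
      (s ^ n * ((2 * Real.pi * Complex.I)⁻¹ *
        ∮ z in C(0, 1), (z - (0 + s))⁻¹ • (g z / z ^ n))) := by
    have := (h1.mul_left (2 * Real.pi * Complex.I)⁻¹).mul_left (s ^ n)
    convert! this using 2 with k
    rw [inv_mul_cancel_left₀ hpi]
    simp only [smul_eq_mul, sub_zero, pow_add]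
    ring
  have h5 := h3.unique h4
  have h6 : ∑ i ∈ Finset.range n, ((i.factorial : ℂ)⁻¹ • (s - 0) ^ i • iteratedDeriv i g 0) =
      partialSum f (n - 1) (r * s) := by
    unfold partialSum
    rw [Nat.sub_add_cancel hn]
    refine Finset.sum_congr rfl fun i _ => ?_
    rw [hg, iteratedDeriv_comp_const_mul (hf.contDiff) (r : ℂ)]
    simp only [mul_zero, sub_zero, smul_eq_mul, mul_pow]
    ring
  rw [h6] at h5
  rw [show f (r * s) = g s from rfl, h5]
  congr 1
  unfold remInt circleIntegral kernel
  simp only [deriv_circleMap, smul_eq_mul, zero_add]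
  rw [← intervalIntegral.integral_const_mul, ← intervalIntegral.integral_const_mul]
  refine intervalIntegral.integral_congr fun t _ => ?_
  simp only [hg]
  have hI := Complex.I_ne_zero
  field_simp


/-! ### Laplace's method at one saddle point. -/

/-- Gaussian decay of the kernel over the whole sector. Since `λθ / 2 < π`, concavity of `sin` on
`[0, π]` bounds `sin(λ|t|/2)` below by a multiple of `|t|`, and `1 - cos(λt)` is twice its square.
-/
lemma exists_cos_sub_one_le {lam θ : ℝ} (hlam : 0 < lam) (hθ : 0 < θ)
    (hlamθ : lam * θ < 2 * Real.pi) :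
    ∃ c > 0, ∀ t : ℝ, |t| ≤ θ → (Real.cos (lam * t) - 1) / lam ≤ -c * t ^ 2 := by
  set y := lam * θ / 2 with hy
  have hy0 : 0 < y := by positivity
  have hyπ : y < Real.pi := by rw [hy]; linarith
  have hsy : 0 < Real.sin y := Real.sin_pos_of_pos_of_lt_pi hy0 hyπ
  refine ⟨lam / 2 * (Real.sin y / y) ^ 2, by positivity, fun t ht => ?_⟩
  set u := lam * |t| / 2 with hu
  have hu0 : 0 ≤ u := by positivity
  have huy : u ≤ y := by rw [hu, hy]; gcongr
  have hsin : u * (Real.sin y / y) ≤ Real.sin u := by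
    have hconc := strictConcaveOn_sin_Icc.concaveOn
    have h := hconc.2 (Set.left_mem_Icc.2 Real.pi_pos.le) (Set.mem_Icc.2 ⟨hy0.le, hyπ.le⟩)
      (sub_nonneg.2 ((div_le_one hy0).2 huy)) (div_nonneg hu0 hy0.le) (sub_add_cancel 1 (u / y))
    simp only [smul_eq_mul, mul_zero, Real.sin_zero, zero_add] at h
    rw [div_mul_cancel₀ _ hy0.ne'] at h
    calc u * (Real.sin y / y) = u / y * Real.sin y := by ring
      _ ≤ _ := h
  have hcos : Real.cos (lam * t) = 1 - 2 * Real.sin u ^ 2 := by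
    have h1 : Real.cos (lam * t) = Real.cos (2 * u) := by
      rw [← Real.cos_abs, abs_mul, abs_of_pos hlam]; congr 1; rw [hu]; ring
    rw [h1, Real.cos_two_mul, Real.cos_sq']; ring
  have hsq : (u * (Real.sin y / y)) ^ 2 ≤ Real.sin u ^ 2 :=
    pow_le_pow_left₀ (by positivity) hsin 2
  rw [hcos, div_le_iff₀ hlam]
  have hut : u ^ 2 = lam ^ 2 * t ^ 2 / 4 := by rw [hu, div_pow, mul_pow, sq_abs]; ring
  rw [mul_pow, hut] at hsq
  nlinarith [hsq]

lemma tendsto_exp_second_order {lam : ℝ} (hlam : 0 < lam) {ι : Type*} {l : Filter ι} {n : ι → ℕ}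
    (hn : Tendsto n l atTop) (x : ℝ) :
    Tendsto (fun i => (n i / lam : ℂ) * (Complex.exp (lam * (x / √(n i) : ℝ) * Complex.I) - 1 -
      lam * (x / √(n i) : ℝ) * Complex.I)) l (𝓝 ((-(lam / 2) * x ^ 2 : ℝ) : ℂ)) := by
  have hn' : Tendsto (fun i => √(n i : ℝ)) l atTop :=
    Real.tendsto_sqrt_atTop.comp (tendsto_natCast_atTop_atTop.comp hn)
  have hz : Tendsto (fun i => lam * |x| / √(n i : ℝ)) l (𝓝 0) := hn'.const_div_atTop _
  rw [tendsto_iff_norm_sub_tendsto_zero]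
  have hb : Tendsto (fun i => lam ^ 2 * |x| ^ 3 / √(n i : ℝ)) l (𝓝 0) := hn'.const_div_atTop _
  refine squeeze_zero' (Eventually.of_forall fun _ => norm_nonneg _) ?_ hb
  filter_upwards [hz.eventually_le_const one_pos, hn.eventually_ge_atTop 1] with i hi h1
  have h0 : (0 : ℝ) < n i := by exact_mod_cast h1
  have hs0 : 0 < √(n i : ℝ) := Real.sqrt_pos.2 h0
  have hsq : √(n i : ℝ) ^ 2 = n i := Real.sq_sqrt h0.le
  set z : ℂ := lam * (x / √(n i) : ℝ) * Complex.I with hzdef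
  have hznorm : ‖z‖ = lam * |x| / √(n i : ℝ) := by
    rw [hzdef, norm_mul, norm_mul, Complex.norm_I, Complex.norm_real, Complex.norm_real,
      Real.norm_eq_abs, Real.norm_eq_abs, abs_div, abs_of_pos hlam, abs_of_pos hs0]
    ring
  have hexp : ‖Complex.exp z - (1 + z + z ^ 2 / 2)‖ ≤ ‖z‖ ^ 3 := by
    have h := Complex.exp_bound (x := z) (by rw [hznorm]; exact hi) (n := 3) (by norm_num)
    simp only [Finset.sum_range_succ, Finset.sum_range_zero] at h
    norm_num [Nat.factorial] at h
    refine h.trans ?_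
    have : 0 ≤ ‖z‖ ^ 3 := by positivity
    linarith
  have hz2 : z ^ 2 = ((-(lam ^ 2 * x ^ 2 / n i) : ℝ) : ℂ) := by
    have hsq' : ((√(n i : ℝ) : ℝ) : ℂ) ^ 2 = n i := by exact_mod_cast hsq
    rw [hzdef, mul_pow, Complex.I_sq]
    push_cast
    rw [mul_pow, div_pow, hsq']
    ring
  have heq : (n i / lam : ℂ) * (Complex.exp z - 1 - z) - ((-(lam / 2) * x ^ 2 : ℝ) : ℂ) =
      (n i / lam : ℂ) * (Complex.exp z - (1 + z + z ^ 2 / 2)) := by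
    have hne : (n i : ℂ) ≠ 0 := by exact_mod_cast h0.ne'
    have hle : (lam : ℂ) ≠ 0 := by exact_mod_cast hlam.ne'
    rw [hz2]
    push_cast
    field_simp
    ring
  rw [heq, norm_mul]
  have hnl : ‖(n i / lam : ℂ)‖ = n i / lam := by
    rw [norm_div, Complex.norm_real, Complex.norm_natCast, Real.norm_of_nonneg hlam.le]
  rw [hnl]
  calc (n i : ℝ) / lam * ‖Complex.exp z - (1 + z + z ^ 2 / 2)‖ ≤ n i / lam * ‖z‖ ^ 3 := by gcongr
    _ = lam ^ 2 * |x| ^ 3 / √(n i : ℝ) := by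
      rw [hznorm]
      nth_rewrite 1 [← hsq]
      field_simp

/-- The saddle has width `n^{-1/2}`, so `|w - 1|` is of that order. The Cauchy factor is then
constant across the saddle precisely when `1 - |s|` is much larger than `n^{-1/2}`. -/
lemma norm_div_le_one_add {ζ w s : ℂ} (hζ : ‖ζ‖ = 1) (hw : ‖w‖ = 1) (hs : ‖s‖ < 1) :
    ‖(ζ - s) / (ζ * w - s) - 1‖ ≤ ‖w - 1‖ / (1 - ‖s‖) := by
  have h1 : 1 - ‖s‖ ≤ ‖ζ * w - s‖ := by
    have := norm_sub_norm_le (ζ * w) s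
    rwa [norm_mul, hζ, hw, one_mul] at this
  have h0 : 0 < 1 - ‖s‖ := by linarith
  have hne : ζ * w - s ≠ 0 := norm_pos_iff.1 (h0.trans_le h1)
  rw [div_sub_one hne, norm_div]
  have : ‖ζ - s - (ζ * w - s)‖ = ‖w - 1‖ := by
    rw [show ζ - s - (ζ * w - s) = -(ζ * (w - 1)) by ring, norm_neg, norm_mul, hζ, one_mul]
  rw [this]
  gcongr

/-- Factorization of the kernel near a saddle point. -/
lemma kernel_factor {lam : ℝ} (hlam : 0 < lam) {n : ℕ} (hn : 1 ≤ n) (hr : 1 < scale lam n)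
    (f : ℂ → ℂ) {ζ s : ℂ} (hζ : ‖ζ‖ = 1) (hs : ‖s‖ < 1) (b c : ℂ) {t : ℝ}
    (ht : |t| < Real.pi) :
    kernel f (scale lam n) n s (ζ * Complex.exp (t * Complex.I)) * (ζ ^ n / ζ * (ζ - s)) /
        (slow b c (scale lam n) * Complex.exp (n / lam)) =
      (f (scale lam n * (ζ * Complex.exp (t * Complex.I))) /
        (slow b c (scale lam n * (ζ * Complex.exp (t * Complex.I)) / ζ) *
          Complex.exp ((scale lam n * (ζ * Complex.exp (t * Complex.I)) / ζ) ^ (lam : ℂ)))) *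
      (Complex.exp (t * Complex.I) ^ b *
        (1 + t * Complex.I / (Real.log (scale lam n) : ℂ)) ^ c) *
      Complex.exp ((n / lam : ℂ) * (Complex.exp (lam * t * Complex.I) - 1 -
        lam * t * Complex.I)) *
      (Complex.exp (t * Complex.I) * ((ζ - s) / (ζ * Complex.exp (t * Complex.I) - s))) := by
  set r := scale lam n with hrdef
  set w := Complex.exp (t * Complex.I) with hw
  have hw0 : w ≠ 0 := Complex.exp_ne_zero _
  have hζ0 : ζ ≠ 0 := by
    rintro rfl; simp at hζ
  have hlog : Complex.log w = t * Complex.I := by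
    rw [hw, Complex.log_exp] <;> simp <;> linarith [abs_lt.1 ht]
  have hdiv : (r : ℂ) * (ζ * w) / ζ = r * w := by field_simp
  have hlam' : (lam : ℂ) ≠ 0 := by exact_mod_cast hlam.ne'
  have hwl : w ^ (lam : ℂ) = Complex.exp (lam * t * Complex.I) := by
    rw [Complex.cpow_def_of_ne_zero hw0, hlog]; congr 1; ring
  have hwn : w ^ n = Complex.exp (n * (t * Complex.I)) := by
    rw [hw, Complex.exp_nat_mul]
  have hslow0 : slow b c r ≠ 0 := slow_ne_zero (by
    rw [Complex.norm_real, Real.norm_of_nonneg (by linarith)]; exact hr) b c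
  have hslow := slow_mul hr hw0 b c
  have hslow1 : slow b c (r * w) ≠ 0 := slow_ne_zero (by
    rw [norm_mul, Complex.norm_real, Real.norm_of_nonneg (by linarith), hw,
      Complex.norm_exp_ofReal_mul_I, mul_one]; exact hr) b c
  rw [hlog] at hslow
  rw [hdiv, scale_mul_cpow hlam hn, hwl]
  have hratio : w ^ b * (1 + t * Complex.I / (Real.log r : ℂ)) ^ c =
      slow b c (r * w) / slow b c r := by rw [hslow]; field_simp
  -- The linear term comes from `w ^ n = e^{int}`. It cancels the linear term of the exponential
  -- because `r_n ^ λ = n / λ`, so `t = 0` is a saddle point.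
  have hexp : Complex.exp ((n / lam : ℂ) * (Complex.exp (lam * t * Complex.I) - 1 -
        lam * t * Complex.I)) = Complex.exp ((n / lam : ℂ) * Complex.exp (lam * t * Complex.I)) /
        (Complex.exp (n / lam) * w ^ n) := by
    rw [hwn, ← Complex.exp_add, ← Complex.exp_sub]
    congr 1; field_simp; ring
  have hne : ζ * w - s ≠ 0 := by
    intro h
    have : ‖s‖ = 1 := by
      rw [← sub_eq_zero.1 h, norm_mul, hζ, hw, Complex.norm_exp_ofReal_mul_I, one_mul]
    linarith
  rw [hratio, hexp]
  unfold kernel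
  have he1 := Complex.exp_ne_zero ((n / lam : ℂ) * Complex.exp (lam * t * Complex.I))
  have he2 := Complex.exp_ne_zero (n / lam : ℂ)
  rw [mul_pow]
  field_simp


/-- Provides a constant for the dominating function in Laplace's method: arguments are bounded by
`π`, and the base of the second power tends to `1` uniformly in `t` as `r` grows. -/
lemma exists_cpow_factor_bound (b c : ℂ) : ∃ C > 0, ∃ R : ℝ, ∀ r t : ℝ, R ≤ r →
    |t| ≤ Real.pi → ‖Complex.exp (t * Complex.I) ^ b *
      (1 + t * Complex.I / (Real.log r : ℂ)) ^ c‖ ≤ C := by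
  have h3 : ContinuousAt (fun z : ℂ => z ^ c) 1 := continuousAt_cpow_const (by simp)
  have h4 : ∀ᶠ z : ℂ in 𝓝 1, ‖z ^ c‖ < 2 :=
    h3.norm.tendsto.eventually_lt_const (by simp)
  obtain ⟨δ, hδ, h5⟩ := Metric.eventually_nhds_iff.1 h4
  have h6 := (Real.tendsto_log_atTop.const_div_atTop Real.pi).eventually_lt_const hδ
  obtain ⟨R, hR⟩ := eventually_atTop.1 (h6.and (eventually_gt_atTop 1))
  refine ⟨Real.exp (Real.pi * ‖b‖ + Real.pi * ‖b‖) * 2, by positivity, R, fun r t hr ht => ?_⟩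
  obtain ⟨h7, h8⟩ := hR r hr
  have hlog := Real.log_pos h8
  rw [norm_mul]
  refine mul_le_mul ?_ (h5 ?_).le (norm_nonneg _) (by positivity)
  · have h := Complex.norm_cpow_le (Complex.exp (t * Complex.I)) b
    refine h.trans ?_
    rw [Complex.norm_exp_ofReal_mul_I, Real.one_rpow, one_div, ← Real.exp_neg]
    refine Real.exp_le_exp.2 ?_
    have h9 := Complex.abs_arg_le_pi (Complex.exp (t * Complex.I))
    have h10 : |(Complex.exp (t * Complex.I)).arg * b.im| ≤ Real.pi * ‖b‖ := by
      rw [abs_mul]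
      exact mul_le_mul h9 (Complex.abs_im_le_norm b) (abs_nonneg _) Real.pi_pos.le
    have h11 : 0 ≤ Real.pi * ‖b‖ := by positivity
    linarith [neg_abs_le ((Complex.exp (t * Complex.I)).arg * b.im)]
  · rw [dist_eq_norm, add_sub_cancel_left, norm_div, Complex.norm_real,
      Real.norm_of_nonneg hlog.le, norm_mul, Complex.norm_I, mul_one, Complex.norm_real,
      Real.norm_eq_abs]
    exact lt_of_le_of_lt (by gcongr) h7

lemma tendsto_norm_ofReal_mul_cobounded {ι : Type*} {l : Filter ι} {r : ι → ℝ} {w : ι → ℂ}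
    (hr : Tendsto r l atTop) {c : ℝ} (hc : 0 < c) (hw : ∀ᶠ i in l, c ≤ ‖w i‖) :
    Tendsto (fun i => (r i : ℂ) * w i) l (Bornology.cobounded ℂ) := by
  rw [← tendsto_norm_atTop_iff_cobounded]
  refine tendsto_atTop_mono' l ?_ (hr.atTop_mul_const hc)
  filter_upwards [hw, hr.eventually_ge_atTop 0] with i hi h0
  rw [norm_mul, Complex.norm_real, Real.norm_of_nonneg h0]
  gcongr


lemma continuousOn_kernel {f : ℂ → ℂ} (hf : Continuous f) (r : ℝ) (n : ℕ) {ζ s : ℂ}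
    (hζ : ‖ζ‖ = 1) (hs : ‖s‖ < 1) :
    Continuous fun t : ℝ => kernel f r n s (ζ * Complex.exp (t * Complex.I)) := by
  unfold kernel
  refine Continuous.div (by fun_prop) (by fun_prop) fun t => ?_
  have h1 : ‖ζ * Complex.exp (t * Complex.I)‖ = 1 := by
    rw [norm_mul, hζ, Complex.norm_exp_ofReal_mul_I, one_mul]
  refine mul_ne_zero (pow_ne_zero _ (norm_pos_iff.1 (by rw [h1]; exact one_pos))) ?_
  intro h
  rw [sub_eq_zero.1 h] at h1
  linarith

/-- Laplace's method for the part of the remainder integral over one sector. -/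
theorem tendsto_sector_integral {lam θ : ℝ} (hlam : 0 < lam) (hθ : 0 < θ) (hθπ : θ < Real.pi)
    (hlamθ : lam * θ < 2 * Real.pi) {f : ℂ → ℂ} (hf : Continuous f) {A b c ζ : ℂ}
    (hζ : ‖ζ‖ = 1)
    (main : Tendsto (fun z => f z / (slow b c (z / ζ) * Complex.exp ((z / ζ) ^ (lam : ℂ))))
      (Bornology.cobounded ℂ ⊓ 𝓟 (sector θ ζ)) (𝓝 A))
    {ι : Type*} {l : Filter ι} [l.IsCountablyGenerated] {n : ι → ℕ} {s : ι → ℂ}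
    (hn : Tendsto n l atTop) (hs : Tendsto (fun i => √(n i : ℝ) * (1 - ‖s i‖)) l atTop) :
    Tendsto (fun i => √(n i : ℝ) * ((∫ t in (-θ)..θ,
        kernel f (scale lam (n i)) (n i) (s i) (ζ * Complex.exp (t * Complex.I))) *
        (ζ ^ n i / ζ * (ζ - s i)) / (slow b c (scale lam (n i)) * Complex.exp (n i / lam)))) l
      (𝓝 (A * (√(2 * Real.pi / lam) : ℝ))) := by
  have hζ0 : ζ ≠ 0 := by
    rintro rfl; simp at hζ
  have hnr : Tendsto (fun i => (n i : ℝ)) l atTop := tendsto_natCast_atTop_atTop.comp hn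
  have hsq : Tendsto (fun i => √(n i : ℝ)) l atTop := Real.tendsto_sqrt_atTop.comp hnr
  have hr := tendsto_scale hlam hn
  have hs1 : ∀ᶠ i in l, ‖s i‖ < 1 := by
    filter_upwards [hs.eventually_gt_atTop 0] with i hi
    by_contra! h
    nlinarith [Real.sqrt_nonneg (n i : ℝ)]
  set Ψ : ι → ℝ → ℂ := fun i t =>
    kernel f (scale lam (n i)) (n i) (s i) (ζ * Complex.exp (t * Complex.I)) *
      (ζ ^ n i / ζ * (ζ - s i)) / (slow b c (scale lam (n i)) * Complex.exp (n i / lam)) with hΨ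
  -- The substitution `t = x / √n` produces the factor `√n` and spreads the integrand over the whole
  -- line, where its limit is a Gaussian.
  set Φ : ι → ℝ → ℂ := fun i x => (Set.Icc (-θ) θ).indicator (Ψ i) (x / √(n i : ℝ)) with hΦ
  have hint : ∀ᶠ i in l, ∫ x, Φ i x = √(n i : ℝ) * ((∫ t in (-θ)..θ,
        kernel f (scale lam (n i)) (n i) (s i) (ζ * Complex.exp (t * Complex.I))) *
        (ζ ^ n i / ζ * (ζ - s i)) / (slow b c (scale lam (n i)) * Complex.exp (n i / lam))) := by
    refine Eventually.of_forall fun i => ?_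
    rw [hΦ]
    simp only
    rw [MeasureTheory.Measure.integral_comp_div, MeasureTheory.integral_indicator measurableSet_Icc,
      MeasureTheory.integral_Icc_eq_integral_Ioc,
      ← intervalIntegral.integral_of_le (by linarith), abs_of_nonneg (Real.sqrt_nonneg _),
      hΨ, Complex.real_smul]
    simp only
    rw [intervalIntegral.integral_div, intervalIntegral.integral_mul_const]
  have hgauss : ∫ x : ℝ, A * Complex.exp ((-(lam / 2) * x ^ 2 : ℝ) : ℂ) =
      A * (√(2 * Real.pi / lam) : ℝ) := by
    rw [MeasureTheory.integral_const_mul]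
    congr 1
    have h := integral_gaussian (lam / 2)
    rw [show Real.pi / (lam / 2) = 2 * Real.pi / lam by field_simp] at h
    rw [← h, ← integral_complex_ofReal]
    simp only [Complex.ofReal_exp]
  rw [← hgauss]
  refine Tendsto.congr' hint ?_
  obtain ⟨κ, hκ, hcos⟩ := exists_cos_sub_one_le hlam hθ hlamθ
  obtain ⟨C, hC, R, hCR⟩ := exists_cpow_factor_bound b c
  have hfac : ∀ᶠ i in l, ∀ x : ℝ, |x / √(n i : ℝ)| ≤ θ → Ψ i (x / √(n i : ℝ)) =
      (f (scale lam (n i) * (ζ * Complex.exp ((x / √(n i : ℝ) : ℝ) * Complex.I))) /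
        (slow b c (scale lam (n i) * (ζ * Complex.exp ((x / √(n i : ℝ) : ℝ) * Complex.I)) / ζ) *
          Complex.exp ((scale lam (n i) *
            (ζ * Complex.exp ((x / √(n i : ℝ) : ℝ) * Complex.I)) / ζ) ^ (lam : ℂ)))) *
      (Complex.exp ((x / √(n i : ℝ) : ℝ) * Complex.I) ^ b *
        (1 + (x / √(n i : ℝ) : ℝ) * Complex.I / (Real.log (scale lam (n i)) : ℂ)) ^ c) *
      Complex.exp ((n i / lam : ℂ) *
        (Complex.exp (lam * (x / √(n i : ℝ) : ℝ) * Complex.I) - 1 -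
        lam * (x / √(n i : ℝ) : ℝ) * Complex.I)) *
      (Complex.exp ((x / √(n i : ℝ) : ℝ) * Complex.I) *
        ((ζ - s i) / (ζ * Complex.exp ((x / √(n i : ℝ) : ℝ) * Complex.I) - s i))) := by
    filter_upwards [hn.eventually_ge_atTop 1, hr.eventually_gt_atTop 1, hs1] with i h1 h2 h3 x hx
    exact kernel_factor hlam h1 h2 f hζ h3 b c (hx.trans_lt hθπ)
  have hsec : ∀ t : ℝ, |t| ≤ θ → ∀ r : ℝ, 0 < r →
      (r : ℂ) * (ζ * Complex.exp (t * Complex.I)) ∈ sector θ ζ := by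
    intro t ht r hr0
    have hr' : (r : ℂ) ≠ 0 := by exact_mod_cast hr0.ne'
    refine ⟨mul_ne_zero hr' (mul_ne_zero hζ0 (Complex.exp_ne_zero _)), ?_⟩
    rw [show (r : ℂ) * (ζ * Complex.exp (t * Complex.I)) / ζ = r * Complex.exp (t * Complex.I) by
      field_simp, Complex.arg_real_mul _ hr0, Complex.arg_exp_mul_I]
    have : toIocMod Real.two_pi_pos (-Real.pi) t = t := by
      rw [toIocMod_eq_self]
      have := abs_le.1 ht
      constructor <;> linarith
    rw [this]; exact ht
  have hfb : ∀ᶠ i in l, ∀ t : ℝ, |t| ≤ θ →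
      ‖f (scale lam (n i) * (ζ * Complex.exp (t * Complex.I))) /
        (slow b c (scale lam (n i) * (ζ * Complex.exp (t * Complex.I)) / ζ) *
          Complex.exp ((scale lam (n i) * (ζ * Complex.exp (t * Complex.I)) / ζ) ^ (lam : ℂ)))‖ ≤
        ‖A‖ + 1 := by
    have h1 := main.norm.eventually_le_const (lt_add_one ‖A‖)
    rw [eventually_inf_principal, ← comap_norm_atTop, eventually_comap] at h1
    filter_upwards [hr.eventually h1, hr.eventually_gt_atTop 0] with i hi h0 t ht
    refine hi _ ?_ (hsec t ht _ h0)
    rw [norm_mul, norm_mul, hζ, Complex.norm_exp_ofReal_mul_I, Complex.norm_real,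
      Real.norm_of_nonneg h0.le]; ring
  have hsfac : ∀ᶠ i in l, ∀ x : ℝ,
      ‖(ζ - s i) / (ζ * Complex.exp ((x / √(n i : ℝ) : ℝ) * Complex.I) - s i) - 1‖ ≤
        |x| / (√(n i : ℝ) * (1 - ‖s i‖)) := by
    filter_upwards [hs1, hsq.eventually_gt_atTop 0] with i h1 h0 x
    refine (norm_div_le_one_add hζ (Complex.norm_exp_ofReal_mul_I _) h1).trans ?_
    have h2 : ‖Complex.exp ((x / √(n i : ℝ) : ℝ) * Complex.I) - 1‖ ≤ |x| / √(n i : ℝ) := by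
      have := Real.norm_exp_I_mul_ofReal_sub_one_le (x := x / √(n i : ℝ))
      rw [mul_comm] at this
      rwa [Real.norm_eq_abs, abs_div, abs_of_pos h0] at this
    have h3 : 0 < 1 - ‖s i‖ := by linarith
    rw [← div_div]
    gcongr
  -- The term with `|x|` in the majorant accounts for the Cauchy factor, which differs from `1` by
  -- at most `|x| / (√n (1 - |s|)) ≤ |x|`.
  refine MeasureTheory.tendsto_integral_filter_of_dominated_convergence
    (fun x => (‖A‖ + 1) * C * (Real.exp (-κ * x ^ 2) + |x| * Real.exp (-κ * x ^ 2))) ?_ ?_ ?_ ?_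
  · filter_upwards [hs1] with i h1
    refine Measurable.aestronglyMeasurable ?_
    have hm : Measurable (Ψ i) := by
      have := (continuousOn_kernel hf (scale lam (n i)) (n i) hζ h1).measurable
      rw [hΨ]
      fun_prop
    exact (hm.indicator measurableSet_Icc).comp (measurable_id.div_const _)
  · filter_upwards [hfac, hfb, hsfac, hs.eventually_ge_atTop 1, hr.eventually_ge_atTop R,
      hn.eventually_ge_atTop 1] with i h1 h2 h3 h4 h5 h6
    refine Eventually.of_forall fun x => ?_
    have h0 : (0 : ℝ) < n i := by exact_mod_cast h6
    rw [hΦ]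
    simp only
    by_cases hx : |x / √(n i : ℝ)| ≤ θ
    · rw [Set.indicator_of_mem (Set.mem_Icc.2 (abs_le.1 hx)), h1 x hx, norm_mul, norm_mul, norm_mul]
      have e3 : ‖Complex.exp ((n i / lam : ℂ) *
          (Complex.exp (lam * (x / √(n i : ℝ) : ℝ) * Complex.I) - 1 -
          lam * (x / √(n i : ℝ) : ℝ) * Complex.I))‖ ≤ Real.exp (-κ * x ^ 2) := by
        rw [Complex.norm_exp]
        refine Real.exp_le_exp.2 ?_
        have hre : ((n i / lam : ℂ) * (Complex.exp (lam * (x / √(n i : ℝ) : ℝ) * Complex.I) - 1 -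
          lam * (x / √(n i : ℝ) : ℝ) * Complex.I)).re =
            n i * ((Real.cos (lam * (x / √(n i : ℝ))) - 1) / lam) := by
          rw [← Complex.ofReal_natCast, ← Complex.ofReal_div, Complex.re_ofReal_mul,
            ← Complex.ofReal_mul]
          simp only [Complex.sub_re, Complex.exp_ofReal_mul_I_re, Complex.one_re, Complex.mul_I_re,
            Complex.ofReal_im]
          ring
        rw [hre]
        calc n i * ((Real.cos (lam * (x / √(n i : ℝ))) - 1) / lam)
            ≤ n i * (-κ * (x / √(n i : ℝ)) ^ 2) := by
              gcongr
              exact hcos _ hx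
          _ = -κ * x ^ 2 := by
            rw [div_pow, Real.sq_sqrt h0.le]; field_simp
      have e4 : ‖Complex.exp ((x / √(n i : ℝ) : ℝ) * Complex.I) *
          ((ζ - s i) / (ζ * Complex.exp ((x / √(n i : ℝ) : ℝ) * Complex.I) - s i))‖ ≤ 1 + |x| := by
        rw [norm_mul, Complex.norm_exp_ofReal_mul_I, one_mul]
        have h7 := h3 x
        have h8 : |x| / (√(n i : ℝ) * (1 - ‖s i‖)) ≤ |x| := div_le_self (abs_nonneg _) h4
        have h9 := norm_sub_norm_le
          ((ζ - s i) / (ζ * Complex.exp ((x / √(n i : ℝ) : ℝ) * Complex.I) - s i)) 1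
        rw [norm_one] at h9
        linarith
      have e2 := hCR (scale lam (n i)) (x / √(n i : ℝ)) h5 (hx.trans hθπ.le)
      have e1 := h2 _ hx
      calc _ ≤ (‖A‖ + 1) * C * Real.exp (-κ * x ^ 2) * (1 + |x|) := by gcongr
        _ = _ := by ring
    · rw [Set.indicator_of_notMem (by rwa [Set.mem_Icc, ← abs_le]), norm_zero]
      positivity
  · refine MeasureTheory.Integrable.const_mul ?_ _
    refine (integrable_exp_neg_mul_sq hκ).add ?_
    have := (integrable_mul_exp_neg_mul_sq hκ).norm
    simpa [abs_of_pos (Real.exp_pos _)] using this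
  · refine Eventually.of_forall fun x => ?_
    have ht : Tendsto (fun i => x / √(n i : ℝ)) l (𝓝 0) := hsq.const_div_atTop x
    have hxev : ∀ᶠ i in l, |x / √(n i : ℝ)| ≤ θ :=
      (by simpa using ht.abs : Tendsto _ l (𝓝 (0 : ℝ))).eventually_le_const hθ
    have hev : ∀ᶠ i in l,
        (f (scale lam (n i) * (ζ * Complex.exp ((x / √(n i : ℝ) : ℝ) * Complex.I))) /
          (slow b c (scale lam (n i) * (ζ * Complex.exp ((x / √(n i : ℝ) : ℝ) * Complex.I)) / ζ) *
            Complex.exp ((scale lam (n i) *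
              (ζ * Complex.exp ((x / √(n i : ℝ) : ℝ) * Complex.I)) / ζ) ^ (lam : ℂ)))) *
        (Complex.exp ((x / √(n i : ℝ) : ℝ) * Complex.I) ^ b *
          (1 + (x / √(n i : ℝ) : ℝ) * Complex.I / (Real.log (scale lam (n i)) : ℂ)) ^ c) *
        Complex.exp ((n i / lam : ℂ) *
          (Complex.exp (lam * (x / √(n i : ℝ) : ℝ) * Complex.I) - 1 -
          lam * (x / √(n i : ℝ) : ℝ) * Complex.I)) *
        (Complex.exp ((x / √(n i : ℝ) : ℝ) * Complex.I) *
          ((ζ - s i) / (ζ * Complex.exp ((x / √(n i : ℝ) : ℝ) * Complex.I) - s i))) = Φ i x := by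
      filter_upwards [hfac, hxev] with i h1 h2
      rw [hΦ]
      simp only
      rw [Set.indicator_of_mem (Set.mem_Icc.2 (abs_le.1 h2))]
      exact (h1 x h2).symm
    refine Tendsto.congr' hev ?_
    have hexp1 : Tendsto (fun i => Complex.exp ((x / √(n i : ℝ) : ℝ) * Complex.I)) l (𝓝 1) := by
      have : Continuous fun t : ℝ => Complex.exp ((t : ℂ) * Complex.I) := by fun_prop
      simpa [Function.comp_def] using (this.tendsto 0).comp ht
    have T1 : Tendsto (fun i => (f (scale lam (n i) *
        (ζ * Complex.exp ((x / √(n i : ℝ) : ℝ) * Complex.I))) /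
        (slow b c (scale lam (n i) * (ζ * Complex.exp ((x / √(n i : ℝ) : ℝ) * Complex.I)) / ζ) *
          Complex.exp ((scale lam (n i) *
            (ζ * Complex.exp ((x / √(n i : ℝ) : ℝ) * Complex.I)) / ζ) ^ (lam : ℂ))))) l (𝓝 A) := by
      refine main.comp (f := fun i => (scale lam (n i) : ℂ) *
        (ζ * Complex.exp ((x / √(n i : ℝ) : ℝ) * Complex.I))) (tendsto_inf.2 ⟨?_, ?_⟩)
      · refine tendsto_norm_ofReal_mul_cobounded hr one_pos (Eventually.of_forall fun i => ?_)
        rw [norm_mul, hζ, Complex.norm_exp_ofReal_mul_I, one_mul]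
      · rw [tendsto_principal]
        filter_upwards [hxev, hr.eventually_gt_atTop 0] with i h1 h2
        exact hsec _ h1 _ h2
    have T2 : Tendsto (fun i => Complex.exp ((x / √(n i : ℝ) : ℝ) * Complex.I) ^ b *
        (1 + (x / √(n i : ℝ) : ℝ) * Complex.I / (Real.log (scale lam (n i)) : ℂ)) ^ c) l (𝓝 1) := by
      have h1 : Tendsto (fun i => Complex.exp ((x / √(n i : ℝ) : ℝ) * Complex.I) ^ b) l (𝓝 1) := by
        have h3 : ContinuousAt (fun z : ℂ => z ^ b) 1 := continuousAt_cpow_const (by simp)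
        simpa [Function.comp_def] using h3.tendsto.comp hexp1
      have h2 := tendsto_one_add_log_div_cpow
        (s := fun i => Complex.exp ((x / √(n i : ℝ) : ℝ) * Complex.I)) hr (C := θ) (c := c) (by
          filter_upwards [hxev] with i hi
          have := abs_le.1 hi
          rw [Complex.log_exp (by simp only [Complex.mul_I_im, Complex.ofReal_re]; linarith)
            (by simp only [Complex.mul_I_im, Complex.ofReal_re]; linarith), norm_mul,
            Complex.norm_I, mul_one, Complex.norm_real]
          exact hi)
      have h3 := h1.mul h2
      rw [one_mul] at h3
      refine h3.congr' ?_
      filter_upwards [hxev] with i hi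
      have := abs_le.1 hi
      rw [Complex.log_exp (by simp only [Complex.mul_I_im, Complex.ofReal_re]; linarith)
            (by simp only [Complex.mul_I_im, Complex.ofReal_re]; linarith)]
    have T3 := (Complex.continuous_exp.tendsto _).comp (tendsto_exp_second_order hlam hn x)
    have T4 : Tendsto (fun i => Complex.exp ((x / √(n i : ℝ) : ℝ) * Complex.I) *
        ((ζ - s i) / (ζ * Complex.exp ((x / √(n i : ℝ) : ℝ) * Complex.I) - s i))) l (𝓝 1) := by
      have h1 : Tendsto (fun i =>
          (ζ - s i) / (ζ * Complex.exp ((x / √(n i : ℝ) : ℝ) * Complex.I) - s i)) l (𝓝 1) := by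
        rw [tendsto_iff_norm_sub_tendsto_zero]
        refine squeeze_zero' (Eventually.of_forall fun _ => norm_nonneg _) ?_
          (hs.const_div_atTop |x|)
        filter_upwards [hsfac] with i hi
        exact hi x
      simpa using hexp1.mul h1
    have := ((T1.mul T2).mul T3).mul T4
    simp only [mul_one] at this
    exact this


/-! ### Decomposition of the circle and asymptotics of the remainder. -/

/-- Common generalization of `OneDirection` and `ManyDirections`: power-logarithmic subexponential
factors in several directions. -/
structure Growth (f : ℂ → ℂ) {m : ℕ} (A b c ζ : Fin (m + 1) → ℂ) (lam mu θ : ℝ) : Prop where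
  entire : Differentiable ℂ f
  coeff_ne : ∀ k, A k ≠ 0
  dir_zero : ζ 0 = 1
  dir_norm : ∀ k, ‖ζ k‖ = 1
  disjoint : ∀ j k, j ≠ k → Disjoint (sector θ (ζ j)) (sector θ (ζ k))
  main : ∀ k, Tendsto
    (fun z => f z / (slow (b k) (c k) (z / ζ k) * Complex.exp ((z / ζ k) ^ (lam : ℂ))))
    (Bornology.cobounded ℂ ⊓ 𝓟 (sector θ (ζ k))) (𝓝 (A k))
  other : ExpBoundIn (⋃ k, sector θ (ζ k))ᶜ f mu lam

lemma measurableSet_sector (θ : ℝ) (ζ : ℂ) : MeasurableSet (sector θ ζ) := by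
  have h1 : Measurable fun z : ℂ => |(z / ζ).arg| :=
    (Complex.measurable_arg.comp (measurable_id.div_const ζ)).norm
  exact (measurableSet_singleton (0 : ℂ)).compl.inter (measurableSet_le h1 measurable_const)

lemma mul_exp_mem_sector_iff {θ t : ℝ} {ζ : ℂ} (hζ : ζ ≠ 0) (ht : t ∈ Set.Ioc (-Real.pi) Real.pi) :
    ζ * Complex.exp (t * Complex.I) ∈ sector θ ζ ↔ |t| ≤ θ := by
  have h0 : ζ * Complex.exp (t * Complex.I) ≠ 0 := mul_ne_zero hζ (Complex.exp_ne_zero _)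
  have h1 : toIocMod Real.two_pi_pos (-Real.pi) t = t := by
    rw [toIocMod_eq_self]
    exact ⟨ht.1, by linarith [ht.2]⟩
  simp only [sector, Set.mem_ofPred_eq, mul_div_cancel_left₀ _ hζ, Complex.arg_exp_mul_I, h1,
    ne_eq, h0, not_false_eq_true, true_and]

lemma ofReal_mul_mem_sector_iff {θ r : ℝ} {ζ w : ℂ} (hr : 0 < r) :
    (r : ℂ) * w ∈ sector θ ζ ↔ w ∈ sector θ ζ := by
  have hr' : (r : ℂ) ≠ 0 := by exact_mod_cast hr.ne'
  simp only [sector, Set.mem_ofPred_eq, mul_div_assoc, Complex.arg_real_mul _ hr, ne_eq,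
    mul_eq_zero, hr', false_or]

/-- By periodicity the circle may be parametrized from the point opposite to `ζ`. The sector then
corresponds to one interval inside `(-π, π]`, without wrapping around. -/
lemma integral_indicator_sector {θ : ℝ} (hθ : 0 < θ) (hθπ : θ < Real.pi) {ζ : ℂ} (hζ : ‖ζ‖ = 1)
    (G : ℂ → ℂ) :
    ∫ t in (0 : ℝ)..2 * Real.pi, (sector θ ζ).indicator G (circleMap 0 1 t) =
      ∫ t in (-θ)..θ, G (ζ * Complex.exp (t * Complex.I)) := by
  have hζ0 : ζ ≠ 0 := by
    rintro rfl; simp at hζ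
  have hper : Function.Periodic (fun t : ℝ => (sector θ ζ).indicator G (circleMap 0 1 t))
      (2 * Real.pi) := fun t => by simp only [periodic_circleMap 0 1 t]
  have hζe : ζ = Complex.exp (ζ.arg * Complex.I) := by
    have := Complex.norm_mul_exp_arg_mul_I ζ
    rw [hζ] at this
    simpa using this.symm
  have h1 := hper.intervalIntegral_add_eq 0 (-Real.pi + ζ.arg)
  rw [zero_add] at h1
  rw [h1, show -Real.pi + ζ.arg + 2 * Real.pi = Real.pi + ζ.arg by ring,
    ← intervalIntegral.integral_comp_add_right]
  have h2 : ∀ t : ℝ, circleMap 0 1 (t + ζ.arg) = ζ * Complex.exp (t * Complex.I) := by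
    intro t
    simp only [circleMap, zero_add, Complex.ofReal_one, one_mul]
    conv_rhs => rw [hζe]
    rw [← Complex.exp_add]
    congr 1
    push_cast
    ring
  simp only [h2]
  rw [intervalIntegral.integral_of_le (by linarith), intervalIntegral.integral_of_le (by linarith),
    ← MeasureTheory.integral_Icc_eq_integral_Ioc (x := -θ)]
  have h3 : Set.Icc (-θ) θ ⊆ Set.Ioc (-Real.pi) Real.pi := fun t ht =>
    ⟨by linarith [ht.1], by linarith [ht.2]⟩
  rw [← Set.inter_eq_self_of_subset_right h3,
    ← MeasureTheory.setIntegral_indicator measurableSet_Icc]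
  refine MeasureTheory.setIntegral_congr_fun measurableSet_Ioc fun t ht => ?_
  by_cases htθ : |t| ≤ θ
  · rw [Set.indicator_of_mem ((mul_exp_mem_sector_iff hζ0 ht).2 htθ),
      Set.indicator_of_mem (Set.mem_Icc.2 (abs_le.1 htθ))]
  · rw [Set.indicator_of_notMem (fun h => htθ ((mul_exp_mem_sector_iff hζ0 ht).1 h)),
      Set.indicator_of_notMem (fun h => htθ (abs_le.2 (Set.mem_Icc.1 h)))]

lemma integral_circle_eq_sum_sectors {θ : ℝ} (hθ : 0 < θ) (hθπ : θ < Real.pi) {m : ℕ}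
    {ζ : Fin (m + 1) → ℂ} (hζ : ∀ k, ‖ζ k‖ = 1)
    (hdis : ∀ j k, j ≠ k → Disjoint (sector θ (ζ j)) (sector θ (ζ k))) {G : ℂ → ℂ}
    (hG : Continuous fun t : ℝ => G (circleMap 0 1 t)) :
    ∫ t in (0 : ℝ)..2 * Real.pi, G (circleMap 0 1 t) =
      ∑ k, (∫ t in (-θ)..θ, G (ζ k * Complex.exp (t * Complex.I))) +
        ∫ t in (0 : ℝ)..2 * Real.pi, ((⋃ k, sector θ (ζ k))ᶜ).indicator G (circleMap 0 1 t) := by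
  have hint : ∀ S : Set ℂ, MeasurableSet S →
      IntervalIntegrable (fun t : ℝ => S.indicator G (circleMap 0 1 t)) MeasureTheory.volume 0
        (2 * Real.pi) := by
    intro S hS
    have h1 := hG.intervalIntegrable (μ := MeasureTheory.volume) 0 (2 * Real.pi)
    have h2 : (fun t : ℝ => S.indicator G (circleMap 0 1 t)) =
        (circleMap 0 1 ⁻¹' S).indicator (fun t : ℝ => G (circleMap 0 1 t)) := by
      ext t; rfl
    rw [h2]
    have hm : MeasurableSet (circleMap 0 1 ⁻¹' S) := (continuous_circleMap 0 1).measurable hS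
    exact ⟨h1.1.indicator hm, h1.2.indicator hm⟩
  simp only [← integral_indicator_sector hθ hθπ (hζ _)]
  rw [← intervalIntegral.integral_finsetSum fun k _ => hint _ (measurableSet_sector θ (ζ k)),
    ← intervalIntegral.integral_add]
  · refine intervalIntegral.integral_congr fun t _ => ?_
    by_cases h : ∃ k, circleMap 0 1 t ∈ sector θ (ζ k)
    · obtain ⟨k, hk⟩ := h
      rw [Finset.sum_eq_single k, Set.indicator_of_mem hk, Set.indicator_of_notMem, add_zero]
      · exact fun h => h (Set.mem_iUnion.2 ⟨k, hk⟩)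
      · exact fun j _ hjk => Set.indicator_of_notMem
          (fun hj => Set.disjoint_left.1 (hdis j k hjk) hj hk) _
      · simp
    · push Not at h
      rw [Finset.sum_eq_zero fun k _ => Set.indicator_of_notMem (h k) _, zero_add,
        Set.indicator_of_mem]
      simpa using h
  · have := IntervalIntegrable.sum Finset.univ
      (fun k _ => hint _ (measurableSet_sector θ (ζ k)))
    convert! this using 1
    ext t
    simp
  · exact hint _ (MeasurableSet.iUnion fun k => measurableSet_sector θ (ζ k)).compl

/-- The size of the remainder integral at one saddle point, up to subexponential factors. -/
noncomputable def saddleSize (lam : ℝ) (n : ℕ) : ℝ :=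
  Real.exp (n / lam) / √(2 * Real.pi * lam * n)

lemma saddleSize_pos {lam : ℝ} (hlam : 0 < lam) {n : ℕ} (hn : 1 ≤ n) : 0 < saddleSize lam n := by
  have : (0 : ℝ) < n := by exact_mod_cast hn
  unfold saddleSize
  positivity

namespace Growth

variable {f : ℂ → ℂ} {m : ℕ} {A b c ζ : Fin (m + 1) → ℂ} {lam mu θ : ℝ}

/-- On the circle of radius `r_n` the growth bound is `e^{μn/λ}`, because `r_n ^ λ = n / λ`, and the
Cauchy kernel costs at most `1 / (1 - |s|)`. As `μ < 1`, this is exponentially smaller than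
`saddleSize`. -/
lemma exists_other_bound (hf : Growth f A b c ζ lam mu θ) (hlam : 0 < lam) :
    ∃ C : ℝ, ∀ᶠ N : ℕ in atTop, ∀ s : ℂ, ‖s‖ < 1 →
      ‖∫ t in (0 : ℝ)..2 * Real.pi, ((⋃ k, sector θ (ζ k))ᶜ).indicator
        (kernel f (scale lam N) N s) (circleMap 0 1 t)‖ ≤
        C * Real.exp (mu * (N / lam)) / (1 - ‖s‖) := by
  obtain ⟨C, hC0, hC⟩ := hf.other.exists_pos
  have hC := hC.bound
  rw [eventually_inf_principal, ← comap_norm_atTop, eventually_comap] at hC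
  have hr := tendsto_scale hlam tendsto_id (l := atTop)
  refine ⟨C * (2 * Real.pi), ?_⟩
  filter_upwards [hr.eventually hC, eventually_ge_atTop 1] with N hN h1 s hs
  have hr0 : 0 < scale lam N := scale_pos hlam h1
  have hs' : 0 < 1 - ‖s‖ := by linarith
  have hb : ∀ t ∈ Set.uIoc 0 (2 * Real.pi), ‖((⋃ k, sector θ (ζ k))ᶜ).indicator
        (kernel f (scale lam N) N s) (circleMap 0 1 t)‖ ≤
        C * Real.exp (mu * (N / lam)) / (1 - ‖s‖) := by
    intro t _
    set w := circleMap 0 1 t with hw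
    have hwn : ‖w‖ = 1 := by simp [hw]
    by_cases hmem : w ∈ (⋃ k, sector θ (ζ k))ᶜ
    · rw [Set.indicator_of_mem hmem]
      have hmem' : (scale lam N : ℂ) * w ∈ (⋃ k, sector θ (ζ k))ᶜ := by
        simpa only [Set.mem_compl_iff, Set.mem_iUnion, ofReal_mul_mem_sector_iff hr0] using hmem
      have hnorm : ‖(scale lam N : ℂ) * w‖ = scale lam N := by
        rw [norm_mul, hwn, mul_one, Complex.norm_real, Real.norm_of_nonneg hr0.le]
      have h2 := hN _ (by simpa using hnorm) hmem'
      rw [hnorm, scale_rpow hlam, Real.norm_of_nonneg (Real.exp_pos _).le] at h2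
      unfold kernel
      rw [norm_div, norm_mul, norm_mul, norm_pow, hwn, one_pow, mul_one, one_mul]
      have h3 : 1 - ‖s‖ ≤ ‖w - s‖ := by
        have := norm_sub_norm_le w s
        rwa [hwn] at this
      gcongr
    · rw [Set.indicator_of_notMem hmem, norm_zero]
      positivity
  refine (intervalIntegral.norm_integral_le_of_norm_le_const hb).trans (le_of_eq ?_)
  rw [sub_zero, abs_of_pos Real.two_pi_pos]
  ring

/-- Each sector contributes its saddle point, and the rest of the circle goes into `y`, which is
smaller than every power of `n`. The points `s` may approach the unit circle, only more slowly than
`n^{-1/2}`; part (b) relies on this. -/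
theorem remInt_asymp (hf : Growth f A b c ζ lam mu θ) (hlam : 0 < lam) (hmu : mu < 1)
    (hθ : 0 < θ) (hθπ : θ < Real.pi) (hlamθ : lam * θ < 2 * Real.pi)
    {ι : Type*} {l : Filter ι} [l.IsCountablyGenerated] {n : ι → ℕ} {s : ι → ℂ}
    (hn : Tendsto n l atTop) (hs : Tendsto (fun i => √(n i : ℝ) * (1 - ‖s i‖)) l atTop) :
    ∃ (e : Fin (m + 1) → ι → ℂ) (y : ι → ℂ), (∀ k, Tendsto (e k) l (𝓝 (A k))) ∧
      (∀ K : ℝ, Tendsto (fun i => (n i : ℝ) ^ K * ‖y i‖) l (𝓝 0)) ∧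
      ∀ᶠ i in l, remInt f (scale lam (n i)) (n i) (s i) = saddleSize lam (n i) *
        (∑ k, e k i * slow (b k) (c k) (scale lam (n i)) * (ζ k / ζ k ^ n i) / (ζ k - s i) +
          y i) := by
  have hnr : Tendsto (fun i => (n i : ℝ)) l atTop := tendsto_natCast_atTop_atTop.comp hn
  have hr := tendsto_scale hlam hn
  have hs1 : ∀ᶠ i in l, ‖s i‖ < 1 := by
    filter_upwards [hs.eventually_gt_atTop 0] with i hi
    by_contra! h
    nlinarith [Real.sqrt_nonneg (n i : ℝ)]
  have hq : 0 < √(2 * Real.pi / lam) := by positivity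
  have hq' : ((√(2 * Real.pi / lam) : ℝ) : ℂ) ≠ 0 := by exact_mod_cast hq.ne'
  -- The `e k` are the normalized sector integrals themselves, so the decomposition is an exact
  -- identity and only their limits need analysis.
  refine ⟨fun k i => √(n i : ℝ) * ((∫ t in (-θ)..θ,
        kernel f (scale lam (n i)) (n i) (s i) (ζ k * Complex.exp (t * Complex.I))) *
        (ζ k ^ n i / ζ k * (ζ k - s i)) /
        (slow (b k) (c k) (scale lam (n i)) * Complex.exp (n i / lam))) /
        (√(2 * Real.pi / lam) : ℝ),
    fun i => (2 * Real.pi : ℂ)⁻¹ * (∫ t in (0 : ℝ)..2 * Real.pi,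
      ((⋃ k, sector θ (ζ k))ᶜ).indicator
        (kernel f (scale lam (n i)) (n i) (s i)) (circleMap 0 1 t)) / saddleSize lam (n i),
    fun k => ?_, fun K => ?_, ?_⟩
  · have h := (tendsto_sector_integral hlam hθ hθπ hlamθ hf.entire.continuous (hf.dir_norm k)
      (hf.main k) hn hs).div_const ((√(2 * Real.pi / lam) : ℝ) : ℂ)
    rwa [mul_div_cancel_right₀ _ hq'] at h
  · obtain ⟨C, hC⟩ := hf.exists_other_bound hlam
    have hd : 0 < (1 - mu) / lam := div_pos (by linarith) hlam
    -- The extra power of `n` is `√n` from `1 / (1 - |s|) ≤ √n` times `√n` from the denominator of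
    -- `saddleSize`.
    have hlim : Tendsto (fun i => (2 * Real.pi)⁻¹ * C * √(2 * Real.pi * lam) *
        ((n i : ℝ) ^ (K + 1) * Real.exp (-((1 - mu) / lam) * n i))) l (𝓝 0) := by
      have := (tendsto_rpow_mul_exp_neg_mul_atTop_nhds_zero (K + 1) _ hd).comp hnr
      simpa using this.const_mul ((2 * Real.pi)⁻¹ * C * √(2 * Real.pi * lam))
    refine squeeze_zero' (Eventually.of_forall fun _ => by positivity) ?_ hlim
    filter_upwards [hn.eventually hC, hs1, hn.eventually_ge_atTop 1, hs.eventually_ge_atTop 1]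
      with i h1 h2 h3 h4
    have h0 : (0 : ℝ) < n i := by exact_mod_cast h3
    have h5 := h1 _ h2
    have h6 : 0 < 1 - ‖s i‖ := by linarith
    have hC0 : 0 ≤ C * Real.exp (mu * (n i / lam)) := by
      by_contra! hneg
      have := (norm_nonneg _).trans h5
      have h7 := div_neg_of_neg_of_pos hneg h6
      linarith
    have hsq : √(n i : ℝ) ^ 2 = n i := Real.sq_sqrt h0.le
    have hs0 : 0 < √(n i : ℝ) := Real.sqrt_pos.2 h0
    have h8 : C * Real.exp (mu * (n i / lam)) / (1 - ‖s i‖) ≤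
        C * Real.exp (mu * (n i / lam)) * √(n i : ℝ) := by
      rw [div_le_iff₀ h6, mul_assoc]
      exact le_mul_of_one_le_right hC0 h4
    rw [norm_div, norm_mul, Complex.norm_real, Real.norm_of_nonneg (saddleSize_pos hlam h3).le,
      norm_inv, ← Complex.ofReal_ofNat, ← Complex.ofReal_mul, Complex.norm_real,
      Real.norm_of_nonneg Real.two_pi_pos.le]
    calc _ ≤ (n i : ℝ) ^ K * ((2 * Real.pi)⁻¹ * (C * Real.exp (mu * (n i / lam)) * √(n i : ℝ)) /
          saddleSize lam (n i)) := by
          have := saddleSize_pos hlam h3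
          gcongr
          exact h5.trans h8
      _ = _ := by
        unfold saddleSize
        rw [Real.rpow_add h0, Real.rpow_one, Real.sqrt_mul (by positivity)]
        have he : Real.exp (-((1 - mu) / lam) * n i) =
            Real.exp (mu * (n i / lam)) / Real.exp (n i / lam) := by
          rw [← Real.exp_sub]; congr 1; ring
        rw [he]
        rw [show (n i : ℝ) ^ K * (n i : ℝ) = (n i : ℝ) ^ K * √(n i : ℝ) ^ 2 by rw [hsq]]
        have := Real.exp_pos (n i / lam)
        field_simp
  · filter_upwards [hs1, hn.eventually_ge_atTop 1, hr.eventually_gt_atTop 1] with i h1 h2 h3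
    have h0 : (0 : ℝ) < n i := by exact_mod_cast h2
    have hκ : (saddleSize lam (n i) : ℂ) ≠ 0 := by exact_mod_cast (saddleSize_pos hlam h2).ne'
    have hcont : Continuous fun t : ℝ => kernel f (scale lam (n i)) (n i) (s i)
        (circleMap 0 1 t) := by
      have := continuousOn_kernel hf.entire.continuous (scale lam (n i)) (n i) (ζ := 1) (by simp) h1
      simpa [circleMap] using this
    unfold remInt
    rw [integral_circle_eq_sum_sectors hθ hθπ hf.dir_norm hf.disjoint hcont, mul_add, mul_add,
      mul_div_cancel₀ _ hκ, Finset.mul_sum, Finset.mul_sum]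
    congr 1
    refine Finset.sum_congr rfl fun k _ => ?_
    have hζ0 : ζ k ≠ 0 := norm_pos_iff.1 (by rw [hf.dir_norm k]; exact one_pos)
    have hslow : slow (b k) (c k) (scale lam (n i)) ≠ 0 := slow_ne_zero (by
      rw [Complex.norm_real, Real.norm_of_nonneg (by linarith)]; exact h3) _ _
    have hne : ζ k - s i ≠ 0 := by
      intro h
      have := hf.dir_norm k
      rw [sub_eq_zero.1 h] at this
      linarith
    have hconst : saddleSize lam (n i) * √(n i : ℝ) / (Real.exp (n i / lam) *
        √(2 * Real.pi / lam)) = (2 * Real.pi)⁻¹ := by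
      unfold saddleSize
      have e1 : √(2 * Real.pi * lam * n i) * √(2 * Real.pi / lam) = 2 * Real.pi * √(n i : ℝ) := by
        rw [← Real.sqrt_mul (by positivity),
          show 2 * Real.pi * lam * n i * (2 * Real.pi / lam) = (2 * Real.pi) ^ 2 * n i by
            field_simp, Real.sqrt_mul (by positivity), Real.sqrt_sq Real.two_pi_pos.le]
      have hs0 : 0 < √(n i : ℝ) := Real.sqrt_pos.2 h0
      have := Real.exp_pos (n i / lam)
      have hp := Real.pi_pos
      rw [div_mul_eq_mul_div, div_div, mul_comm (Real.exp _) (√(2 * Real.pi / lam)), ← mul_assoc,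
        e1]
      field_simp
    have hconst' : (2 * Real.pi : ℂ)⁻¹ = saddleSize lam (n i) * (√(n i : ℝ) : ℝ) /
        (Complex.exp (n i / lam) * (√(2 * Real.pi / lam) : ℝ)) := by
      have := congrArg (Complex.ofReal) hconst
      push_cast at this
      exact this.symm
    rw [hconst']
    generalize (∫ t in (-θ)..θ,
      kernel f (scale lam (n i)) (n i) (s i) (ζ k * Complex.exp (t * Complex.I))) = J
    have he := Complex.exp_ne_zero (n i / lam : ℂ)
    field_simp

end Growth


/-! ### Zeros of small perturbations of `c e^v - 1`. -/

lemma quarter_le_norm_exp_sub_one {u : ℂ} (hu : ‖u‖ = 1 / 2) : 1 / 4 ≤ ‖Complex.exp u - 1‖ := by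
  have h1 := Complex.norm_exp_sub_one_sub_id_le (x := u) (by rw [hu]; norm_num)
  have h2 := norm_sub_norm_le u (u - (Complex.exp u - 1))
  rw [sub_sub_cancel, norm_sub_rev] at h2
  rw [hu] at h1 h2
  norm_num at h1 h2 ⊢
  linarith

/-- A function close to `c * exp v - 1`, `‖c‖ = 1`, has a zero near each zero of the latter. -/
lemma exists_zero_near {F : ℂ → ℂ} {c u : ℂ} (hu : c * Complex.exp u = 1)
    (hd : DifferentiableOn ℂ F (ball u 1))
    (hF : ∀ v ∈ ball u 1, ‖F v - (c * Complex.exp v - 1)‖ < 1 / 16) :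
    (∃ v ∈ closedBall u (1 / 2), F v = 0) ∧ F (u + 1 / 2) ≠ 0 := by
  have hexp : ∀ v, c * Complex.exp v - 1 = Complex.exp (v - u) - 1 := by
    intro v
    rw [Complex.exp_sub, ← hu]
    have := Complex.exp_ne_zero u
    have hc : c = (Complex.exp u)⁻¹ := by field_simp; exact hu
    rw [hc]; field_simp
  have hu0 : ‖F u‖ < 1 / 16 := by
    have := hF u (mem_ball_self one_pos)
    rwa [hu, sub_self, sub_zero] at this
  have hsph : ∀ z ∈ sphere u (1 / 2), 3 / 16 < ‖F z‖ := by
    intro z hz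
    have hz1 : ‖z - u‖ = 1 / 2 := mem_sphere_iff_norm.1 hz
    have h1 := hF z (by rw [mem_ball_iff_norm, hz1]; norm_num)
    rw [hexp] at h1
    have h2 := quarter_le_norm_exp_sub_one hz1
    have h3 := norm_sub_norm_le (Complex.exp (z - u) - 1) (Complex.exp (z - u) - 1 - F z)
    rw [sub_sub_cancel, norm_sub_rev _ (F z)] at h3
    linarith
  have hmem : u + 1 / 2 ∈ sphere u (1 / 2) := by
    rw [mem_sphere_iff_norm, add_sub_cancel_left]; norm_num
  refine ⟨?_, ?_⟩
  · have hfreq : ∃ᶠ z in 𝓝 u, F z ≠ F u := by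
      intro h
      simp only [ne_eq, not_not] at h
      have han : AnalyticOnNhd ℂ F (ball u 1) := hd.analyticOnNhd isOpen_ball
      have heq := han.eqOn_of_preconnected_of_eventuallyEq analyticOnNhd_const
        (convex_ball u 1).isPreconnected (mem_ball_self one_pos) h
      have h1 := heq (x := u + 1 / 2) (by
        rw [mem_ball_iff_norm, add_sub_cancel_left]; norm_num)
      have h2 := hsph _ hmem
      rw [h1] at h2
      linarith
    -- A quantitative open mapping theorem plays the role of Rouché's: on the circle `|F - F u| ≥
    -- 3/16 - 1/16 = 1/8`, so the image covers the disk of radius `1/16` about `F u`, which contains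
    -- `0`.
    have hsub := DiffContOnCl.ball_subset_image_closedBall (f := F) (z₀ := u) (r := 1 / 2)
      (ε := 1 / 8) ((hd.mono (by
        rw [closure_ball _ (by norm_num)]
        exact closedBall_subset_ball (by norm_num))).diffContOnCl) (by norm_num) (fun z hz => by
          have h1 := hsph z hz
          have h2 := norm_sub_norm_le (F z) (F u)
          linarith) hfreq
    obtain ⟨v, hv, hv0⟩ := hsub (show (0 : ℂ) ∈ ball (F u) (1 / 8 / 2) by
      rw [mem_ball_iff_norm, zero_sub, norm_neg]; norm_num; linarith)
    exact ⟨v, hv, hv0⟩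
  · intro h
    have := hsph _ hmem
    rw [h, norm_zero] at this
    linarith

/-- The zeros of `c e^v - 1` are `2π` apart, and each attracts a zero of `F j` within distance
`1/2`, so these are distinct. The point where `F j` does not vanish is kept to show later that the
partial sum is not the zero polynomial. -/
theorem exists_many_zeros {F : ℕ → ℂ → ℂ} {c : ℕ → ℂ} (hc : ∀ᶠ j in atTop, ‖c j‖ = 1)
    (hd : ∀ B : ℝ, ∀ᶠ j in atTop, DifferentiableOn ℂ (F j) (closedBall 0 B))
    (hF : ∀ B : ℝ, Tendsto (fun p : ℕ × ℂ => F p.1 p.2 - (c p.1 * Complex.exp p.2 - 1))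
      (atTop ×ˢ 𝓟 (closedBall 0 B)) (𝓝 0)) (N : ℕ) :
    ∃ B > 0, ∀ᶠ j in atTop, (∃ v : Fin N → ℂ, Function.Injective v ∧
      ∀ k, v k ∈ closedBall 0 B ∧ F j (v k) = 0) ∧ ∃ v ∈ closedBall 0 B, F j v ≠ 0 := by
  have hp := Real.pi_pos
  -- Large enough for the unit balls about the model zeros `i (2πk - arg c)`, `k ≤ N`.
  set B : ℝ := 2 * Real.pi * N + Real.pi + 1 with hB
  refine ⟨B, by positivity, ?_⟩
  have h1 := (hF B).norm.eventually_lt_const (show ‖(0 : ℂ)‖ < 1 / 16 by norm_num)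
  rw [eventually_prod_principal_iff] at h1
  filter_upwards [hc, hd B, h1] with j hcj hdj hFj
  have hce : c j = Complex.exp ((c j).arg * Complex.I) := by
    have := Complex.norm_mul_exp_arg_mul_I (c j)
    rw [hcj] at this
    simpa using this.symm
  set u : ℕ → ℂ := fun k => ((2 * Real.pi * k - (c j).arg : ℝ) : ℂ) * Complex.I with hu
  have hcu : ∀ k, c j * Complex.exp (u k) = 1 := by
    intro k
    conv_lhs => rw [hce]
    rw [← Complex.exp_add, Complex.exp_eq_one_iff]
    refine ⟨k, ?_⟩
    rw [hu]; push_cast; ring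
  have hball : ∀ k ≤ N, ball (u k) 1 ⊆ closedBall 0 B := by
    intro k hk v hv
    rw [mem_ball_iff_norm] at hv
    rw [mem_closedBall_zero_iff]
    have h2 : ‖u k‖ ≤ 2 * Real.pi * N + Real.pi := by
      rw [hu]
      simp only
      rw [norm_mul, Complex.norm_I, mul_one, Complex.norm_real, Real.norm_eq_abs]
      have h3 := abs_sub (2 * Real.pi * k) (c j).arg
      have h4 := Complex.abs_arg_le_pi (c j)
      have h5 : |2 * Real.pi * k| ≤ 2 * Real.pi * N := by
        rw [abs_of_nonneg (by positivity)]
        have : (k : ℝ) ≤ N := by exact_mod_cast hk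
        gcongr
      linarith
    have h3 := norm_sub_norm_le v (u k)
    linarith
  have key : ∀ k ≤ N, _ := fun k hk => exists_zero_near (hcu k) (hdj.mono (hball k hk))
    (fun v hv => hFj v (hball k hk hv))
  refine ⟨?_, u 0 + 1 / 2, ?_, (key 0 (Nat.zero_le _)).2⟩
  · choose v hv hv0 using fun k : Fin N => (key k k.2.le).1
    refine ⟨v, fun a b hab => ?_, fun k => ⟨?_, hv0 k⟩⟩
    · by_contra hne
      have h2 := hv a
      have h3 := hv b
      rw [← hab] at h3
      rw [mem_closedBall_iff_norm] at h2 h3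
      have h4 : ‖u a - u b‖ ≤ 1 := by
        have := norm_sub_le (v a - u b) (v a - u a)
        rw [sub_sub_sub_cancel_left] at this
        linarith
      have h5 : ‖u a - u b‖ = 2 * Real.pi * |(a : ℝ) - (b : ℝ)| := by
        rw [hu]
        simp only
        rw [← sub_mul, norm_mul, Complex.norm_I, mul_one, ← Complex.ofReal_sub, Complex.norm_real,
          Real.norm_eq_abs, show (2 * Real.pi * ((a : ℕ) : ℝ) - (c j).arg -
          (2 * Real.pi * ((b : ℕ) : ℝ) - (c j).arg)) = 2 * Real.pi * ((a : ℝ) - (b : ℝ)) by ring,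
          abs_mul, abs_of_pos Real.two_pi_pos]
      have h6 : (1 : ℝ) ≤ |((a : ℕ) : ℝ) - ((b : ℕ) : ℝ)| := by
        have : ((a : ℕ) : ℤ) - ((b : ℕ) : ℤ) ≠ 0 := by
          intro h
          exact hne (Fin.ext (by omega))
        exact_mod_cast Int.one_le_abs this
      have h7 := Real.pi_gt_three
      nlinarith
    · exact hball k k.2.le (closedBall_subset_ball (by norm_num) (hv k))
  · refine hball 0 (Nat.zero_le _) ?_
    rw [mem_ball_iff_norm, add_sub_cancel_left]; norm_num

/-! ### The phase function and the local comparison of `f` with the remainder. -/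

/-- The mean value inequality for `z ↦ g z - g' x * z` on a segment, with `g'` Lipschitz near `ξ`.
The bound is uniform in both points because the base point of the expansion will move with `n`. -/
lemma exists_second_order_bound {g g' : ℂ → ℂ} {ξ : ℂ} (hg : ∀ᶠ z in 𝓝 ξ, HasDerivAt g (g' z) z)
    (hg' : ContDiffAt ℂ 1 g' ξ) :
    ∃ C : ℝ, ∀ᶠ p in 𝓝 ξ ×ˢ 𝓝 ξ,
      ‖g p.2 - g p.1 - g' p.1 * (p.2 - p.1)‖ ≤ C * ‖p.2 - p.1‖ ^ 2 := by
  obtain ⟨K, t, ht, hK⟩ := hg'.exists_lipschitzOnWith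
  obtain ⟨ρ, hρ, hball⟩ := Metric.eventually_nhds_iff_ball.1 (hg.and ht)
  refine ⟨K, ?_⟩
  filter_upwards [prod_mem_prod (ball_mem_nhds ξ hρ) (ball_mem_nhds ξ hρ)] with ⟨x, y⟩ ⟨hx, hy⟩
  simp only at hx hy ⊢
  have hseg : segment ℝ x y ⊆ ball ξ ρ := (convex_ball ξ ρ).segment_subset hx hy
  have h := Convex.norm_image_sub_le_of_norm_hasDerivWithin_le (f := fun z => g z - g' x * z)
    (f' := fun z => g' z - g' x) (s := segment ℝ x y) (C := K * ‖y - x‖) (x := x) (y := y)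
    (fun z hz => by
      have h1 := (hball z (hseg hz)).1.sub ((hasDerivAt_id z).const_mul (g' x))
      rw [mul_one] at h1
      exact h1.hasDerivWithinAt)
    (fun z hz => by
      have h1 := hK.norm_sub_le (hball z (hseg hz)).2 (hball x hx).2
      refine h1.trans ?_
      gcongr
      obtain ⟨a, b, ha, hb, hab, rfl⟩ := hz
      have : a • x + b • y - x = b • (y - x) := by
        rw [show a = 1 - b by linarith, sub_smul, one_smul, smul_sub]; ring
      rw [this, norm_smul, Real.norm_of_nonneg hb]
      exact mul_le_of_le_one_left (norm_nonneg _) (by linarith))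
    (convex_segment x y) (left_mem_segment ℝ x y) (right_mem_segment ℝ x y)
  calc _ = ‖g y - g' x * y - (g x - g' x * x)‖ := by congr 1; ring
    _ ≤ _ := h
    _ = _ := by ring

/-- The phase function of the scaled partial sums. -/
noncomputable def phase (lam : ℝ) (s : ℂ) : ℂ := (s ^ (lam : ℂ) - 1) / lam - Complex.log s

/-- The derivative of `phase`. -/
noncomputable def dphase (lam : ℝ) (s : ℂ) : ℂ := (s ^ (lam : ℂ) - 1) / s

lemma hasDerivAt_phase {lam : ℝ} (hlam : 0 < lam) {s : ℂ} (hs : s ∈ Complex.slitPlane) :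
    HasDerivAt (phase lam) (dphase lam s) s := by
  have hs0 : s ≠ 0 := Complex.slitPlane_ne_zero hs
  have hl : (lam : ℂ) ≠ 0 := by exact_mod_cast hlam.ne'
  have h1 := (((hasDerivAt_id s).cpow_const (c := (lam : ℂ)) hs).sub_const 1).div_const (lam : ℂ)
  have h2 := h1.sub (Complex.hasDerivAt_log hs)
  refine HasDerivAt.congr_deriv (f := phase lam) h2 ?_
  unfold dphase
  rw [id_eq, Complex.cpow_sub _ _ hs0, Complex.cpow_one]
  field_simp

lemma contDiffAt_dphase (lam : ℝ) {s : ℂ} (hs : s ∈ Complex.slitPlane) :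
    ContDiffAt ℂ 1 (dphase lam) s := by
  have hs0 : s ≠ 0 := Complex.slitPlane_ne_zero hs
  unfold dphase
  have h1 : AnalyticAt ℂ (fun s : ℂ => (s ^ (lam : ℂ) - 1) / s) s := by
    refine AnalyticAt.div ?_ analyticAt_id hs0
    exact (analyticAt_id.cpow analyticAt_const hs).sub analyticAt_const
  exact h1.contDiffAt


lemma continuous_partialSum (f : ℂ → ℂ) (n : ℕ) : Continuous (partialSum f n) := by
  unfold partialSum
  fun_prop

lemma differentiable_partialSum (f : ℂ → ℂ) (n : ℕ) : Differentiable ℂ (partialSum f n) := by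
  unfold partialSum
  fun_prop

lemma finite_zeros_partialSum {f : ℂ → ℂ} {n : ℕ} {z : ℂ} (hz : partialSum f n z ≠ 0) :
    {z | partialSum f n z = 0}.Finite := by
  set P : Polynomial ℂ := ∑ k ∈ Finset.range (n + 1),
    Polynomial.C (iteratedDeriv k f 0 / (k.factorial : ℂ)) * Polynomial.X ^ k with hP
  have heval : ∀ w, P.eval w = partialSum f n w := by
    intro w
    rw [hP, Polynomial.eval_finsetSum]
    simp [partialSum]
  have hP0 : P ≠ 0 := by
    rintro h
    apply hz
    rw [← heval, h, Polynomial.eval_zero]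
  refine (Polynomial.finite_setOfPred_isRoot hP0).subset fun w hw => ?_
  have : P.eval w = 0 := by rw [heval]; exact hw
  exact this

namespace Growth

variable {f : ℂ → ℂ} {m : ℕ} {A b c ζ : Fin (m + 1) → ℂ} {lam mu θ : ℝ}

/-- Local form of the asymptotics of `f` in the direction of the positive real axis. -/
theorem tendsto_local (hf : Growth f A b c ζ lam mu θ) (hlam : 0 < lam)
    {ξ : ℂ} (hξ : ξ ∈ Complex.slitPlane) (hξθ : |ξ.arg| < θ)
    {ι : Type*} {l : Filter ι} {n : ι → ℕ} {s : ι → ℂ} (hn : Tendsto n l atTop)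
    (hs : Tendsto s l (𝓝 ξ)) :
    Tendsto (fun i => f (scale lam (n i) * s i) / (s i ^ n i * Complex.exp (n i / lam) *
      slow (b 0) (c 0) (scale lam (n i)) * Complex.exp (n i * phase lam (s i)))) l
      (𝓝 (A 0 * ξ ^ b 0)) := by
  have hξ0 : ξ ≠ 0 := Complex.slitPlane_ne_zero hξ
  have hr := tendsto_scale hlam hn
  have hl : (lam : ℂ) ≠ 0 := by exact_mod_cast hlam.ne'
  have hnorm : ∀ᶠ i in l, ‖ξ‖ / 2 ≤ ‖s i‖ :=
    Filter.Tendsto.eventually_const_le (half_lt_self (norm_pos_iff.2 hξ0)) hs.norm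
  have harg : ∀ᶠ i in l, |(s i).arg| < θ :=
    (((Complex.continuousAt_arg hξ).tendsto.comp hs).abs).eventually_lt_const hξθ
  have T1 : Tendsto (fun i => f (scale lam (n i) * s i) /
      (slow (b 0) (c 0) (scale lam (n i) * s i) *
        Complex.exp ((scale lam (n i) * s i) ^ (lam : ℂ)))) l (𝓝 (A 0)) := by
    have h := hf.main 0
    simp only [hf.dir_zero, div_one] at h
    refine h.comp (f := fun i => (scale lam (n i) : ℂ) * s i) (tendsto_inf.2 ⟨?_, ?_⟩)
    · exact tendsto_norm_ofReal_mul_cobounded hr (half_pos (norm_pos_iff.2 hξ0)) hnorm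
    · rw [tendsto_principal]
      filter_upwards [harg, hnorm, hr.eventually_gt_atTop 0] with i h1 h2 h3
      rw [ofReal_mul_mem_sector_iff h3]
      refine ⟨?_, by rw [div_one]; exact h1.le⟩
      rintro h4
      rw [h4, norm_zero] at h2
      linarith [norm_pos_iff.2 hξ0]
  have T2 : Tendsto (fun i => s i ^ b 0 *
      (1 + Complex.log (s i) / (Real.log (scale lam (n i)) : ℂ)) ^ c 0) l (𝓝 (ξ ^ b 0)) := by
    have h1 : Tendsto (fun i => s i ^ b 0) l (𝓝 (ξ ^ b 0)) :=
      (continuousAt_cpow_const hξ).tendsto.comp hs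
    have h2 := tendsto_one_add_log_div_cpow hr (C := ‖Complex.log ξ‖ + 1) (c := c 0)
      ((((continuousAt_clog hξ).tendsto.comp hs).norm).eventually_le_const (lt_add_one _))
    simpa using h1.mul h2
  refine (T1.mul T2).congr' ?_
  filter_upwards [hr.eventually_gt_atTop 1, hnorm, hn.eventually_ge_atTop 1,
    hr.eventually_gt_atTop (2 / ‖ξ‖)] with i h1 h2 h3 h4
  have hs0 : s i ≠ 0 := by
    rintro h5
    rw [h5, norm_zero] at h2
    linarith [norm_pos_iff.2 hξ0]
  have hslow0 : slow (b 0) (c 0) (scale lam (n i)) ≠ 0 := slow_ne_zero (by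
    rw [Complex.norm_real, Real.norm_of_nonneg (by linarith)]; exact h1) _ _
  have hsn : s i ^ n i = Complex.exp (n i * Complex.log (s i)) := by
    rw [Complex.exp_nat_mul, Complex.exp_log hs0]
  -- `phase` is defined so as to make this identity true.
  have hexp : s i ^ n i * Complex.exp (n i / lam) * Complex.exp (n i * phase lam (s i)) =
      Complex.exp ((scale lam (n i) * s i) ^ (lam : ℂ)) := by
    rw [scale_mul_cpow hlam h3, hsn, ← Complex.exp_add, ← Complex.exp_add]
    congr 1
    unfold phase
    field_simp
    ring
  have hdenom : s i ^ n i * Complex.exp (n i / lam) * slow (b 0) (c 0) (scale lam (n i)) *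
      Complex.exp (n i * phase lam (s i)) = slow (b 0) (c 0) (scale lam (n i)) *
      Complex.exp ((scale lam (n i) * s i) ^ (lam : ℂ)) := by
    rw [← hexp]; ring
  rw [hdenom, slow_mul h1 hs0]
  set q := s i ^ b 0 * (1 + Complex.log (s i) / (Real.log (scale lam (n i)) : ℂ)) ^ c 0 with hq
  have hq0 : q ≠ 0 := by
    intro h
    have h5 : slow (b 0) (c 0) (scale lam (n i)) * q = 0 := by rw [h, mul_zero]
    rw [hq, ← slow_mul h1 hs0] at h5
    refine slow_ne_zero ?_ _ _ h5
    rw [norm_mul, Complex.norm_real, Real.norm_of_nonneg (by linarith)]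
    rw [div_lt_iff₀ (norm_pos_iff.2 hξ0)] at h4
    nlinarith
  have := Complex.exp_ne_zero ((scale lam (n i) * s i) ^ (lam : ℂ))
  field_simp


lemma local_limit_ne_zero (hf : Growth f A b c ζ lam mu θ) {ξ : ℂ}
    (hξ : ξ ∈ Complex.slitPlane) : A 0 * ξ ^ b 0 ≠ 0 :=
  mul_ne_zero (hf.coeff_ne 0) (by
    simp [Complex.cpow_eq_zero_iff, Complex.slitPlane_ne_zero hξ])

/-- At the scale `1 / (n * dphase σ)` the function `f (r s) / s ^ n` behaves like `exp`. -/
theorem tendsto_ratio (hf : Growth f A b c ζ lam mu θ) (hlam : 0 < lam)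
    {ξ : ℂ} (hξ : ξ ∈ Complex.slitPlane) (hξθ : |ξ.arg| < θ)
    {ι : Type*} {l : Filter ι} {n : ι → ℕ} {s σ v : ι → ℂ} (hn : Tendsto n l atTop)
    (hs : Tendsto s l (𝓝 ξ)) (hσ : Tendsto σ l (𝓝 ξ))
    (hv : ∀ᶠ i in l, n i * (dphase lam (σ i) * (s i - σ i)) = v i)
    (hsσ : Tendsto (fun i => (n i : ℝ) * ‖s i - σ i‖ ^ 2) l (𝓝 0)) :
    Tendsto (fun i => f (scale lam (n i) * s i) / s i ^ n i /
      (f (scale lam (n i) * σ i) / σ i ^ n i) / Complex.exp (v i)) l (𝓝 1) := by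
  have h1 := hf.tendsto_local hlam hξ hξθ hn hs
  have h2 := hf.tendsto_local hlam hξ hξθ hn hσ
  have hne := hf.local_limit_ne_zero hξ
  have h3 := h1.div h2 hne
  rw [div_self hne] at h3
  obtain ⟨C, hC⟩ := exists_second_order_bound
    ((Complex.isOpen_slitPlane.eventually_mem hξ).mono fun z hz => hasDerivAt_phase hlam hz)
    (contDiffAt_dphase lam hξ)
  have h4 : Tendsto (fun i => n i * (phase lam (s i) - phase lam (σ i)) - v i) l (𝓝 0) := by
    have h5 : Tendsto (fun i => C * ((n i : ℝ) * ‖s i - σ i‖ ^ 2)) l (𝓝 0) := by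
      simpa using hsσ.const_mul C
    refine squeeze_zero_norm' ?_ h5
    filter_upwards [(hσ.prodMk hs).eventually hC, hv] with i hi hvi
    rw [← hvi, ← mul_sub, norm_mul, Complex.norm_natCast]
    calc (n i : ℝ) * _ ≤ n i * (C * ‖s i - σ i‖ ^ 2) := by gcongr
      _ = _ := by ring
  have h5 : Tendsto (fun i => Complex.exp (n i * (phase lam (s i) - phase lam (σ i)) - v i)) l
      (𝓝 1) := by
    simpa [Function.comp_def] using (Complex.continuous_exp.tendsto 0).comp h4
  have h6 := h3.mul h5
  rw [one_mul] at h6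
  have hr := tendsto_scale hlam hn
  have hξ0 : ξ ≠ 0 := Complex.slitPlane_ne_zero hξ
  refine h6.congr' ?_
  filter_upwards [h2.eventually_ne hne, hs.eventually_ne hξ0, hσ.eventually_ne hξ0,
    hr.eventually_gt_atTop 1] with i e2 e3 e4 e5
  have hslow0 : slow (b 0) (c 0) (scale lam (n i)) ≠ 0 := slow_ne_zero (by
    rw [Complex.norm_real, Real.norm_of_nonneg (by linarith)]; exact e5) _ _
  have hfσ : f (scale lam (n i) * σ i) ≠ 0 := by
    intro h; apply e2; rw [h, zero_div]
  have hexp : Complex.exp (n i * (phase lam (s i) - phase lam (σ i)) - v i) =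
      Complex.exp (n i * phase lam (s i)) / Complex.exp (n i * phase lam (σ i)) /
        Complex.exp (v i) := by
    rw [← Complex.exp_sub, ← Complex.exp_sub]; congr 1; ring
  simp only [Pi.div_apply]
  rw [hexp]
  have x1 := Complex.exp_ne_zero (n i * phase lam (s i))
  have x2 := Complex.exp_ne_zero (n i * phase lam (σ i))
  have x3 := Complex.exp_ne_zero (v i)
  have x4 := Complex.exp_ne_zero (n i / lam : ℂ)
  field_simp

/-- Many zeros near a point of balance between `f` and the remainder. -/
theorem many_zeros (hf : Growth f A b c ζ lam mu θ) (hlam : 0 < lam)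
    {ξ : ℂ} (hξ : ξ ∈ Complex.slitPlane) (hξθ : |ξ.arg| < θ)
    {n : ℕ → ℕ} {σ δ : ℕ → ℂ} (hn : Tendsto n atTop atTop)
    (hσ : Tendsto σ atTop (𝓝 ξ)) (hδ : Tendsto δ atTop (𝓝 0))
    (hδ1 : ∀ᶠ j in atTop, n j * (dphase lam (σ j) * δ j) = 1)
    (hδ2 : Tendsto (fun j => (n j : ℝ) * ‖δ j‖ ^ 2) atTop (𝓝 0))
    (hbal : ∀ᶠ j in atTop, ‖f (scale lam (n j) * σ j)‖ =
      ‖f (scale lam (n j) * σ j) - partialSum f (n j - 1) (scale lam (n j) * σ j)‖)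
    (hR : ∀ B : ℝ, Tendsto (fun p : ℕ × ℂ =>
      remInt f (scale lam (n p.1)) (n p.1) (σ p.1 + δ p.1 * p.2) /
        remInt f (scale lam (n p.1)) (n p.1) (σ p.1)) (atTop ×ˢ 𝓟 (closedBall 0 B)) (𝓝 1))
    (hin : ∀ B : ℝ, ∀ᶠ p : ℕ × ℂ in atTop ×ˢ 𝓟 (closedBall 0 B), ‖σ p.1 + δ p.1 * p.2‖ < 1)
    (N : ℕ) :
    ∃ B > 0, ∀ᶠ j in atTop, ∀ (z : ℂ) (ρ : ℝ),
      closedBall (scale lam (n j) * σ j) (scale lam (n j) * (‖δ j‖ * B)) ⊆ closedBall z ρ →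
        N ≤ zeroCount (partialSum f (n j - 1)) z ρ := by
  have hξ0 : ξ ≠ 0 := Complex.slitPlane_ne_zero hξ
  have hslim : ∀ B : ℝ, Tendsto (fun p : ℕ × ℂ => σ p.1 + δ p.1 * p.2)
      (atTop ×ˢ 𝓟 (closedBall 0 B)) (𝓝 ξ) := by
    intro B
    have h1 : Tendsto (fun p : ℕ × ℂ => δ p.1 * p.2) (atTop ×ˢ 𝓟 (closedBall 0 B)) (𝓝 0) := by
      have h2 : Tendsto (fun p : ℕ × ℂ => ‖δ p.1‖ * B) (atTop ×ˢ 𝓟 (closedBall 0 B)) (𝓝 0) := by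
        simpa [Function.comp_def] using ((hδ.norm).mul_const B).comp tendsto_fst
      refine squeeze_zero_norm' ?_ h2
      rw [eventually_prod_principal_iff]
      refine Eventually.of_forall fun j v hv => ?_
      rw [norm_mul]
      gcongr
      simpa using hv
    simpa using (hσ.comp tendsto_fst).add h1
  -- Here `s ^ n` is taken at the moving point but the remainder integral at the fixed `σ j`. The
  -- part from `f` becomes `cc j * exp v` in the limit and the part from the remainder becomes `1`;
  -- the balance condition gives `‖cc j‖ = 1`.
  set F : ℕ → ℂ → ℂ := fun j v =>
    partialSum f (n j - 1) (scale lam (n j) * (σ j + δ j * v)) /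
      ((σ j + δ j * v) ^ n j * remInt f (scale lam (n j)) (n j) (σ j)) with hF
  set cc : ℕ → ℂ := fun j => f (scale lam (n j) * σ j) /
    (σ j ^ n j * remInt f (scale lam (n j)) (n j) (σ j)) with hcc
  have hr := tendsto_scale hlam hn
  have hσ1 : ∀ᶠ j in atTop, ‖σ j‖ < 1 := by
    have := hin 0
    rw [eventually_prod_principal_iff] at this
    filter_upwards [this] with j hj
    simpa using hj 0 (by simp)
  have hfσ : ∀ᶠ j in atTop, f (scale lam (n j) * σ j) ≠ 0 := by
    have h2 := (hf.tendsto_local hlam hξ hξθ hn hσ).eventually_ne (hf.local_limit_ne_zero hξ)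
    filter_upwards [h2] with j hj h
    apply hj
    rw [h, zero_div]
  have htail : ∀ᶠ j in atTop, ‖f (scale lam (n j) * σ j)‖ =
      ‖σ j ^ n j * remInt f (scale lam (n j)) (n j) (σ j)‖ := by
    filter_upwards [hbal, hσ1, hn.eventually_ge_atTop 1] with j h1 h2 h3
    rw [h1, sub_partialSum hf.entire _ h3 h2]
  have hc1 : ∀ᶠ j in atTop, ‖cc j‖ = 1 := by
    filter_upwards [htail, hfσ] with j h1 h2
    rw [hcc]
    simp only
    rw [norm_div, ← h1, div_self (norm_ne_zero_iff.2 h2)]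
  have hsne : ∀ B : ℝ, ∀ᶠ j in atTop, ∀ v ∈ closedBall (0 : ℂ) B, σ j + δ j * v ≠ 0 := by
    intro B
    have := (hslim B).eventually_ne hξ0
    rwa [eventually_prod_principal_iff] at this
  have hRne : ∀ᶠ j in atTop, σ j ^ n j * remInt f (scale lam (n j)) (n j) (σ j) ≠ 0 := by
    filter_upwards [htail, hfσ] with j h1 h2
    rw [← norm_ne_zero_iff, ← h1]
    exact norm_ne_zero_iff.2 h2
  have hd : ∀ B : ℝ, ∀ᶠ j in atTop, DifferentiableOn ℂ (F j) (closedBall 0 B) := by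
    intro B
    filter_upwards [hsne B, hRne] with j h1 h2 v hv
    refine DifferentiableAt.differentiableWithinAt ?_
    refine DifferentiableAt.div ?_ (by fun_prop)
      (mul_ne_zero (pow_ne_zero _ (h1 v hv)) (right_ne_zero_of_mul h2))
    exact (differentiable_partialSum f _).differentiableAt.comp v (by fun_prop)
  have hFlim : ∀ B : ℝ, Tendsto (fun p : ℕ × ℂ => F p.1 p.2 - (cc p.1 * Complex.exp p.2 - 1))
      (atTop ×ˢ 𝓟 (closedBall 0 B)) (𝓝 0) := by
    intro B
    set l : Filter (ℕ × ℂ) := atTop ×ˢ 𝓟 (closedBall 0 B) with hl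
    have hfst : Tendsto (Prod.fst : ℕ × ℂ → ℕ) l atTop := tendsto_fst
    have hball : ∀ᶠ p in l, ‖p.2‖ ≤ B := by
      rw [hl, eventually_prod_principal_iff]
      exact Eventually.of_forall fun j v hv => by simpa using hv
    have hB0 : ∀ᶠ p in l, 0 ≤ B := hball.mono fun p hp => (norm_nonneg _).trans hp
    have hratio := hf.tendsto_ratio hlam hξ hξθ (hn.comp hfst) (hslim B) (hσ.comp hfst)
      (v := Prod.snd) (by
        filter_upwards [hfst.eventually hδ1] with p hp
        simp only [Function.comp, add_sub_cancel_left]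
        rw [← mul_assoc, ← mul_assoc, mul_assoc (n p.1 : ℂ), hp, one_mul]) (by
        have h1 : Tendsto (fun p : ℕ × ℂ => (n p.1 : ℝ) * ‖δ p.1‖ ^ 2 * B ^ 2) l (𝓝 0) := by
          simpa [Function.comp_def] using (hδ2.mul_const (B ^ 2)).comp hfst
        refine squeeze_zero' (Eventually.of_forall fun _ => by positivity) ?_ h1
        filter_upwards [hball] with p hp
        simp only [Function.comp, add_sub_cancel_left]
        rw [norm_mul, mul_pow, ← mul_assoc]
        gcongr)
    have e1 : Tendsto (fun p : ℕ × ℂ => cc p.1 * Complex.exp p.2 *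
        (f (scale lam (n p.1) * (σ p.1 + δ p.1 * p.2)) / (σ p.1 + δ p.1 * p.2) ^ n p.1 /
      (f (scale lam (n p.1) * σ p.1) / σ p.1 ^ n p.1) / Complex.exp p.2 - 1)) l (𝓝 0) := by
      have h2 : Tendsto (fun p : ℕ × ℂ => Real.exp B *
        ‖f (scale lam (n p.1) * (σ p.1 + δ p.1 * p.2)) / (σ p.1 + δ p.1 * p.2) ^ n p.1 /
        (f (scale lam (n p.1) * σ p.1) / σ p.1 ^ n p.1) / Complex.exp p.2 - 1‖) l (𝓝 0) := by
        have := ((hratio.sub_const 1).norm).const_mul (Real.exp B)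
        simpa using this
      refine squeeze_zero_norm' ?_ h2
      filter_upwards [hball, hfst.eventually hc1] with p hp h1
      rw [norm_mul, norm_mul, h1, one_mul]
      gcongr
      exact (Complex.norm_exp_le_exp_norm _).trans (Real.exp_le_exp.2 hp)
    have e2 := e1.sub ((hR B).sub_const 1)
    rw [sub_self, sub_zero] at e2
    refine e2.congr' ?_
    filter_upwards [hfst.eventually hRne, hfst.eventually hfσ, hin B,
      hfst.eventually (hn.eventually_ge_atTop 1), (hslim B).eventually_ne hξ0]
      with p h1 h2 h3 h4 h5
    have h6 := sub_partialSum hf.entire (scale lam (n p.1)) h4 h3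
    have h7 : partialSum f (n p.1 - 1) (scale lam (n p.1) * (σ p.1 + δ p.1 * p.2)) =
      f (scale lam (n p.1) * (σ p.1 + δ p.1 * p.2)) - (σ p.1 + δ p.1 * p.2) ^ n p.1 *
      remInt f (scale lam (n p.1)) (n p.1) (σ p.1 + δ p.1 * p.2) := by rw [← h6]; ring
    have h8 := left_ne_zero_of_mul h1
    have h9 := right_ne_zero_of_mul h1
    have hx := Complex.exp_ne_zero p.2
    rw [hF, hcc]
    simp only
    rw [h7]
    field_simp
    ring
  obtain ⟨B, hB, hZ⟩ := exists_many_zeros hc1 hd hFlim N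
  refine ⟨B, hB, ?_⟩
  have hδne : ∀ᶠ j in atTop, δ j ≠ 0 := by
    filter_upwards [hδ1] with j hj h
    rw [h, mul_zero, mul_zero] at hj
    exact zero_ne_one hj
  filter_upwards [hZ, hδne, hsne B, hRne, hr.eventually_gt_atTop 0] with j hj h2 h3 h4 h5 z ρ hsub
  obtain ⟨⟨v, hvinj, hv⟩, w, hw, hFw⟩ := hj
  have hr' : (scale lam (n j) : ℂ) ≠ 0 := by exact_mod_cast h5.ne'
  -- Needed because `ncard` of an infinite set is `0`.
  have hfin : {z | partialSum f (n j - 1) z = 0}.Finite := by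
    refine finite_zeros_partialSum (z := scale lam (n j) * (σ j + δ j * w)) fun h => hFw ?_
    rw [hF]; simp only; rw [h, zero_div]
  unfold zeroCount
  set Z : Set ℂ := {z' : ℂ | partialSum f (n j - 1) z' = 0 ∧ ‖z' - z‖ ≤ ρ} with hZdef
  have hZfin : Z.Finite := hfin.subset fun x hx => hx.1
  have hinj : Function.Injective fun k : Fin N => (scale lam (n j) : ℂ) * (σ j + δ j * v k) := by
    intro k k' hkk
    exact hvinj (mul_left_cancel₀ h2 (add_left_cancel (mul_left_cancel₀ hr' hkk)))
  have hmem : ∀ k : Fin N, (scale lam (n j) : ℂ) * (σ j + δ j * v k) ∈ Z := by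
    intro k
    obtain ⟨hk1, hk2⟩ := hv k
    refine ⟨?_, ?_⟩
    · rw [hF] at hk2
      simp only at hk2
      rcases div_eq_zero_iff.1 hk2 with h | h
      · exact h
      · exact absurd h (mul_ne_zero (pow_ne_zero _ (h3 _ hk1)) (right_ne_zero_of_mul h4))
    · rw [← mem_closedBall_iff_norm]
      apply hsub
      rw [mem_closedBall_iff_norm, ← mul_sub, add_sub_cancel_left, norm_mul, norm_mul,
        Complex.norm_real, Real.norm_of_nonneg h5.le]
      gcongr
      simpa using hk1
  have hcard : (Set.range fun k : Fin N =>
      (scale lam (n j) : ℂ) * (σ j + δ j * v k)).ncard = N := by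
    rw [← Set.image_univ, Set.ncard_image_of_injective _ hinj, Set.ncard_univ, Nat.card_fin]
  rw [← hcard]
  exact Set.ncard_le_ncard (Set.range_subset_iff.2 hmem) hZfin

/-- On a path along which the phase changes sign, `f` and the remainder are balanced somewhere. -/
theorem exists_balance (hf : Growth f A b c ζ lam mu θ) (hlam : 0 < lam)
    {ξ : ℂ} (hξ : ξ ∈ Complex.slitPlane) (hξθ : |ξ.arg| < θ)
    {n : ℕ → ℕ} (hn : Tendsto n atTop atTop) {σ : ℕ → ℝ → ℂ} {x₀ x₁ : ℝ} (hx : x₀ ≤ x₁)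
    (hcont : ∀ j, Continuous (σ j))
    (hlim : Tendsto (fun p : ℕ × ℝ => σ p.1 p.2) (atTop ×ˢ 𝓟 (Set.Icc x₀ x₁)) (𝓝 ξ))
    (hin : ∀ᶠ p : ℕ × ℝ in atTop ×ˢ 𝓟 (Set.Icc x₀ x₁), ‖σ p.1 p.2‖ < 1)
    (hmod : Moderate (atTop ×ˢ 𝓟 (Set.Icc x₀ x₁)) (fun p : ℕ × ℝ => n p.1)
      (fun p => ‖remInt f (scale lam (n p.1)) (n p.1) (σ p.1 p.2)‖ / saddleSize lam (n p.1)))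
    {η : ℝ} (hη : 0 < η)
    (h₀ : ∀ᶠ j in atTop, n j * (phase lam (σ j x₀)).re ≤ -(n j : ℝ) ^ η)
    (h₁ : ∀ᶠ j in atTop, (n j : ℝ) ^ η ≤ n j * (phase lam (σ j x₁)).re) :
    ∀ᶠ j in atTop, ∃ x ∈ Set.Icc x₀ x₁, ‖f (scale lam (n j) * σ j x)‖ =
      ‖f (scale lam (n j) * σ j x) - partialSum f (n j - 1) (scale lam (n j) * σ j x)‖ := by
  set l : Filter (ℕ × ℝ) := atTop ×ˢ 𝓟 (Set.Icc x₀ x₁) with hl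
  have hfst : Tendsto (fun p : ℕ × ℝ => n p.1) l atTop := hn.comp tendsto_fst
  have hloc := hf.tendsto_local hlam hξ hξθ hfst hlim
  have hne := hf.local_limit_ne_zero hξ
  have m1 := Moderate.of_tendsto hfst (norm_pos_iff.2 hne) hloc.norm
  have m2 := Moderate.slow hlam hfst (b 0) (c 0)
  have m3 : Moderate l (fun p : ℕ × ℝ => n p.1)
      (fun p => √(2 * Real.pi * lam * n p.1)) := by
    have h1 := (Moderate.of_tendsto hfst (show 0 < 2 * Real.pi * lam by positivity)
      tendsto_const_nhds).mul hfst (Moderate.natCast_rpow hfst 1)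
    simpa only [Real.sqrt_eq_rpow, Real.rpow_one] using h1.rpow hfst (1 / 2)
  -- Collects everything in `|f| / |f - p_{n-1}|` other than `exp(n Re Φ)`; it stays between two
  -- powers of `n`.
  obtain ⟨K, hK⟩ := ((m1.mul hfst m2).mul hfst m3).div hfst hmod
  have hξ0 : ξ ≠ 0 := Complex.slitPlane_ne_zero hξ
  have hquot : ∀ᶠ p in l, ∃ g : ℝ, (n p.1 : ℝ) ^ (-K) ≤ g ∧ g ≤ (n p.1 : ℝ) ^ K ∧
      0 < ‖f (scale lam (n p.1) * σ p.1 p.2) -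
        partialSum f (n p.1 - 1) (scale lam (n p.1) * σ p.1 p.2)‖ ∧
      ‖f (scale lam (n p.1) * σ p.1 p.2)‖ = ‖f (scale lam (n p.1) * σ p.1 p.2) -
        partialSum f (n p.1 - 1) (scale lam (n p.1) * σ p.1 p.2)‖ *
        (Real.exp (n p.1 * (phase lam (σ p.1 p.2)).re) * g) := by
    filter_upwards [hK, hin, hfst.eventually_ge_atTop 1, hlim.eventually_ne hξ0,
      hmod.pos hfst, (tendsto_scale hlam hfst).eventually_gt_atTop 1] with p h1 h2 h3 h4 h5 h6
    refine ⟨_, h1.1, h1.2, ?_, ?_⟩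
    · have hs := saddleSize_pos hlam h3
      rw [sub_partialSum hf.entire _ h3 h2, norm_mul]
      have : 0 < ‖remInt f (scale lam (n p.1)) (n p.1) (σ p.1 p.2)‖ := by
        rcases (norm_nonneg (remInt f (scale lam (n p.1)) (n p.1) (σ p.1 p.2))).eq_or_lt with h | h
        · rw [← h, zero_div] at h5
          exact absurd h5 (lt_irrefl _)
        · exact h
      have := norm_pos_iff.2 (pow_ne_zero (n p.1) h4)
      positivity
    · have hs := saddleSize_pos hlam h3
      have hR : ‖remInt f (scale lam (n p.1)) (n p.1) (σ p.1 p.2)‖ ≠ 0 := by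
        intro h
        rw [h, zero_div] at h5
        exact lt_irrefl _ h5
      have hslow0 : ‖slow (b 0) (c 0) (scale lam (n p.1))‖ ≠ 0 := norm_ne_zero_iff.2 (slow_ne_zero (by
        rw [Complex.norm_real, Real.norm_of_nonneg (by linarith)]; exact h6) _ _)
      have h0 : (0 : ℝ) < n p.1 := by exact_mod_cast h3
      rw [sub_partialSum hf.entire _ h3 h2, norm_mul, norm_div, norm_mul, norm_mul, norm_mul,
        Complex.norm_exp, Complex.norm_exp]
      have e1 : (n p.1 / lam : ℂ).re = n p.1 / lam := by
        rw [← Complex.ofReal_natCast, ← Complex.ofReal_div, Complex.ofReal_re]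
      have e2 : (n p.1 * phase lam (σ p.1 p.2)).re = n p.1 * (phase lam (σ p.1 p.2)).re := by
        rw [← Complex.ofReal_natCast, Complex.re_ofReal_mul]
      rw [e1, e2]
      unfold saddleSize
      have x1 := Real.exp_pos (n p.1 / lam)
      have x2 := Real.exp_pos (n p.1 * (phase lam (σ p.1 p.2)).re)
      have x3 := norm_ne_zero_iff.2 (pow_ne_zero (n p.1) h4)
      have x4 : 0 < √(2 * Real.pi * lam * n p.1) := Real.sqrt_pos.2 (by positivity)
      field_simp
  rw [hl, eventually_prod_principal_iff] at hquot
  have hnr : Tendsto (fun j => (n j : ℝ)) atTop atTop := tendsto_natCast_atTop_atTop.comp hn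
  -- At the two ends `exp(∓n^η)` beats the power factor, so `|f| - |f - p_{n-1}|` changes sign along
  -- the path.
  have hsmall : Tendsto (fun j => (n j : ℝ) ^ K * Real.exp (-(n j : ℝ) ^ η)) atTop (𝓝 0) := by
    have h1 := (tendsto_rpow_mul_exp_neg_mul_atTop_nhds_zero (K / η) 1 one_pos).comp
      ((tendsto_rpow_atTop hη).comp hnr)
    refine h1.congr fun j => ?_
    simp only [Function.comp]
    rw [← Real.rpow_mul (Nat.cast_nonneg _), mul_div_cancel₀ _ hη.ne', neg_one_mul]
  filter_upwards [hquot, h₀, h₁, hsmall.eventually_lt_const one_pos, hn.eventually_ge_atTop 1]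
    with j h1 h2 h3 h4 h5
  have h0 : (0 : ℝ) < n j := by exact_mod_cast h5
  have hfc := hf.entire.continuous
  have hpc := continuous_partialSum f (n j - 1)
  have hσc := hcont j
  have hcont1 : ContinuousOn (fun x => ‖f (scale lam (n j) * σ j x)‖ -
      ‖f (scale lam (n j) * σ j x) - partialSum f (n j - 1) (scale lam (n j) * σ j x)‖)
      (Set.Icc x₀ x₁) := by
    refine Continuous.continuousOn ?_
    fun_prop
  have hiv := intermediate_value_Icc hx hcont1
  have hmem : (0 : ℝ) ∈ Set.Icc (‖f (scale lam (n j) * σ j x₀)‖ -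
      ‖f (scale lam (n j) * σ j x₀) - partialSum f (n j - 1) (scale lam (n j) * σ j x₀)‖)
      (‖f (scale lam (n j) * σ j x₁)‖ -
      ‖f (scale lam (n j) * σ j x₁) - partialSum f (n j - 1) (scale lam (n j) * σ j x₁)‖) := by
    constructor
    · obtain ⟨g, hg1, hg2, hg3, hg4⟩ := h1 x₀ (Set.left_mem_Icc.2 hx)
      rw [hg4, sub_nonpos]
      refine mul_le_of_le_one_right hg3.le ?_
      have hg0 : 0 ≤ g := le_trans (by positivity) hg1
      calc _ ≤ Real.exp (-(n j : ℝ) ^ η) * (n j : ℝ) ^ K := by gcongr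
        _ ≤ 1 := by rw [mul_comm]; exact h4.le
    · obtain ⟨g, hg1, hg2, hg3, hg4⟩ := h1 x₁ (Set.right_mem_Icc.2 hx)
      rw [hg4, sub_nonneg]
      refine le_mul_of_one_le_right hg3.le ?_
      have h6 : 1 ≤ Real.exp ((n j : ℝ) ^ η) * (n j : ℝ) ^ (-K) := by
        rw [Real.rpow_neg h0.le, ← div_eq_mul_inv, one_le_div (by positivity)]
        rw [Real.exp_neg, ← div_eq_mul_inv, div_lt_one (Real.exp_pos _)] at h4
        exact h4.le
      refine h6.trans ?_
      gcongr
  obtain ⟨x, hx1, hx2⟩ := hiv hmem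
  exact ⟨x, hx1, sub_eq_zero.1 hx2⟩

end Growth


/-! ### Nonzero limits of the remainder, directly and under magnification. -/

namespace Moderate

variable {ι : Type*} {l : Filter ι} {n : ι → ℕ}

lemma add {g h : ι → ℝ} (hn : Tendsto n l atTop) (hg : Moderate l n g) (hh : Moderate l n h) :
    Moderate l n (fun i => g i + h i) := by
  have hgp := hg.pos hn
  have hhp := hh.pos hn
  obtain ⟨K, hK⟩ := hg
  obtain ⟨K', hK'⟩ := hh
  have hub : Moderate l n fun i => (n i : ℝ) ^ max K K' * 2 :=
    (natCast_rpow hn _).mul hn (of_tendsto hn two_pos tendsto_const_nhds)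
  refine of_between ⟨K, hK⟩ hub hn ?_
  filter_upwards [hK, hK', hgp, hhp, hn.eventually_ge_atTop 1] with i h1 h2 h3 h4 h5
  have h6 : (1 : ℝ) ≤ n i := by exact_mod_cast h5
  have h7 := Real.rpow_le_rpow_of_exponent_le h6 (le_max_left K K')
  have h8 := Real.rpow_le_rpow_of_exponent_le h6 (le_max_right K K')
  exact ⟨by linarith, by linarith [h1.2, h2.2]⟩

lemma sum {κ : Type*} {t : Finset κ} (ht : t.Nonempty) {g : κ → ι → ℝ} (hn : Tendsto n l atTop)
    (hg : ∀ k, Moderate l n (g k)) : Moderate l n (fun i => ∑ k ∈ t, g k i) := by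
  induction ht using Finset.Nonempty.cons_induction with
  | singleton a => simpa using hg a
  | cons a t ha ht ih => simpa only [Finset.sum_cons] using (hg a).add hn ih

end Moderate

/-- A nontrivial combination of simple fractions with distinct poles is not locally zero. -/
lemma eq_zero_of_sum_div_eventually_eq_zero {m : ℕ} {ζ c : Fin m → ℂ}
    (hinj : Function.Injective ζ) {ξ : ℂ} (hne : ∀ k, ζ k ≠ ξ)
    (h : ∀ᶠ z in 𝓝 ξ, ∑ k, c k / (ζ k - z) = 0) : c = 0 := by
  -- Clearing denominators gives a polynomial with infinitely many roots, hence zero; its value at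
  -- `ζ k` isolates `c k`.
  set P : Polynomial ℂ := ∑ k, Polynomial.C (c k) *
    ∏ j ∈ Finset.univ.erase k, (Polynomial.C (ζ j) - Polynomial.X) with hP
  have heval : ∀ z, P.eval z = ∑ k, c k * ∏ j ∈ Finset.univ.erase k, (ζ j - z) := by
    intro z
    rw [hP, Polynomial.eval_finsetSum]
    refine Finset.sum_congr rfl fun k _ => ?_
    rw [Polynomial.eval_mul, Polynomial.eval_C, Polynomial.eval_prod]
    simp
  have hP0 : P = 0 := by
    refine Polynomial.eq_zero_of_infinite_isRoot P ?_
    have hne' : ∀ᶠ z in 𝓝 ξ, ∀ k, ζ k - z ≠ 0 := by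
      rw [eventually_all]
      intro k
      filter_upwards [(isOpen_ne (x := ζ k)).mem_nhds (hne k).symm] with z hz
      exact sub_ne_zero.2 (Ne.symm hz)
    refine Set.Infinite.mono ?_ (infinite_of_mem_nhds ξ (h.and hne'))
    rintro z ⟨hz, hz'⟩
    change P.eval z = 0
    rw [heval]
    have : (∑ k, c k / (ζ k - z)) * ∏ j, (ζ j - z) = 0 := by rw [hz, zero_mul]
    rw [← this, Finset.sum_mul]
    refine Finset.sum_congr rfl fun k _ => ?_
    rw [← Finset.mul_prod_erase _ _ (Finset.mem_univ k)]
    have := hz' k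
    field_simp
  ext k
  have h1 := heval (ζ k)
  rw [hP0, Polynomial.eval_zero, Finset.sum_eq_single k] at h1
  · rcases mul_eq_zero.1 h1.symm with h2 | h2
    · exact h2
    · obtain ⟨j, hj, hj0⟩ := Finset.prod_eq_zero_iff.1 h2
      exact absurd (hinj (sub_eq_zero.1 hj0)) (Finset.ne_of_mem_erase hj)
  · intro j _ hjk
    rw [Finset.prod_eq_zero (i := k), mul_zero]
    · exact Finset.mem_erase.2 ⟨hjk.symm, Finset.mem_univ _⟩
    · exact sub_self _
  · simp

/-- Cauchy's estimates bound the tail by a geometric series with ratio at most `1/2`, whence the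
factor `2`. -/
lemma norm_sub_taylor_le {h : ℂ → ℂ} {ξ : ℂ} {ρ M : ℝ} (hρ : 0 < ρ)
    (hd : DifferentiableOn ℂ h (closedBall ξ ρ)) (hM : ∀ z ∈ sphere ξ ρ, ‖h z‖ ≤ M) (q : ℕ) {w : ℂ}
    (hw : ‖w‖ ≤ ρ / 2) :
    ‖h (ξ + w) - ∑ i ∈ Finset.range q, iteratedDeriv i h ξ / (i.factorial : ℂ) * w ^ i‖ ≤
      2 * M * (‖w‖ / ρ) ^ q := by
  have hdc : DiffContOnCl ℂ h (ball ξ ρ) :=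
    (hd.mono closure_ball_subset_closedBall).diffContOnCl
  have hc : ∀ i, ‖iteratedDeriv i h ξ‖ ≤ i.factorial * M / ρ ^ i := fun i =>
    Complex.norm_iteratedDeriv_le_of_forall_mem_sphere_norm_le i hρ hdc hM
  have hsum := Complex.hasSum_taylorSeries_on_ball (f := h) (c := ξ) (r := ρ) (z := ξ + w)
    (hd.mono ball_subset_closedBall) (by rw [mem_ball_iff_norm, add_sub_cancel_left]; linarith)
  have h1 := (hasSum_nat_add_iff' q).2 hsum
  have hx0 : 0 ≤ ‖w‖ / ρ := by positivity
  have hx : ‖w‖ / ρ ≤ 1 / 2 := by rw [div_le_iff₀ hρ]; linarith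
  have hgeo := ((hasSum_geometric_of_lt_one hx0 (by linarith)).mul_left (M * (‖w‖ / ρ) ^ q))
  have hM0 : 0 ≤ M := by
    have h2 := hc 0
    simp only [Nat.factorial_zero, pow_zero, div_one, Nat.cast_one, one_mul] at h2
    exact (norm_nonneg _).trans h2
  have h2 := h1.norm_le_of_bounded hgeo (fun i => by
    have hf : (0 : ℝ) < ((i + q).factorial : ℝ) := by positivity
    rw [add_sub_cancel_left, smul_eq_mul, smul_eq_mul, norm_mul, norm_mul, norm_pow, norm_inv,
      Complex.norm_natCast]
    calc _ ≤ ((i + q).factorial : ℝ)⁻¹ *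
          (‖w‖ ^ (i + q) * ((i + q).factorial * M / ρ ^ (i + q))) := by
          gcongr
          exact hc _
      _ = M * (‖w‖ / ρ) ^ q * (‖w‖ / ρ) ^ i := by
          rw [div_pow, div_pow, pow_add, pow_add]; field_simp)
  have h3 : ∑ i ∈ Finset.range q, ((i.factorial : ℂ)⁻¹ • (ξ + w - ξ) ^ i • iteratedDeriv i h ξ) =
      ∑ i ∈ Finset.range q, iteratedDeriv i h ξ / (i.factorial : ℂ) * w ^ i := by
    refine Finset.sum_congr rfl fun i _ => ?_
    rw [add_sub_cancel_left, smul_eq_mul, smul_eq_mul]; ring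
  rw [h3] at h2
  refine h2.trans ?_
  have h4 : (1 - ‖w‖ / ρ)⁻¹ ≤ 2 := by
    rw [inv_le_comm₀ (by linarith) two_pos]; linarith
  calc _ ≤ M * (‖w‖ / ρ) ^ q * 2 := by gcongr
    _ = _ := by ring


/-- Under magnification at a point, a convergent sequence of holomorphic functions with nonzero
limit has a subsequence which, suitably normalized, converges to a nonzero polynomial. -/
theorem exists_zoom {h : ℕ → ℂ → ℂ} {Q : ℂ → ℂ} {ξ : ℂ} {ρ₀ : ℝ} (hρ₀ : 0 < ρ₀)
    (hd : ∀ᶠ j in atTop, DifferentiableOn ℂ (h j) (closedBall ξ ρ₀))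
    (hQd : DifferentiableOn ℂ Q (closedBall ξ ρ₀))
    (hlim : Tendsto (fun p : ℕ × ℂ => h p.1 p.2 - Q p.2) (atTop ×ˢ 𝓟 (closedBall ξ ρ₀)) (𝓝 0))
    (hQ : ¬ ∀ᶠ z in 𝓝 ξ, Q z = 0) {ρ : ℕ → ℝ} (hρ : ∀ᶠ j in atTop, 0 < ρ j)
    (hρ0 : Tendsto ρ atTop (𝓝 0)) :
    ∃ (q : ℕ) (φ : ℕ → ℕ) (μ : ℕ → ℝ) (T : Polynomial ℂ) (c C : ℝ), StrictMono φ ∧ T ≠ 0 ∧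
      0 < c ∧ (∀ᶠ j in atTop, c * ρ j ^ q ≤ μ j ∧ μ j ≤ C) ∧
      ∀ B : ℝ, Tendsto (fun p : ℕ × ℂ => h (φ p.1) (ξ + ρ (φ p.1) * p.2) / μ (φ p.1) - T.eval p.2)
        (atTop ×ˢ 𝓟 (closedBall 0 B)) (𝓝 0) := by
  obtain ⟨M₀, hM₀⟩ := (isCompact_closedBall ξ ρ₀).exists_bound_of_continuousOn hQd.continuousOn
  have hM₀0 : 0 ≤ M₀ := (norm_nonneg _).trans (hM₀ ξ (mem_closedBall_self hρ₀.le))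
  set M := M₀ + 1 with hM
  set a : ℕ → ℕ → ℂ := fun j i => iteratedDeriv i (h j) ξ / (i.factorial : ℂ) with ha
  have hMj : ∀ᶠ j in atTop, ∀ z ∈ closedBall ξ ρ₀, ‖h j z‖ ≤ M := by
    have h1 := hlim.norm.eventually_lt_const (show ‖(0 : ℂ)‖ < 1 by simp)
    rw [eventually_prod_principal_iff] at h1
    filter_upwards [h1] with j hj z hz
    have h2 := hj z hz
    have h3 := norm_sub_norm_le (h j z) (Q z)
    linarith [hM₀ z hz]
  have hcoef : ∀ᶠ j in atTop, ∀ i, ‖a j i‖ ≤ M / ρ₀ ^ i := by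
    filter_upwards [hMj, hd] with j h1 h2 i
    have := Complex.norm_iteratedDeriv_le_of_forall_mem_sphere_norm_le i hρ₀
      (h2.mono closure_ball_subset_closedBall).diffContOnCl
      (fun z hz => h1 z (sphere_subset_closedBall hz))
    rw [ha]
    simp only
    rw [norm_div, Complex.norm_natCast, div_le_iff₀ (by positivity)]
    calc _ ≤ _ := this
      _ = _ := by ring
  -- The limit may vanish at `ξ`, but only to finite order. By Cauchy's estimates for `h j - Q`, the
  -- `q`-th coefficients of `h j` stay away from `0`.
  obtain ⟨q, hq⟩ : ∃ q, iteratedDeriv q Q ξ ≠ 0 := by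
    by_contra! hall
    apply hQ
    filter_upwards [ball_mem_nhds ξ hρ₀] with z hz
    have h1 := Complex.hasSum_taylorSeries_on_ball (hQd.mono ball_subset_closedBall) hz
    simp only [hall, smul_zero] at h1
    exact h1.unique hasSum_zero
  have haq : ∃ c > 0, ∀ᶠ j in atTop, c ≤ ‖a j q‖ := by
    set α : ℝ := ‖iteratedDeriv q Q ξ‖ with hα
    have hα0 : 0 < α := norm_pos_iff.2 hq
    have hqf : (0 : ℝ) < q.factorial := by positivity
    refine ⟨α / 2 / q.factorial, by positivity, ?_⟩
    have h1 := hlim.norm.eventually_lt_const (show ‖(0 : ℂ)‖ < α / 2 / q.factorial * ρ₀ ^ q by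
      rw [norm_zero]; positivity)
    rw [eventually_prod_principal_iff] at h1
    filter_upwards [h1, hd] with j h2 h3
    have h4 := Complex.norm_iteratedDeriv_le_of_forall_mem_sphere_norm_le q hρ₀
      ((h3.sub hQd).mono closure_ball_subset_closedBall).diffContOnCl
      (fun z hz => (h2 z (sphere_subset_closedBall hz)).le)
    have hcd : ∀ g : ℂ → ℂ, DifferentiableOn ℂ g (closedBall ξ ρ₀) → ContDiffAt ℂ q g ξ :=
      fun g hg => (hg.analyticAt (closedBall_mem_nhds ξ hρ₀)).contDiffAt
    rw [iteratedDeriv_sub (hcd _ h3) (hcd _ hQd)] at h4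
    have h5 : (q.factorial : ℝ) * (α / 2 / q.factorial * ρ₀ ^ q) / ρ₀ ^ q = α / 2 := by
      field_simp
    rw [h5] at h4
    have h6 := norm_sub_norm_le (iteratedDeriv q Q ξ) (iteratedDeriv q Q ξ - iteratedDeriv q (h j) ξ)
    rw [sub_sub_cancel, norm_sub_rev] at h6
    rw [ha]
    simp only
    rw [norm_div, Complex.norm_natCast]
    gcongr
    linarith
  obtain ⟨c, hc, hcq⟩ := haq
  -- Normalizing by the total size of the magnified coefficients up to degree `q`, rather than by
  -- one of them, keeps them in a compact set with `ℓ¹` norm `1`. So a limit polynomial exists and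
  -- is nonzero, and `μ j ≥ c ρ_j^q` makes the Taylor remainder, of order `ρ_j^{q+1}`, negligible.
  set μ : ℕ → ℝ := fun j => ∑ i ∈ Finset.range (q + 1), ‖a j i‖ * ρ j ^ i with hμ
  have hμlow : ∀ᶠ j in atTop, c * ρ j ^ q ≤ μ j := by
    filter_upwards [hcq, hρ] with j h1 h2
    calc c * ρ j ^ q ≤ ‖a j q‖ * ρ j ^ q := by gcongr
      _ ≤ μ j := Finset.single_le_sum (f := fun i => ‖a j i‖ * ρ j ^ i)
          (fun i _ => by positivity) (Finset.mem_range.2 (Nat.lt_succ_self q))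
  have hμup : ∀ᶠ j in atTop, μ j ≤ ∑ i ∈ Finset.range (q + 1), M / ρ₀ ^ i := by
    filter_upwards [hcoef, hρ, hρ0.eventually_le_const one_pos] with j h1 h2 h3
    refine Finset.sum_le_sum fun i _ => ?_
    calc ‖a j i‖ * ρ j ^ i ≤ M / ρ₀ ^ i * 1 := by
          gcongr
          · exact h1 i
          · exact pow_le_one₀ h2.le h3
      _ = _ := mul_one _
  have hμpos : ∀ᶠ j in atTop, 0 < μ j := by
    filter_upwards [hμlow, hρ] with j h1 h2
    exact lt_of_lt_of_le (by positivity) h1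
  set β : ℕ → (Fin (q + 1) → ℂ) := fun j i => a j i * ρ j ^ (i : ℕ) / μ j with hβ
  have hβ1 : ∀ᶠ j in atTop, ∑ i, ‖β j i‖ = 1 := by
    filter_upwards [hμpos, hρ] with j h1 h2
    have h3 : ∀ i : Fin (q + 1), ‖β j i‖ = ‖a j i‖ * ρ j ^ (i : ℕ) / μ j := by
      intro i
      rw [hβ]
      simp only
      rw [norm_div, norm_mul, norm_pow, Complex.norm_real, Complex.norm_real,
        Real.norm_of_nonneg h1.le, Real.norm_of_nonneg h2.le]
    simp only [h3]
    rw [← Finset.sum_div, Fin.sum_univ_eq_sum_range (fun i => ‖a j i‖ * ρ j ^ i) (q + 1)]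
    exact div_self h1.ne'
  obtain ⟨β', hβ', φ, hφ, hφlim⟩ := tendsto_subseq_of_frequently_bounded
    (isBounded_closedBall (x := (0 : Fin (q + 1) → ℂ)) (r := 1)) (x := β) (by
      refine Eventually.frequently ?_
      filter_upwards [hβ1] with j hj
      rw [mem_closedBall_zero_iff, pi_norm_le_iff_of_nonneg zero_le_one]
      intro i
      rw [← hj]
      exact Finset.single_le_sum (f := fun i => ‖β j i‖) (fun _ _ => norm_nonneg _)
        (Finset.mem_univ i))
  have hcoord : ∀ i, Tendsto (fun j => β (φ j) i) atTop (𝓝 (β' i)) := fun i =>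
    (tendsto_pi_nhds.1 hφlim) i
  have hβ'1 : ∑ i, ‖β' i‖ = 1 := by
    have h1 := tendsto_finsetSum Finset.univ fun i _ => (hcoord i).norm
    refine tendsto_nhds_unique h1 (Tendsto.congr' ?_ tendsto_const_nhds)
    filter_upwards [hφ.tendsto_atTop.eventually hβ1] with j hj
    exact hj.symm
  set T : Polynomial ℂ := ∑ i : Fin (q + 1), Polynomial.C (β' i) * Polynomial.X ^ (i : ℕ) with hT
  have hTeval : ∀ t, T.eval t = ∑ i : Fin (q + 1), β' i * t ^ (i : ℕ) := by
    intro t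
    rw [hT, Polynomial.eval_finsetSum]
    simp
  have hT0 : T ≠ 0 := by
    intro h0
    have h1 : ∀ i, β' i = 0 := by
      intro i
      have h2 := congrArg (fun p => Polynomial.coeff p (i : ℕ)) h0
      simp only [hT, Polynomial.finsetSum_coeff, Polynomial.coeff_C_mul_X_pow,
        Polynomial.coeff_zero] at h2
      rw [Finset.sum_eq_single i] at h2
      · simpa using h2
      · intro k _ hk
        rw [if_neg]
        exact fun h => hk (Fin.ext h.symm)
      · simp
    simp [h1] at hβ'1
  refine ⟨q, φ, μ, T, c, _, hφ, hT0, hc, hμlow.and hμup, fun B => ?_⟩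
  set l : Filter (ℕ × ℂ) := atTop ×ˢ 𝓟 (closedBall 0 B) with hl
  have hfst : Tendsto (Prod.fst : ℕ × ℂ → ℕ) l atTop := tendsto_fst
  have hφl : Tendsto (fun p : ℕ × ℂ => φ p.1) l atTop := hφ.tendsto_atTop.comp hfst
  have hball : ∀ᶠ p in l, ‖p.2‖ ≤ B := by
    rw [hl, eventually_prod_principal_iff]
    exact Eventually.of_forall fun j v hv => by simpa using hv
  have hsum0 : Tendsto (fun p : ℕ × ℂ => ∑ i, (β (φ p.1) i - β' i) * p.2 ^ (i : ℕ)) l (𝓝 0) := by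
    rw [← Finset.sum_const_zero (s := (Finset.univ : Finset (Fin (q + 1))))]
    refine tendsto_finsetSum _ fun i _ => ?_
    have h1 : Tendsto (fun p : ℕ × ℂ => ‖β (φ p.1) i - β' i‖ * B ^ (i : ℕ)) l (𝓝 0) := by
      have := ((((hcoord i).comp hfst).sub_const (β' i)).norm).mul_const (B ^ (i : ℕ))
      simpa using this
    refine squeeze_zero_norm' ?_ h1
    filter_upwards [hball] with p hp
    rw [norm_mul, norm_pow]
    gcongr
  have hrem : Tendsto (fun p : ℕ × ℂ => (h (φ p.1) (ξ + ρ (φ p.1) * p.2) -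
      ∑ i ∈ Finset.range (q + 1), a (φ p.1) i * (ρ (φ p.1) * p.2) ^ i) / μ (φ p.1)) l (𝓝 0) := by
    have h1 : Tendsto (fun p : ℕ × ℂ => 2 * M * (B / ρ₀) ^ (q + 1) / c * ρ (φ p.1)) l (𝓝 0) := by
      have := (hρ0.comp hφl).const_mul (2 * M * (B / ρ₀) ^ (q + 1) / c)
      simpa using this
    refine squeeze_zero_norm' ?_ h1
    have h2 : Tendsto (fun p : ℕ × ℂ => ρ (φ p.1) * B) l (𝓝 0) := by
      simpa using (hρ0.comp hφl).mul_const B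
    filter_upwards [hball, hφl.eventually hμlow, hφl.eventually hρ, hφl.eventually hd,
      hφl.eventually hMj, h2.eventually_le_const (half_pos hρ₀), hφl.eventually hμpos]
      with p h3 h4 h5 h6 h7 h8 h9
    have hw : ‖(ρ (φ p.1) : ℂ) * p.2‖ ≤ ρ (φ p.1) * B := by
      rw [norm_mul, Complex.norm_real, Real.norm_of_nonneg h5.le]
      gcongr
    have h10 := norm_sub_taylor_le hρ₀ h6 (fun z hz => h7 z (sphere_subset_closedBall hz)) (q + 1)
      (hw.trans h8)
    rw [norm_div, Complex.norm_real, Real.norm_of_nonneg h9.le, div_le_iff₀ h9]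
    have hB0 : 0 ≤ B := (norm_nonneg _).trans h3
    calc _ ≤ 2 * M * (‖(ρ (φ p.1) : ℂ) * p.2‖ / ρ₀) ^ (q + 1) := h10
      _ ≤ 2 * M * (ρ (φ p.1) * B / ρ₀) ^ (q + 1) := by gcongr
      _ = 2 * M * (B / ρ₀) ^ (q + 1) / c * ρ (φ p.1) * (c * ρ (φ p.1) ^ q) := by
        rw [mul_div_assoc, mul_pow, pow_succ (ρ (φ p.1))]; field_simp
      _ ≤ _ := by gcongr
  have h11 := hrem.add hsum0
  rw [add_zero] at h11
  refine h11.congr' ?_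
  filter_upwards [hφl.eventually hμpos] with p h9
  have h9' : (μ (φ p.1) : ℂ) ≠ 0 := by exact_mod_cast h9.ne'
  have h12 : ∑ i, (β (φ p.1) i - β' i) * p.2 ^ (i : ℕ) =
      (∑ i ∈ Finset.range (q + 1), a (φ p.1) i * (ρ (φ p.1) * p.2) ^ i) / μ (φ p.1) -
      T.eval p.2 := by
    rw [hTeval, ← Fin.sum_univ_eq_sum_range
      (fun i => a (φ p.1) i * ((ρ (φ p.1) : ℂ) * p.2) ^ i) (q + 1), Finset.sum_div,
      ← Finset.sum_sub_distrib]
    refine Finset.sum_congr rfl fun i _ => ?_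
    rw [hβ]
    simp only
    rw [mul_pow]
    field_simp
  rw [h12]
  ring


namespace Growth

variable {f : ℂ → ℂ} {m : ℕ} {A b c ζ : Fin (m + 1) → ℂ} {lam mu θ : ℝ}

lemma dir_ne_zero (hf : Growth f A b c ζ lam mu θ) (k : Fin (m + 1)) : ζ k ≠ 0 :=
  norm_pos_iff.1 (by rw [hf.dir_norm k]; exact one_pos)

lemma dir_injective (hf : Growth f A b c ζ lam mu θ) (hθ : 0 < θ) : Function.Injective ζ := by
  intro j k hjk
  by_contra hne
  have hmem : ζ j ∈ sector θ (ζ j) := by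
    refine ⟨hf.dir_ne_zero j, ?_⟩
    rw [div_self (hf.dir_ne_zero j), Complex.arg_one, abs_zero]
    exact hθ.le
  exact Set.disjoint_left.1 (hf.disjoint j k hne) hmem (hjk ▸ hmem)

lemma one_sub_norm_le (hf : Growth f A b c ζ lam mu θ) (k : Fin (m + 1)) (s : ℂ) :
    1 - ‖s‖ ≤ ‖ζ k - s‖ := by
  have := norm_sub_norm_le (ζ k) s
  rwa [hf.dir_norm k] at this

end Growth

/-- Total size of the subexponential factors. -/
noncomputable def slowSum {m : ℕ} (b c : Fin (m + 1) → ℂ) (lam : ℝ) (n : ℕ) : ℝ :=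
  ∑ k, ‖slow (b k) (c k) (scale lam n)‖

lemma moderate_slowSum {m : ℕ} (b c : Fin (m + 1) → ℂ) {lam : ℝ} (hlam : 0 < lam) {ι : Type*}
    {l : Filter ι} {n : ι → ℕ} (hn : Tendsto n l atTop) :
    Moderate l n (fun i => slowSum b c lam (n i)) :=
  Moderate.sum Finset.univ_nonempty hn fun k => Moderate.slow hlam hn (b k) (c k)

lemma tendsto_sqrt_mul_one_sub {ι : Type*} {l : Filter ι} {n : ι → ℕ} {s : ι → ℂ}
    (hn : Tendsto n l atTop) {κ : ℝ} (hκ : κ < 1) (hs : ∀ᶠ i in l, ‖s i‖ ≤ κ) :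
    Tendsto (fun i => √(n i : ℝ) * (1 - ‖s i‖)) l atTop := by
  have hsq : Tendsto (fun i => √(n i : ℝ)) l atTop :=
    Real.tendsto_sqrt_atTop.comp (tendsto_natCast_atTop_atTop.comp hn)
  refine tendsto_atTop_mono' l ?_ (hsq.atTop_mul_const (sub_pos.2 hκ))
  filter_upwards [hs] with i hi
  gcongr

namespace Growth

variable {f : ℂ → ℂ} {m : ℕ} {A b c ζ : Fin (m + 1) → ℂ} {lam mu θ : ℝ}

/-- Along a subsequence the normalized remainders converge to a nontrivial rational function. -/
theorem exists_subseq_remInt_limit (hf : Growth f A b c ζ lam mu θ) (hlam : 0 < lam)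
    (hmu : mu < 1) (hθ : 0 < θ) (hθπ : θ < Real.pi) (hlamθ : lam * θ < 2 * Real.pi)
    {n : ℕ → ℕ} (hn : Tendsto n atTop atTop) :
    ∃ (φ : ℕ → ℕ) (a : Fin (m + 1) → ℂ), StrictMono φ ∧ a ≠ 0 ∧ ∀ κ < 1,
      Tendsto (fun p : ℕ × ℂ => remInt f (scale lam (n (φ p.1))) (n (φ p.1)) p.2 /
        (saddleSize lam (n (φ p.1)) * slowSum b c lam (n (φ p.1))) - ∑ k, A k * a k / (ζ k - p.2))
        (atTop ×ˢ 𝓟 (closedBall 0 κ)) (𝓝 0) := by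
  -- The unimodular factors `ζ_k^{1-n}` and the relative sizes of the directions need not converge.
  -- Divided by `slowSum` the coefficients have `ℓ¹` norm `1`, so compactness provides a nonzero
  -- limit vector.
  set α : ℕ → Fin (m + 1) → ℂ := fun j k =>
    slow (b k) (c k) (scale lam (n j)) * (ζ k / ζ k ^ n j) / slowSum b c lam (n j) with hα
  have hpos : ∀ᶠ j in atTop, 0 < slowSum b c lam (n j) := (moderate_slowSum b c hlam hn).pos hn
  have hα1 : ∀ᶠ j in atTop, ∑ k, ‖α j k‖ = 1 := by
    filter_upwards [hpos] with j hj
    have h1 : ∀ k, ‖α j k‖ = ‖slow (b k) (c k) (scale lam (n j))‖ / slowSum b c lam (n j) := by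
      intro k
      rw [hα]
      simp only
      rw [norm_div, norm_mul, norm_div, norm_pow, hf.dir_norm k, one_pow, div_one, mul_one,
        Complex.norm_real, Real.norm_of_nonneg hj.le]
    simp only [h1]
    rw [← Finset.sum_div]
    exact div_self hj.ne'
  obtain ⟨a, ha, φ, hφ, hφlim⟩ := tendsto_subseq_of_frequently_bounded
    (isBounded_closedBall (x := (0 : Fin (m + 1) → ℂ)) (r := 1)) (x := α) (by
      refine Eventually.frequently ?_
      filter_upwards [hα1] with j hj
      rw [mem_closedBall_zero_iff, pi_norm_le_iff_of_nonneg zero_le_one]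
      intro i
      rw [← hj]
      exact Finset.single_le_sum (f := fun i => ‖α j i‖) (fun _ _ => norm_nonneg _)
        (Finset.mem_univ i))
  have hcoord : ∀ i, Tendsto (fun j => α (φ j) i) atTop (𝓝 (a i)) := fun i =>
    (tendsto_pi_nhds.1 hφlim) i
  refine ⟨φ, a, hφ, ?_, fun κ hκ => ?_⟩
  · rintro rfl
    have h1 := tendsto_finsetSum Finset.univ fun i _ => (hcoord i).norm
    have h2 : Tendsto (fun j => ∑ i, ‖α (φ j) i‖) atTop (𝓝 1) := by
      refine Tendsto.congr' ?_ tendsto_const_nhds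
      filter_upwards [hφ.tendsto_atTop.eventually hα1] with j hj
      exact hj.symm
    have h3 := tendsto_nhds_unique h1 h2
    simp at h3
  set l : Filter (ℕ × ℂ) := atTop ×ˢ 𝓟 (closedBall 0 κ) with hl
  have hfst : Tendsto (Prod.fst : ℕ × ℂ → ℕ) l atTop := tendsto_fst
  have hφl : Tendsto (fun p : ℕ × ℂ => φ p.1) l atTop := hφ.tendsto_atTop.comp hfst
  have hnl : Tendsto (fun p : ℕ × ℂ => n (φ p.1)) l atTop := hn.comp hφl
  have hball : ∀ᶠ p in l, ‖p.2‖ ≤ κ := by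
    rw [hl, eventually_prod_principal_iff]
    exact Eventually.of_forall fun j v hv => by simpa using hv
  obtain ⟨e, y, he, hy, hR⟩ := hf.remInt_asymp hlam hmu hθ hθπ hlamθ hnl
    (s := Prod.snd) (tendsto_sqrt_mul_one_sub hnl hκ hball)
  have hyD : Tendsto (fun p : ℕ × ℂ => y p / slowSum b c lam (n (φ p.1))) l (𝓝 0) := by
    obtain ⟨K, hK⟩ := (moderate_slowSum b c hlam hnl).inv hnl
    refine squeeze_zero_norm' ?_ (hy K)
    filter_upwards [hK, hφl.eventually hpos] with p h1 h2
    rw [norm_div, Complex.norm_real, Real.norm_of_nonneg h2.le, div_eq_mul_inv, mul_comm]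
    gcongr
    exact h1.2
  have hterm : ∀ k, Tendsto (fun p : ℕ × ℂ => (e k p * α (φ p.1) k - A k * a k) / (ζ k - p.2)) l
      (𝓝 0) := by
    intro k
    have h1 : Tendsto (fun p : ℕ × ℂ => ‖e k p * α (φ p.1) k - A k * a k‖ / (1 - κ)) l (𝓝 0) := by
      have := ((((he k).mul ((hcoord k).comp hfst)).sub_const (A k * a k)).norm).div_const (1 - κ)
      simpa using this
    refine squeeze_zero_norm' ?_ h1
    filter_upwards [hball] with p hp
    rw [norm_div]
    have h2 := hf.one_sub_norm_le k p.2
    have h3 : 0 < 1 - κ := by linarith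
    gcongr
    linarith
  have hsum := (tendsto_finsetSum Finset.univ fun k _ => hterm k).add hyD
  rw [Finset.sum_const_zero, add_zero] at hsum
  refine hsum.congr' ?_
  filter_upwards [hR, hφl.eventually hpos, hnl.eventually_ge_atTop 1] with p h1 h2 h3
  have h4 : (saddleSize lam (n (φ p.1)) : ℂ) ≠ 0 := by
    exact_mod_cast (saddleSize_pos hlam h3).ne'
  have h5 : (slowSum b c lam (n (φ p.1)) : ℂ) ≠ 0 := by exact_mod_cast h2.ne'
  rw [h1, mul_div_mul_left _ _ h4, add_div, Finset.sum_div, add_sub_right_comm,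
    ← Finset.sum_sub_distrib]
  congr 1
  refine Finset.sum_congr rfl fun k _ => ?_
  rw [hα]
  simp only
  ring

/-- Follows from the remainder formula after division by `s ^ N`, without differentiating under the
integral; the price is the exclusion of `0`. -/
lemma differentiableOn_remInt (hf : Growth f A b c ζ lam mu θ) {N : ℕ} (hN : 1 ≤ N) (r : ℝ)
    {S : Set ℂ} (hS : ∀ z ∈ S, z ≠ 0 ∧ ‖z‖ < 1) : DifferentiableOn ℂ (remInt f r N) S := by
  have h1 : DifferentiableOn ℂ
      (fun s => (f (r * s) - partialSum f (N - 1) (r * s)) / s ^ N) S := by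
    intro s hs
    refine DifferentiableAt.differentiableWithinAt ?_
    refine DifferentiableAt.div (DifferentiableAt.sub ?_ ?_) (by fun_prop)
      (pow_ne_zero _ (hS s hs).1)
    · exact hf.entire.differentiableAt.comp s (by fun_prop)
    · exact (differentiable_partialSum f _).differentiableAt.comp s (by fun_prop)
  refine h1.congr fun s hs => ?_
  rw [sub_partialSum hf.entire r hN (hS s hs).2, mul_div_cancel_left₀ _ (pow_ne_zero _ (hS s hs).1)]

/-- Polynomial limits of magnified remainders at an interior point. -/
theorem exists_zoom_remInt (hf : Growth f A b c ζ lam mu θ) (hlam : 0 < lam)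
    (hmu : mu < 1) (hθ : 0 < θ) (hθπ : θ < Real.pi) (hlamθ : lam * θ < 2 * Real.pi)
    {ξ : ℂ} (hξ0 : ξ ≠ 0) (hξ1 : ‖ξ‖ < 1) {n : ℕ → ℕ} (hn : Tendsto n atTop atTop)
    {ε : ℝ} (hε : ε < 1) :
    ∃ (φ : ℕ → ℕ) (ν : ℕ → ℝ) (T : Polynomial ℂ), StrictMono φ ∧ T ≠ 0 ∧
      Moderate atTop (fun j => n (φ j)) ν ∧ ∀ B : ℝ, Tendsto (fun p : ℕ × ℂ =>
        remInt f (scale lam (n (φ p.1))) (n (φ p.1))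
          (ξ + ((n (φ p.1) : ℝ) ^ (-1 + ε) : ℝ) * p.2) /
        (saddleSize lam (n (φ p.1)) * ν p.1) - T.eval p.2)
        (atTop ×ˢ 𝓟 (closedBall 0 B)) (𝓝 0) := by
  obtain ⟨φ, a, hφ, ha, hlim⟩ := hf.exists_subseq_remInt_limit hlam hmu hθ hθπ hlamθ hn
  set N : ℕ → ℕ := fun j => n (φ j) with hN
  have hNt : Tendsto N atTop atTop := hn.comp hφ.tendsto_atTop
  obtain ⟨ρ₀, hρ₀, hρball⟩ : ∃ ρ₀ > 0, ∀ z ∈ closedBall ξ ρ₀, z ≠ 0 ∧ ‖z‖ < 1 := by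
    refine ⟨min (‖ξ‖ / 2) ((1 - ‖ξ‖) / 2), lt_min (half_pos (norm_pos_iff.2 hξ0)) (by linarith),
      fun z hz => ?_⟩
    rw [mem_closedBall_iff_norm] at hz
    have h1 := hz.trans (min_le_left _ _)
    have h2 := hz.trans (min_le_right _ _)
    have h3 := norm_pos_iff.2 hξ0
    have h4 := norm_sub_norm_le z ξ
    refine ⟨?_, by linarith⟩
    rintro rfl
    rw [zero_sub, norm_neg] at h1
    linarith
  have hsubset : closedBall ξ ρ₀ ⊆ closedBall 0 (‖ξ‖ + ρ₀) := by
    refine closedBall_subset_closedBall' ?_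
    rw [dist_zero_right]; linarith
  -- Test the ball condition at its point farthest from the origin, `(1 + ρ₀ / ‖ξ‖) ξ`.
  have hκ : ‖ξ‖ + ρ₀ < 1 := by
    have h1 : ‖ξ + (ρ₀ / ‖ξ‖ : ℝ) * ξ‖ < 1 := by
      refine (hρball _ ?_).2
      rw [mem_closedBall_iff_norm, add_sub_cancel_left, norm_mul, Complex.norm_real,
        Real.norm_of_nonneg (by positivity), div_mul_cancel₀ _ (norm_ne_zero_iff.2 hξ0)]
    have h2 : ξ + (ρ₀ / ‖ξ‖ : ℝ) * ξ = ((1 + ρ₀ / ‖ξ‖ : ℝ) : ℂ) * ξ := by push_cast; ring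
    rw [h2, norm_mul, Complex.norm_real, Real.norm_of_nonneg (by positivity), add_mul,
      div_mul_cancel₀ _ (norm_ne_zero_iff.2 hξ0), one_mul] at h1
    exact h1
  set Q : ℂ → ℂ := fun s => ∑ k, A k * a k / (ζ k - s) with hQ
  have hζne : ∀ k, ∀ z : ℂ, ‖z‖ < 1 → ζ k - z ≠ 0 := by
    intro k z hz
    have := hf.one_sub_norm_le k z
    exact norm_pos_iff.1 (by linarith)
  have hQd : DifferentiableOn ℂ Q (closedBall ξ ρ₀) := by
    intro z hz
    refine DifferentiableAt.differentiableWithinAt ?_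
    have h1 : ∀ k ∈ Finset.univ, DifferentiableAt ℂ (fun s => A k * a k / (ζ k - s)) z :=
      fun k _ => DifferentiableAt.div (by fun_prop) (by fun_prop) (hζne k z (hρball z hz).2)
    exact DifferentiableAt.fun_sum h1
  have hQ0 : ¬ ∀ᶠ z in 𝓝 ξ, Q z = 0 := by
    intro h
    have h1 := eq_zero_of_sum_div_eventually_eq_zero (c := fun k => A k * a k)
      (hf.dir_injective hθ) (fun k => sub_ne_zero.1 (hζne k ξ hξ1)) h
    apply ha
    ext k
    have h2 := congrFun h1 k
    simpa [hf.coeff_ne k] using h2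
  have hNr : Tendsto (fun j => (N j : ℝ)) atTop atTop := tendsto_natCast_atTop_atTop.comp hNt
  have hρ0 : Tendsto (fun j => (N j : ℝ) ^ (-1 + ε)) atTop (𝓝 0) := by
    have := (tendsto_rpow_neg_atTop (show 0 < 1 - ε by linarith)).comp hNr
    refine this.congr fun j => ?_
    simp only [Function.comp]
    congr 1; ring
  have hρpos : ∀ᶠ j in atTop, 0 < (N j : ℝ) ^ (-1 + ε) := by
    filter_upwards [hNr.eventually_gt_atTop 0] with j hj
    positivity
  obtain ⟨q, ψ, μ, T, c₀, C, hψ, hT, hc₀, hμ, hz⟩ := exists_zoom (Q := Q) (ξ := ξ) hρ₀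
    (h := fun j s => remInt f (scale lam (N j)) (N j) s /
        (saddleSize lam (N j) * slowSum b c lam (N j))) (by
      filter_upwards [hNt.eventually_ge_atTop 1] with j hj
      exact (hf.differentiableOn_remInt hj _ hρball).div_const _) hQd
    ((hlim _ hκ).mono_left (prod_mono_right _ (principal_mono.2 hsubset))) hQ0
    (ρ := fun j => (N j : ℝ) ^ (-1 + ε)) hρpos hρ0
  have hNψ : Tendsto (fun j => N (ψ j)) atTop atTop := hNt.comp hψ.tendsto_atTop
  refine ⟨φ ∘ ψ, fun j => slowSum b c lam (N (ψ j)) * μ (ψ j), T, hφ.comp hψ, hT, ?_, fun B => ?_⟩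
  -- The bounds `c₀ ρ^q ≤ μ ≤ C`, with `ρ` a power of `n`, make the normalizer of power size, as
  -- `exists_balance` requires.
  · refine (moderate_slowSum b c hlam hNψ).mul hNψ ?_
    have h1 : Moderate atTop (fun j => N (ψ j)) (fun j => c₀ * ((N (ψ j) : ℝ) ^ (-1 + ε)) ^ (q : ℝ)) :=
      (Moderate.of_tendsto hNψ hc₀ tendsto_const_nhds).mul hNψ
        ((Moderate.natCast_rpow hNψ _).rpow hNψ q)
    have h2 : Moderate atTop (fun j => N (ψ j)) (fun _ => max C 1) :=
      Moderate.of_tendsto hNψ (lt_max_of_lt_right one_pos) tendsto_const_nhds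
    refine h1.of_between h2 hNψ ?_
    filter_upwards [hψ.tendsto_atTop.eventually hμ] with j hj
    rw [Real.rpow_natCast]
    exact ⟨hj.1, hj.2.trans (le_max_left _ _)⟩
  · refine (hz B).congr fun p => ?_
    simp only [Function.comp, hN]
    push_cast
    rw [div_div, mul_assoc]

end Growth


/-! ### Counting zeros near a regular point of the limit curve. -/

lemma tendsto_div_of_sub_tendsto_zero {ι : Type*} {l : Filter ι} {x y : ι → ℂ} {c : ℝ}
    (hc : 0 < c) (hy : ∀ᶠ i in l, c ≤ ‖y i‖) (hxy : Tendsto (fun i => x i - y i) l (𝓝 0)) :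
    Tendsto (fun i => x i / y i) l (𝓝 1) := by
  rw [tendsto_iff_norm_sub_tendsto_zero]
  have h1 : Tendsto (fun i => ‖x i - y i‖ / c) l (𝓝 0) := by simpa using hxy.norm.div_const c
  refine squeeze_zero' (Eventually.of_forall fun _ => norm_nonneg _) ?_ h1
  filter_upwards [hy] with i hi
  have h0 : y i ≠ 0 := norm_pos_iff.1 (hc.trans_le hi)
  rw [div_sub_one h0, norm_div]
  gcongr

lemma eventually_rpow_half_le {n : ℕ → ℕ} (hn : Tendsto n atTop atTop) {ε c : ℝ} (hε : 0 < ε)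
    (hc : 0 < c) :
    ∀ᶠ j in atTop, (n j : ℝ) ^ (ε / 2) ≤ c * (n j : ℝ) ^ ε - 1 := by
  have hnr : Tendsto (fun j => (n j : ℝ)) atTop atTop := tendsto_natCast_atTop_atTop.comp hn
  have h1 := (tendsto_rpow_atTop (half_pos hε)).comp hnr
  filter_upwards [h1.eventually_ge_atTop (2 / c), h1.eventually_ge_atTop 1] with j h2 h3
  simp only [Function.comp] at h2 h3
  have h4 : (n j : ℝ) ^ ε = (n j : ℝ) ^ (ε / 2) * (n j : ℝ) ^ (ε / 2) := by
    rw [← Real.rpow_add_of_nonneg (Nat.cast_nonneg _) (half_pos hε).le (half_pos hε).le]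
    congr 1; ring
  rw [h4]
  rw [div_le_iff₀ hc] at h2
  nlinarith

namespace Growth

variable {f : ℂ → ℂ} {m : ℕ} {A b c ζ : Fin (m + 1) → ℂ} {lam mu θ : ℝ}

/-- A path of length of order `n^{-1+ε'}` crosses the curve near `ξ`, with `n Re Φ` running from
about `-n^{ε'}` to `n^{ε'}`, so it contains a balance point. The zeros near it are spaced on the
scale `1/n`; both scales fit into the disk of relative radius `n^{-1+ε}`. -/
theorem tendsto_zeroCount_of_zoom (hf : Growth f A b c ζ lam mu θ) (hlam : 0 < lam)
    {ξ : ℂ} (hξ : ξ ∈ Complex.slitPlane) (hξθ : |ξ.arg| < θ) (hξ1 : ‖ξ‖ < 1)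
    (hre : (phase lam ξ).re = 0) (hdp : dphase lam ξ ≠ 0)
    {n : ℕ → ℕ} (hn : Tendsto n atTop atTop) {ν : ℕ → ℝ} {T : Polynomial ℂ} (hT : T ≠ 0)
    (hν : Moderate atTop n ν) {ε ε' : ℝ} (hε' : 0 < ε') (hε'1 : ε' < 1 / 2) (hεε' : ε' < ε)
    (hz : ∀ B : ℝ, Tendsto (fun p : ℕ × ℂ =>
        remInt f (scale lam (n p.1)) (n p.1) (ξ + ((n p.1 : ℝ) ^ (-1 + ε') : ℝ) * p.2) /
        (saddleSize lam (n p.1) * ν p.1) - T.eval p.2) (atTop ×ˢ 𝓟 (closedBall 0 B)) (𝓝 0)) :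
    Tendsto (fun j => zeroCount (partialSum f (n j - 1)) (scale lam (n j) * ξ)
      (‖ξ‖ * scale lam (n j) * (n j : ℝ) ^ (-1 + ε))) atTop atTop := by
  have hξ0 : ξ ≠ 0 := Complex.slitPlane_ne_zero hξ
  set d : ℂ := (dphase lam ξ)⁻¹ with hd
  have hd0 : d ≠ 0 := inv_ne_zero hdp
  have hnr : Tendsto (fun j => (n j : ℝ)) atTop atTop := tendsto_natCast_atTop_atTop.comp hn
  have hnpos : ∀ᶠ j in atTop, (0 : ℝ) < n j := hnr.eventually_gt_atTop 0
  set ρ : ℕ → ℝ := fun j => (n j : ℝ) ^ (-1 + ε') with hρ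
  have hpow0 : ∀ x : ℝ, x < 0 → Tendsto (fun j => (n j : ℝ) ^ x) atTop (𝓝 0) := by
    intro x hx
    have := (tendsto_rpow_neg_atTop (show 0 < -x by linarith)).comp hnr
    simpa [Function.comp_def] using this
  have hρ0 : Tendsto ρ atTop (𝓝 0) := hpow0 _ (by linarith)
  have hρpos : ∀ᶠ j in atTop, 0 < ρ j := by
    filter_upwards [hnpos] with j hj
    rw [hρ]; positivity
  -- the direction avoiding the roots of the limit polynomial
  obtain ⟨y₀, hy₀⟩ := Infinite.exists_notMem_finset (T.roots.toFinset.image fun t => (t / d).im)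
  -- The factor `d = 1 / Φ'(ξ)` turns the linear term of the phase into `x + i y₀`, so `x` controls
  -- its real part while `y₀` remains free.
  set t : ℝ → ℂ := fun x => d * (x + y₀ * Complex.I) with ht
  have htc : Continuous t := by rw [ht]; fun_prop
  have hTt : ∀ x, T.eval (t x) ≠ 0 := by
    intro x hx
    apply hy₀
    rw [Finset.mem_image]
    refine ⟨t x, ?_, ?_⟩
    · rw [Multiset.mem_toFinset, Polynomial.mem_roots hT]
      exact hx
    · rw [ht]
      simp only
      rw [mul_div_cancel_left₀ _ hd0]
      simp
  have hTc : Continuous fun x => ‖T.eval (t x)‖ := (T.continuous.comp htc).norm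
  obtain ⟨xm, hxm, hmin⟩ := isCompact_Icc.exists_isMinOn (s := Set.Icc (-1 : ℝ) 1)
    ⟨0, by simp⟩ hTc.continuousOn
  obtain ⟨xM, hxM, hmax⟩ := isCompact_Icc.exists_isMaxOn (s := Set.Icc (-1 : ℝ) 1)
    ⟨0, by simp⟩ hTc.continuousOn
  set c₁ := ‖T.eval (t xm)‖ with hc₁
  have hc₁0 : 0 < c₁ := norm_pos_iff.2 (hTt xm)
  set B₀ := ‖d‖ * (1 + |y₀|) with hB₀
  have htB : ∀ x ∈ Set.Icc (-1 : ℝ) 1, ‖t x‖ ≤ B₀ := by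
    intro x hx
    rw [ht, hB₀]
    simp only
    rw [norm_mul]
    gcongr
    refine (norm_add_le _ _).trans ?_
    rw [norm_mul, Complex.norm_I, mul_one, Complex.norm_real, Complex.norm_real, Real.norm_eq_abs,
      Real.norm_eq_abs]
    gcongr
    exact abs_le.2 hx
  set σ : ℕ → ℝ → ℂ := fun j x => ξ + ρ j * t x with hσ
  have hbal : ∀ᶠ j in atTop, ∃ x ∈ Set.Icc (-1 : ℝ) 1, ‖f (scale lam (n j) * σ j x)‖ =
      ‖f (scale lam (n j) * σ j x) - partialSum f (n j - 1) (scale lam (n j) * σ j x)‖ := by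
    set l : Filter (ℕ × ℝ) := atTop ×ˢ 𝓟 (Set.Icc (-1) 1) with hl
    have hfst : Tendsto (Prod.fst : ℕ × ℝ → ℕ) l atTop := tendsto_fst
    have hmemI : ∀ᶠ p in l, p.2 ∈ Set.Icc (-1 : ℝ) 1 := by
      rw [hl, eventually_prod_principal_iff]
      exact Eventually.of_forall fun j v hv => hv
    have hlim : Tendsto (fun p : ℕ × ℝ => σ p.1 p.2) l (𝓝 ξ) := by
      have h1 : Tendsto (fun p : ℕ × ℝ => (ρ p.1 : ℂ) * t p.2) l (𝓝 0) := by
        have h2 : Tendsto (fun p : ℕ × ℝ => |ρ p.1| * B₀) l (𝓝 0) := by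
          simpa [Function.comp_def] using ((hρ0.abs).mul_const B₀).comp hfst
        refine squeeze_zero_norm' ?_ h2
        filter_upwards [hmemI] with p hp
        rw [norm_mul, Complex.norm_real, Real.norm_eq_abs]
        gcongr
        exact htB _ hp
      simpa using h1.const_add ξ
    have hX := (hz B₀).comp (f := fun p : ℕ × ℝ => (p.1, t p.2)) (x := l) (by
      refine tendsto_fst.prodMk ?_
      rw [tendsto_principal]
      filter_upwards [hmemI] with p hp
      simpa using htB _ hp)
    simp only [Function.comp_def] at hX
    -- The quadratic error is of order `n ρ² = n^{-1+2ε'}`, which vanishes in the limit because `ε'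
    -- < 1/2`.
    have hηlim : ∀ x : ℝ, Tendsto (fun j => (n j : ℝ) * (phase lam (σ j x)).re -
        (n j : ℝ) ^ ε' * x) atTop (𝓝 0) := by
      intro x
      obtain ⟨C, hC⟩ := exists_second_order_bound
        ((Complex.isOpen_slitPlane.eventually_mem hξ).mono fun z hz => hasDerivAt_phase hlam hz)
        (contDiffAt_dphase lam hξ)
      have h1 : Tendsto (fun j => σ j x) atTop (𝓝 ξ) := by
        have h2 : Tendsto (fun j => (ρ j : ℂ) * t x) atTop (𝓝 0) := by
          have := (Complex.continuous_ofReal.tendsto 0).comp hρ0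
          simpa [Function.comp_def] using this.mul_const (t x)
        simpa using h2.const_add ξ
      have h2 : Tendsto (fun j => C * ‖t x‖ ^ 2 * (n j : ℝ) ^ (-1 + 2 * ε')) atTop (𝓝 0) := by
        simpa using (hpow0 (-1 + 2 * ε') (by linarith)).const_mul (C * ‖t x‖ ^ 2)
      refine squeeze_zero_norm' ?_ h2
      filter_upwards [((tendsto_const_nhds (x := ξ)).prodMk h1).eventually hC, hnpos, hρpos]
        with j h3 h4 h5
      have h6 : σ j x - ξ = ρ j * t x := add_sub_cancel_left _ _
      simp only [h6] at h3
      have h7 : (phase lam (σ j x) - phase lam ξ - dphase lam ξ * (ρ j * t x)).re =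
          (phase lam (σ j x)).re - ρ j * x := by
        have h8 : dphase lam ξ * (ρ j * t x) = (ρ j : ℂ) * (x + y₀ * Complex.I) := by
          rw [ht, hd]; field_simp
        rw [h8, Complex.sub_re, Complex.sub_re, hre, Complex.re_ofReal_mul]
        simp
      have h8 := (Complex.abs_re_le_norm _).trans h3
      rw [h7] at h8
      have h9 : (n j : ℝ) ^ ε' = n j * ρ j := by
        rw [hρ]
        simp only
        rw [Real.rpow_add h4, Real.rpow_neg_one]; field_simp
      have h10 : (n j : ℝ) ^ (-1 + 2 * ε') = n j * ρ j ^ 2 := by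
        rw [hρ]
        simp only
        rw [← Real.rpow_natCast, ← Real.rpow_mul h4.le, ← Real.rpow_one_add' h4.le]
        · congr 1; push_cast; ring
        · push_cast; intro h; linarith
      rw [h9, h10, mul_assoc, ← mul_sub, norm_mul, Real.norm_natCast, Real.norm_eq_abs]
      calc (n j : ℝ) * |(phase lam (σ j x)).re - ρ j * x| ≤ n j * (C * ‖(ρ j : ℂ) * t x‖ ^ 2) := by
            gcongr
        _ = _ := by
          rw [norm_mul, Complex.norm_real, Real.norm_of_nonneg h5.le]; ring
    have hhalf := eventually_rpow_half_le hn hε' one_pos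
    refine hf.exists_balance hlam hξ hξθ hn (by norm_num) (fun j => by rw [hσ]; fun_prop) hlim
      (hlim.norm.eventually_lt_const hξ1) ?_ (half_pos hε') ?_ ?_
    · have hm1 : Moderate l (fun p : ℕ × ℝ => n p.1) (fun p => ν p.1) := hν.comp hfst
      have hm2 : Moderate l (fun p : ℕ × ℝ => n p.1) (fun p =>
          ‖remInt f (scale lam (n p.1)) (n p.1) (ξ + ((n p.1 : ℝ) ^ (-1 + ε') : ℝ) * t p.2) /
          (saddleSize lam (n p.1) * ν p.1)‖) := by
        refine Moderate.of_bounds (hn.comp hfst) (half_pos hc₁0) (C := ‖T.eval (t xM)‖ + c₁ / 2) ?_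
        filter_upwards [hmemI, hX.norm.eventually_le_const
          (show ‖(0 : ℂ)‖ < c₁ / 2 by rw [norm_zero]; exact half_pos hc₁0)] with p h1 h2
        have h3 : c₁ ≤ ‖T.eval (t p.2)‖ := hmin h1
        have h4 : ‖T.eval (t p.2)‖ ≤ ‖T.eval (t xM)‖ := hmax h1
        rw [norm_sub_rev] at h2
        have h5 := norm_sub_norm_le (T.eval (t p.2)) (remInt f (scale lam (n p.1)) (n p.1)
          (ξ + ((n p.1 : ℝ) ^ (-1 + ε') : ℝ) * t p.2) / (saddleSize lam (n p.1) * ν p.1))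
        have h6 := norm_sub_norm_le (remInt f (scale lam (n p.1)) (n p.1)
          (ξ + ((n p.1 : ℝ) ^ (-1 + ε') : ℝ) * t p.2) / (saddleSize lam (n p.1) * ν p.1))
          (T.eval (t p.2))
        rw [norm_sub_rev] at h6
        constructor <;> linarith
      refine (hm2.mul (hn.comp hfst) hm1).congr' ?_
      filter_upwards [hm1.pos (hn.comp hfst), hfst.eventually (hn.eventually_ge_atTop 1)]
        with p h1 h2
      rw [norm_div, norm_mul, Complex.norm_real, Complex.norm_real, Real.norm_of_nonneg h1.le,
        Real.norm_of_nonneg (saddleSize_pos hlam h2).le]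
      have := saddleSize_pos hlam h2
      simp only [hσ, hρ]
      field_simp
    · filter_upwards [(hηlim (-1)).eventually_le_const (show (0 : ℝ) < 1 by norm_num), hhalf]
        with j h1 h2
      linarith
    · filter_upwards [Filter.Tendsto.eventually_const_le (show (-1 : ℝ) < 0 by norm_num) (hηlim 1),
        hhalf] with j h1 h2
      linarith
  -- choose the balance points
  have hbal' : ∀ j, ∃ x ∈ Set.Icc (-1 : ℝ) 1, (∃ x ∈ Set.Icc (-1 : ℝ) 1,
      ‖f (scale lam (n j) * σ j x)‖ =
      ‖f (scale lam (n j) * σ j x) - partialSum f (n j - 1) (scale lam (n j) * σ j x)‖) →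
      ‖f (scale lam (n j) * σ j x)‖ =
      ‖f (scale lam (n j) * σ j x) - partialSum f (n j - 1) (scale lam (n j) * σ j x)‖ := by
    intro j
    by_cases h : ∃ x ∈ Set.Icc (-1 : ℝ) 1, ‖f (scale lam (n j) * σ j x)‖ =
      ‖f (scale lam (n j) * σ j x) - partialSum f (n j - 1) (scale lam (n j) * σ j x)‖
    · obtain ⟨x, hx, hx'⟩ := h
      exact ⟨x, hx, fun _ => hx'⟩
    -- An arbitrary value for the finitely many indices without a balance point.
    · exact ⟨0, by simp, fun h' => absurd h' h⟩
  choose x hxI hxbal using hbal'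
  set s : ℕ → ℂ := fun j => σ j (x j) with hs
  have hslim : Tendsto s atTop (𝓝 ξ) := by
    have h1 : Tendsto (fun j => (ρ j : ℂ) * t (x j)) atTop (𝓝 0) := by
      have h2 : Tendsto (fun j => |ρ j| * B₀) atTop (𝓝 0) := by
        simpa using (hρ0.abs).mul_const B₀
      refine squeeze_zero_norm (fun j => ?_) h2
      rw [norm_mul, Complex.norm_real, Real.norm_eq_abs]
      gcongr
      exact htB _ (hxI j)
    simpa using h1.const_add ξ
  have hdlim : Tendsto (fun j => dphase lam (s j)) atTop (𝓝 (dphase lam ξ)) :=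
    (contDiffAt_dphase lam hξ).continuousAt.tendsto.comp hslim
  set δ : ℕ → ℂ := fun j => (n j * dphase lam (s j))⁻¹ with hδ
  have hδn : Tendsto (fun j => (n j : ℝ) * ‖δ j‖) atTop (𝓝 ‖d‖) := by
    have h1 := (hdlim.inv₀ hdp).norm
    refine h1.congr' ?_
    filter_upwards [hnpos] with j hj
    rw [hδ]
    simp only
    rw [norm_inv, norm_inv, norm_mul, Complex.norm_natCast]
    field_simp
  have hδpow : ∀ y : ℝ, y < 1 → Tendsto (fun j => (n j : ℝ) ^ y * ‖δ j‖) atTop (𝓝 0) := by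
    intro y hy
    have h1 := (hpow0 (y - 1) (by linarith)).mul hδn
    rw [zero_mul] at h1
    refine h1.congr' ?_
    filter_upwards [hnpos] with j hj
    rw [← mul_assoc, Real.rpow_sub_one hj.ne', div_mul_cancel₀ _ hj.ne']
  have hδ0 : Tendsto δ atTop (𝓝 0) := by
    rw [tendsto_zero_iff_norm_tendsto_zero]
    simpa using hδpow 0 one_pos
  have hδ1 : ∀ᶠ j in atTop, n j * (dphase lam (s j) * δ j) = 1 := by
    filter_upwards [hdlim.eventually_ne hdp, hnpos] with j h1 h2
    have h3 : (n j : ℂ) ≠ 0 := by exact_mod_cast h2.ne'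
    rw [hδ]
    simp only
    field_simp
  have hδ2 : Tendsto (fun j => (n j : ℝ) * ‖δ j‖ ^ 2) atTop (𝓝 0) := by
    have h1 := (hδpow (1 / 2) (by norm_num)).pow 2
    rw [zero_pow two_ne_zero] at h1
    refine h1.congr fun j => ?_
    rw [mul_pow, ← Real.rpow_natCast, ← Real.rpow_mul (Nat.cast_nonneg _)]
    norm_num
  have hfinal : Tendsto (fun j => (ρ j * B₀) / (n j : ℝ) ^ (-1 + ε)) atTop (𝓝 0) := by
    have h1 := (hpow0 (ε' - ε) (by linarith)).mul_const B₀
    rw [zero_mul] at h1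
    refine h1.congr' ?_
    filter_upwards [hnpos] with j hj
    rw [hρ]
    simp only
    rw [mul_div_right_comm, ← Real.rpow_sub hj]
    congr 2; ring
  have hmany := hf.many_zeros hlam hξ hξθ hn hslim hδ0 hδ1 hδ2
    (by filter_upwards [hbal] with j hj; exact hxbal j hj) (fun B => by
      set l : Filter (ℕ × ℂ) := atTop ×ˢ 𝓟 (closedBall 0 B) with hl
      have hfst : Tendsto (Prod.fst : ℕ × ℂ → ℕ) l atTop := tendsto_fst
      have hball : ∀ᶠ p in l, ‖p.2‖ ≤ B := by
        rw [hl, eventually_prod_principal_iff]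
        exact Eventually.of_forall fun j v hv => by simpa using hv
      -- The spacing `δ ~ 1/n` is finer than the magnification scale `ρ = n^{-1+ε'}`. In magnified
      -- coordinates the points merge, so the remainder is asymptotically constant, `T` being
      -- continuous and bounded away from `0` on the path.
      have hu : Tendsto (fun p : ℕ × ℂ => δ p.1 * p.2 / ρ p.1) l (𝓝 0) := by
        have h1 : Tendsto (fun p : ℕ × ℂ => (n p.1 : ℝ) ^ (1 - ε') * ‖δ p.1‖ * B) l (𝓝 0) := by
          simpa [Function.comp_def] using
            ((hδpow (1 - ε') (by linarith)).mul_const B).comp hfst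
        refine squeeze_zero_norm' ?_ h1
        filter_upwards [hball, hfst.eventually hρpos, hfst.eventually hnpos] with p h2 h3 h4
        rw [norm_div, norm_mul, Complex.norm_real, Real.norm_of_nonneg h3.le]
        have h5 : (n p.1 : ℝ) ^ (1 - ε') = (ρ p.1)⁻¹ := by
          rw [hρ]
          simp only
          rw [← Real.rpow_neg h4.le]; congr 1; ring
        rw [h5, div_eq_mul_inv, mul_comm _ (ρ p.1)⁻¹, mul_assoc]
        gcongr
      have hu1 : ∀ᶠ p in l, ‖δ p.1 * p.2 / ρ p.1‖ ≤ 1 :=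
        hu.norm.eventually_le_const (by simp)
      have hY := (hz B₀).comp (f := fun p : ℕ × ℂ => (p.1, t (x p.1))) (x := l) (by
        refine tendsto_fst.prodMk ?_
        rw [tendsto_principal]
        exact Eventually.of_forall fun p => by simpa using htB _ (hxI p.1))
      have hX := (hz (B₀ + 1)).comp
        (f := fun p : ℕ × ℂ => (p.1, t (x p.1) + δ p.1 * p.2 / ρ p.1)) (x := l) (by
        refine tendsto_fst.prodMk ?_
        rw [tendsto_principal]
        filter_upwards [hu1] with p hp
        rw [mem_closedBall_zero_iff]
        exact (norm_add_le _ _).trans (add_le_add (htB _ (hxI p.1)) hp))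
      simp only [Function.comp_def] at hX hY
      have hTT : Tendsto (fun p : ℕ × ℂ => T.eval (t (x p.1) + δ p.1 * p.2 / ρ p.1) -
          T.eval (t (x p.1))) l (𝓝 0) := by
        have huc := (isCompact_closedBall (0 : ℂ) (B₀ + 1)).uniformContinuousOn_of_continuous
          T.continuous.continuousOn
        rw [Metric.uniformContinuousOn_iff] at huc
        rw [Metric.tendsto_nhds]
        intro e he
        obtain ⟨e', he', h1⟩ := huc e he
        filter_upwards [hu1, hu.norm.eventually_lt_const
          (show ‖(0 : ℂ)‖ < e' by rw [norm_zero]; exact he')] with p h2 h3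
        have h4 := h1 (t (x p.1) + δ p.1 * p.2 / ρ p.1) (by
          rw [mem_closedBall_zero_iff]
          exact (norm_add_le _ _).trans (add_le_add (htB _ (hxI p.1)) h2)) (t (x p.1)) (by
          rw [mem_closedBall_zero_iff]
          linarith [htB _ (hxI p.1)]) (by rw [dist_eq_norm, add_sub_cancel_left]; exact h3)
        rw [dist_eq_norm] at h4
        rwa [dist_zero_right]
      have hlow : ∀ᶠ p : ℕ × ℂ in l, c₁ / 2 ≤ ‖remInt f (scale lam (n p.1)) (n p.1)
          (ξ + ((n p.1 : ℝ) ^ (-1 + ε') : ℝ) * t (x p.1)) /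
          (saddleSize lam (n p.1) * ν p.1)‖ := by
        filter_upwards [hY.norm.eventually_le_const
          (show ‖(0 : ℂ)‖ < c₁ / 2 by rw [norm_zero]; exact half_pos hc₁0)] with p h2
        have h3 : c₁ ≤ ‖T.eval (t (x p.1))‖ := hmin (hxI p.1)
        rw [norm_sub_rev] at h2
        have h5 := norm_sub_norm_le (T.eval (t (x p.1))) (remInt f (scale lam (n p.1)) (n p.1)
          (ξ + ((n p.1 : ℝ) ^ (-1 + ε') : ℝ) * t (x p.1)) / (saddleSize lam (n p.1) * ν p.1))
        linarith
      have hsub := (hX.sub hY).add hTT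
      simp only [sub_zero, add_zero] at hsub
      have hq := tendsto_div_of_sub_tendsto_zero (half_pos hc₁0) hlow
        (x := fun p : ℕ × ℂ => remInt f (scale lam (n p.1)) (n p.1)
          (ξ + ((n p.1 : ℝ) ^ (-1 + ε') : ℝ) * (t (x p.1) + δ p.1 * p.2 / ρ p.1)) /
          (saddleSize lam (n p.1) * ν p.1)) (by
          refine hsub.congr fun p => ?_
          ring)
      refine hq.congr' ?_
      filter_upwards [hfst.eventually (hν.pos hn), hfst.eventually (hn.eventually_ge_atTop 1),
        hfst.eventually hρpos] with p h1 h2 h3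
      have h4 : (saddleSize lam (n p.1) * ν p.1 : ℂ) ≠ 0 := by
        exact_mod_cast (mul_pos (saddleSize_pos hlam h2) h1).ne'
      rw [div_div_div_cancel_right₀ h4]
      have h5 : (ρ p.1 : ℂ) ≠ 0 := by exact_mod_cast h3.ne'
      have h6 : ξ + (ρ p.1 : ℂ) * (t (x p.1) + δ p.1 * p.2 / ρ p.1) = s p.1 + δ p.1 * p.2 := by
        rw [hs, hσ]
        simp only
        field_simp
        ring
      rw [← h6])
    (fun B => by
      have h1 : Tendsto (fun p : ℕ × ℂ => s p.1 + δ p.1 * p.2) (atTop ×ˢ 𝓟 (closedBall 0 B))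
          (𝓝 ξ) := by
        have h1 : Tendsto (fun p : ℕ × ℂ => δ p.1 * p.2) (atTop ×ˢ 𝓟 (closedBall 0 B)) (𝓝 0) := by
          have h2 : Tendsto (fun p : ℕ × ℂ => ‖δ p.1‖ * B) (atTop ×ˢ 𝓟 (closedBall 0 B))
              (𝓝 0) := by
            simpa [Function.comp_def] using ((hδ0.norm).mul_const B).comp tendsto_fst
          refine squeeze_zero_norm' ?_ h2
          rw [eventually_prod_principal_iff]
          refine Eventually.of_forall fun j v hv => ?_
          rw [norm_mul]
          gcongr
          simpa using hv
        simpa using (hslim.comp tendsto_fst).add h1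
      exact h1.norm.eventually_lt_const hξ1)
  refine Filter.tendsto_atTop.2 fun N => ?_
  obtain ⟨B, hB, hev⟩ := hmany N
  have hfinal2 : Tendsto (fun j => ‖δ j‖ * B / (n j : ℝ) ^ (-1 + ε)) atTop (𝓝 0) := by
    have h1 := (hδpow (1 - ε) (by linarith)).mul_const B
    rw [zero_mul] at h1
    refine h1.congr' ?_
    filter_upwards [hnpos] with j hj
    rw [show (1 - ε) = -(-1 + ε) by ring, Real.rpow_neg hj.le]
    field_simp
  have hfin := hfinal.add hfinal2
  rw [add_zero] at hfin
  filter_upwards [hev, hfin.eventually_le_const (norm_pos_iff.2 hξ0), hnpos, hρpos,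
    (tendsto_scale hlam hn).eventually_gt_atTop 0] with j h1 h2 h3 h4 h5
  refine h1 _ _ (closedBall_subset_closedBall' ?_)
  rw [dist_eq_norm, ← mul_sub, norm_mul, Complex.norm_real, Real.norm_of_nonneg h5.le]
  have h6 : ‖s j - ξ‖ ≤ ρ j * B₀ := by
    rw [hs, hσ]
    simp only
    rw [add_sub_cancel_left, norm_mul, Complex.norm_real, Real.norm_of_nonneg h4.le]
    gcongr
    exact htB _ (hxI j)
  rw [← add_div, div_le_iff₀ (by positivity)] at h2
  calc _ ≤ scale lam (n j) * (‖δ j‖ * B) + scale lam (n j) * (ρ j * B₀) := by gcongr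
    _ = scale lam (n j) * (ρ j * B₀ + ‖δ j‖ * B) := by ring
    _ ≤ scale lam (n j) * (‖ξ‖ * (n j : ℝ) ^ (-1 + ε)) := by gcongr
    _ = _ := by ring

end Growth


/-! ### Counting zeros near the saddle point `1`. -/

lemma hasDerivAt_dphase_one (lam : ℝ) : HasDerivAt (dphase lam) lam 1 := by
  have h1 := (((hasDerivAt_id (1 : ℂ)).cpow_const (c := (lam : ℂ))
    (by simp [Complex.one_mem_slitPlane])).sub_const 1).div (hasDerivAt_id (1 : ℂ)) (by simp)
  refine HasDerivAt.congr_deriv (f := dphase lam) h1 ?_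
  simp

lemma eventually_norm_dphase_one_add_sub_le (lam : ℝ) {e : ℝ} (he : 0 < e) :
    ∀ᶠ w in 𝓝 (0 : ℂ), ‖dphase lam (1 + w) - lam * w‖ ≤ e * ‖w‖ := by
  have h1 := (hasDerivAt_iff_isLittleO_nhds_zero.1 (hasDerivAt_dphase_one lam)).bound he
  filter_upwards [h1] with w hw
  have h2 : dphase lam 1 = 0 := by simp [dphase]
  rw [h2, sub_zero, smul_eq_mul, mul_comm w] at hw
  exact hw

/-- The phase and its derivative both vanish at `1`. The mean value inequality on a disk integrates
the first-order estimate for `dphase`. -/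
lemma eventually_norm_phase_one_add_sub_le {lam : ℝ} (hlam : 0 < lam) {e : ℝ} (he : 0 < e) :
    ∀ᶠ w in 𝓝 (0 : ℂ), ‖phase lam (1 + w) - lam / 2 * w ^ 2‖ ≤ e * ‖w‖ ^ 2 := by
  have h1 : ∀ᶠ w in 𝓝 (0 : ℂ), HasDerivAt (fun w => phase lam (1 + w) - lam / 2 * w ^ 2)
      (dphase lam (1 + w) - lam * w) w := by
    have hmem : ∀ᶠ w in 𝓝 (0 : ℂ), 1 + w ∈ Complex.slitPlane := by
      have hc : Tendsto (fun w : ℂ => 1 + w) (𝓝 0) (𝓝 1) := by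
        simpa using (tendsto_id (x := 𝓝 (0 : ℂ))).const_add 1
      exact hc.eventually (Complex.isOpen_slitPlane.eventually_mem Complex.one_mem_slitPlane)
    filter_upwards [hmem] with w hw
    have h2 := (hasDerivAt_phase hlam hw).comp_const_add 1 w
    have h3 := ((hasDerivAt_id w).pow 2).const_mul (lam / 2 : ℂ)
    refine (h2.sub h3).congr_deriv ?_
    simp
    ring
  obtain ⟨r, hr, hball⟩ := Metric.eventually_nhds_iff_ball.1
    (h1.and (eventually_norm_dphase_one_add_sub_le lam he))
  filter_upwards [ball_mem_nhds (0 : ℂ) hr] with w hw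
  have hsub : closedBall (0 : ℂ) ‖w‖ ⊆ ball 0 r :=
    closedBall_subset_ball (by simpa using hw)
  have h2 := Convex.norm_image_sub_le_of_norm_hasDerivWithin_le
    (f := fun w => phase lam (1 + w) - lam / 2 * w ^ 2)
    (f' := fun w => dphase lam (1 + w) - lam * w) (s := closedBall 0 ‖w‖) (C := e * ‖w‖)
    (fun z hz => (hball z (hsub hz)).1.hasDerivWithinAt) (fun z hz => by
      refine (hball z (hsub hz)).2.trans ?_
      gcongr
      simpa using hz) (convex_closedBall 0 ‖w‖) (mem_closedBall_self (norm_nonneg w))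
    (show w ∈ closedBall 0 ‖w‖ by simp)
  have h3 : phase lam 1 = 0 := by simp [phase]
  simp only [add_zero, h3, ne_eq, OfNat.ofNat_ne_zero, not_false_eq_true, zero_pow, mul_zero,
    sub_zero] at h2
  calc _ ≤ _ := h2
    _ = _ := by ring

/-- Keeps the arc about `1` inside the unit disk with `1 - |s|` comparable to `τ`, which is much
larger than `n^{-1/2}`, so the remainder asymptotics apply. -/
lemma norm_one_add_le {τ ω : ℝ} (hτ : 0 ≤ τ) (hτ1 : τ ≤ 1 / 2) (hω : Real.cos ω ≤ -1 / 2) :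
    ‖1 + τ * Complex.exp (ω * Complex.I)‖ ≤ 1 - τ / 4 := by
  have h1 : ‖1 + τ * Complex.exp (ω * Complex.I)‖ ^ 2 = 1 + 2 * τ * Real.cos ω + τ ^ 2 := by
    rw [← Complex.normSq_eq_norm_sq, Complex.normSq_apply]
    simp only [Complex.add_re, Complex.one_re, Complex.re_ofReal_mul, Complex.exp_ofReal_mul_I_re,
      Complex.add_im, Complex.one_im, Complex.im_ofReal_mul, Complex.exp_ofReal_mul_I_im]
    nlinarith [Real.sin_sq_add_cos_sq ω]
  refine abs_le_of_sq_le_sq' ?_ (by linarith) |>.2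
  rw [h1]
  nlinarith

namespace Growth

variable {f : ℂ → ℂ} {m : ℕ} {A b c ζ : Fin (m + 1) → ℂ} {lam mu θ : ℝ}

/-- Near the saddle point `1` the remainder is dominated by that saddle point. -/
theorem tendsto_remInt_near_one (hf : Growth f A b c ζ lam mu θ) (hlam : 0 < lam)
    (hmu : mu < 1) (hθ : 0 < θ) (hθπ : θ < Real.pi) (hlamθ : lam * θ < 2 * Real.pi)
    {ε : ℝ} (hε : 0 < ε) (hε1 : ε < 1 / 2)
    (hdom : ∀ k, k ≠ 0 → Tendsto (fun N : ℕ => ‖slow (b k) (c k) (scale lam N)‖ /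
      ‖slow (b 0) (c 0) (scale lam N)‖ * (N : ℝ) ^ (-1 / 2 + ε)) atTop (𝓝 0))
    {ι : Type*} {l : Filter ι} [l.IsCountablyGenerated] {n : ι → ℕ} {s : ι → ℂ}
    (hn : Tendsto n l atTop) {C κ : ℝ} (hκ : 0 < κ)
    (hs : ∀ᶠ i in l, ‖1 - s i‖ ≤ C * (n i : ℝ) ^ (-1 / 2 + ε))
    (hs' : ∀ᶠ i in l, κ * (n i : ℝ) ^ (-1 / 2 + ε) ≤ 1 - ‖s i‖) :
    Tendsto (fun i => (1 - s i) * remInt f (scale lam (n i)) (n i) (s i) /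
      (saddleSize lam (n i) * slow (b 0) (c 0) (scale lam (n i)))) l (𝓝 (A 0)) := by
  have hnr : Tendsto (fun i => (n i : ℝ)) l atTop := tendsto_natCast_atTop_atTop.comp hn
  have hnpos : ∀ᶠ i in l, (0 : ℝ) < n i := hnr.eventually_gt_atTop 0
  have hτ0 : Tendsto (fun i => (n i : ℝ) ^ (-1 / 2 + ε)) l (𝓝 0) := by
    have := (tendsto_rpow_neg_atTop (show 0 < 1 / 2 - ε by linarith)).comp hnr
    refine this.congr fun i => ?_
    simp only [Function.comp]
    congr 1; ring
  have hs0 : Tendsto (fun i => 1 - s i) l (𝓝 0) := by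
    refine squeeze_zero_norm' hs ?_
    simpa using hτ0.const_mul C
  have hs1 : Tendsto s l (𝓝 1) := by
    simpa using hs0.const_sub 1
  have hsqrt : Tendsto (fun i => √(n i : ℝ) * (1 - ‖s i‖)) l atTop := by
    refine tendsto_atTop_mono' l ?_ (((tendsto_rpow_atTop hε).comp hnr).const_mul_atTop hκ)
    filter_upwards [hs', hnpos] with i h1 h2
    simp only [Function.comp]
    rw [Real.sqrt_eq_rpow]
    calc κ * (n i : ℝ) ^ ε = (n i : ℝ) ^ (1 / 2 : ℝ) * (κ * (n i : ℝ) ^ (-1 / 2 + ε)) := by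
          rw [mul_left_comm, ← Real.rpow_add h2]
          congr 2; ring
      _ ≤ _ := by gcongr
  obtain ⟨e, y, he, hy, hR⟩ := hf.remInt_asymp hlam hmu hθ hθπ hlamθ hn hsqrt
  have hslowne : ∀ᶠ i in l, slow (b 0) (c 0) (scale lam (n i)) ≠ 0 := by
    filter_upwards [(tendsto_scale hlam hn).eventually_gt_atTop 1] with i hi
    exact slow_ne_zero (by
      rw [Complex.norm_real, Real.norm_of_nonneg (by linarith)]; exact hi) _ _
  have hyD : Tendsto (fun i => (1 - s i) * (y i / slow (b 0) (c 0) (scale lam (n i)))) l (𝓝 0) := by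
    have h1 : Tendsto (fun i => y i / slow (b 0) (c 0) (scale lam (n i))) l (𝓝 0) := by
      obtain ⟨K, hK⟩ := (Moderate.slow hlam hn (b 0) (c 0)).inv hn
      refine squeeze_zero_norm' ?_ (hy K)
      filter_upwards [hK] with i h1
      rw [norm_div, div_eq_mul_inv, mul_comm]
      gcongr
      exact h1.2
    simpa using hs0.mul h1
  -- The factor `1 - s` cancels the pole of the term `k = 0`. In the other terms, whose poles stay
  -- away from `1`, it supplies the small factor `n^{-1/2+ε}` used by `hdom`.
  have hterm : ∀ k, Tendsto (fun i => (1 - s i) * (e k i * slow (b k) (c k) (scale lam (n i)) *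
      (ζ k / ζ k ^ n i) / (ζ k - s i) / slow (b 0) (c 0) (scale lam (n i)))) l
      (𝓝 (if k = 0 then A 0 else 0)) := by
    intro k
    by_cases hk : k = 0
    · subst hk
      rw [if_pos rfl]
      refine (he 0).congr' ?_
      filter_upwards [hslowne, hs', hnpos] with i h1 h2 h3
      have h4 : 1 - s i ≠ 0 := by
        intro h
        rw [← sub_eq_zero.1 h, norm_one, sub_self] at h2
        have : 0 < κ * (n i : ℝ) ^ (-1 / 2 + ε) := by positivity
        linarith
      rw [hf.dir_zero, one_pow]
      field_simp
    · rw [if_neg hk]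
      have hζ1 : ζ k - 1 ≠ 0 := by
        rw [← hf.dir_zero]
        exact sub_ne_zero.2 fun h => hk (hf.dir_injective hθ h)
      have h1 : Tendsto (fun i => ‖e k i‖ / ‖ζ k - s i‖ * (C * (‖slow (b k) (c k) (scale lam (n i))‖ /
          ‖slow (b 0) (c 0) (scale lam (n i))‖ * (n i : ℝ) ^ (-1 / 2 + ε)))) l (𝓝 0) := by
        have h2 := (((he k).norm).div ((hs1.const_sub (ζ k)).norm) (norm_ne_zero_iff.2 hζ1)).mul
          (((hdom k hk).comp hn).const_mul C)
        simpa using h2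
      refine squeeze_zero_norm' ?_ h1
      filter_upwards [hs] with i h2
      rw [norm_mul, norm_div, norm_div, norm_mul, norm_mul, norm_div, norm_pow, hf.dir_norm k,
        one_pow, div_one, mul_one]
      calc _ ≤ (C * (n i : ℝ) ^ (-1 / 2 + ε)) * (‖e k i‖ * ‖slow (b k) (c k) (scale lam (n i))‖ /
            ‖ζ k - s i‖ / ‖slow (b 0) (c 0) (scale lam (n i))‖) := by gcongr
        _ = _ := by ring
  have hsum := (tendsto_finsetSum Finset.univ fun k _ => hterm k).add hyD
  rw [Finset.sum_ite_eq' Finset.univ (0 : Fin (m + 1)) fun _ => A 0, if_pos (Finset.mem_univ _),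
    add_zero] at hsum
  refine hsum.congr' ?_
  filter_upwards [hR, hn.eventually_ge_atTop 1] with i h1 h2
  have h4 : (saddleSize lam (n i) : ℂ) ≠ 0 := by exact_mod_cast (saddleSize_pos hlam h2).ne'
  rw [h1, mul_left_comm, mul_div_mul_left _ _ h4, mul_div_assoc, add_div, mul_add, Finset.sum_div,
    Finset.mul_sum]

end Growth


lemma cos_le_neg_half {ω : ℝ} (hω : ω ∈ Set.Icc (2 * Real.pi / 3) (5 * Real.pi / 6)) :
    Real.cos ω ≤ -1 / 2 := by
  have hπ := Real.pi_pos
  have h1 := Real.cos_le_cos_of_nonneg_of_le_pi (x := 2 * Real.pi / 3) (y := ω) (by positivity)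
    (by linarith [hω.2]) hω.1
  rw [show 2 * Real.pi / 3 = Real.pi - Real.pi / 3 by ring, Real.cos_pi_sub,
    Real.cos_pi_div_three] at h1
  linarith

lemma re_mul_sq_ofReal_mul_exp (x τ ω : ℝ) :
    ((x / 2 : ℂ) * (τ * Complex.exp (ω * Complex.I)) ^ 2).re = x / 2 * τ ^ 2 * Real.cos (2 * ω) := by
  have h1 : (x / 2 : ℂ) * (τ * Complex.exp (ω * Complex.I)) ^ 2 =
      ((x / 2 * τ ^ 2 : ℝ) : ℂ) * Complex.exp ((2 * ω : ℝ) * Complex.I) := by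
    rw [mul_pow, ← Complex.exp_nat_mul]
    push_cast
    ring_nf
  rw [h1, Complex.re_ofReal_mul, Complex.exp_ofReal_mul_I_re]

namespace Growth

variable {f : ℂ → ℂ} {m : ℕ} {A b c ζ : Fin (m + 1) → ℂ} {lam mu θ : ℝ}

/-- On `1 + τ e^{iω}` with `τ = n^{-1/2+ε'}`, `n Re Φ` is about `(λ/2) n^{2ε'} cos 2ω`, which
changes sign as `ω` crosses `3π/4`. The zeros are spaced on the scale `1 / (nτ)`, much smaller than
`τ`. -/
theorem tendsto_zeroCount_near_one (hf : Growth f A b c ζ lam mu θ) (hlam : 0 < lam)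
    (hmu : mu < 1) (hθ : 0 < θ) (hθπ : θ < Real.pi) (hlamθ : lam * θ < 2 * Real.pi)
    {ε ε' : ℝ} (hε' : 0 < ε') (hε'1 : ε' < 1 / 2) (hεε' : ε' < ε)
    (hdom : ∀ k, k ≠ 0 → Tendsto (fun N : ℕ => ‖slow (b k) (c k) (scale lam N)‖ /
      ‖slow (b 0) (c 0) (scale lam N)‖ * (N : ℝ) ^ (-1 / 2 + ε')) atTop (𝓝 0))
    {n : ℕ → ℕ} (hn : Tendsto n atTop atTop) :
    Tendsto (fun j => zeroCount (partialSum f (n j - 1)) (scale lam (n j))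
      (scale lam (n j) * (n j : ℝ) ^ (-1 / 2 + ε))) atTop atTop := by
  have hξ := Complex.one_mem_slitPlane
  have hξθ : |(1 : ℂ).arg| < θ := by simpa using hθ
  have hnr : Tendsto (fun j => (n j : ℝ)) atTop atTop := tendsto_natCast_atTop_atTop.comp hn
  have hnpos : ∀ᶠ j in atTop, (0 : ℝ) < n j := hnr.eventually_gt_atTop 0
  have hpow0 : ∀ x : ℝ, x < 0 → Tendsto (fun j => (n j : ℝ) ^ x) atTop (𝓝 0) := by
    intro x hx
    have := (tendsto_rpow_neg_atTop (show 0 < -x by linarith)).comp hnr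
    simpa [Function.comp_def] using this
  set τ : ℕ → ℝ := fun j => (n j : ℝ) ^ (-1 / 2 + ε') with hτ
  have hτ0 : Tendsto τ atTop (𝓝 0) := hpow0 _ (by linarith)
  have hτnonneg : ∀ j, 0 ≤ τ j := fun j => by rw [hτ]; positivity
  have hτpos : ∀ᶠ j in atTop, 0 < τ j := by
    filter_upwards [hnpos] with j hj
    rw [hτ]; positivity
  have hτsq : ∀ᶠ j in atTop, n j * τ j ^ 2 = (n j : ℝ) ^ (2 * ε') := by
    filter_upwards [hnpos] with j hj
    rw [hτ]
    simp only
    rw [← Real.rpow_natCast, ← Real.rpow_mul hj.le, ← Real.rpow_one_add' hj.le]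
    · congr 1; push_cast; ring
    · push_cast; intro h; linarith
  have hτhalf : ∀ᶠ j in atTop, τ j ≤ 1 / 2 := hτ0.eventually_le_const (by norm_num)
  have hnorm : ∀ j (ω : ℝ), ‖(τ j : ℂ) * Complex.exp (ω * Complex.I)‖ = τ j := by
    intro j ω
    rw [norm_mul, Complex.norm_exp_ofReal_mul_I, mul_one, Complex.norm_real,
      Real.norm_of_nonneg (hτnonneg j)]
  have hw0 : ∀ {ι : Type} {l : Filter ι} {u : ι → ℕ} (v : ι → ℝ), Tendsto u l atTop →
      Tendsto (fun i => (τ (u i) : ℂ) * Complex.exp (v i * Complex.I)) l (𝓝 0) := by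
    intro ι l u v hu
    refine squeeze_zero_norm (fun i => (hnorm _ _).le) (hτ0.comp hu)
  clear_value τ
  set σ : ℕ → ℝ → ℂ := fun j ω => 1 + τ j * Complex.exp (ω * Complex.I) with hσ
  set I₀ : Set ℝ := Set.Icc (2 * Real.pi / 3) (5 * Real.pi / 6) with hI₀
  have hπ := Real.pi_pos
  have hAne := norm_pos_iff.2 (hf.coeff_ne 0)
  -- At the ends of the arc `cos 2ω = ∓1/2`, so the main term is `∓(λ/4) n^{2ε'}`; an error of
  -- `λ/16` leaves the margin `3λ/16`.
  have hphase : ∀ ω : ℝ, ∀ᶠ j in atTop, |n j * (phase lam (σ j ω)).re -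
      lam / 2 * (n j : ℝ) ^ (2 * ε') * Real.cos (2 * ω)| ≤ lam / 16 * (n j : ℝ) ^ (2 * ε') := by
    intro ω
    filter_upwards [(hw0 (fun _ => ω) tendsto_id).eventually
      (eventually_norm_phase_one_add_sub_le hlam (show 0 < lam / 16 by positivity)), hτsq]
      with j h1 h2
    have h3 := (Complex.abs_re_le_norm _).trans h1
    simp only [id] at h3
    rw [hnorm, Complex.sub_re, re_mul_sq_ofReal_mul_exp] at h3
    rw [← h2, show n j * (phase lam (σ j ω)).re - lam / 2 * (n j * τ j ^ 2) * Real.cos (2 * ω) =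
      n j * ((phase lam (σ j ω)).re - lam / 2 * τ j ^ 2 * Real.cos (2 * ω)) by ring, abs_mul,
      Nat.abs_cast, mul_left_comm]
    gcongr
  -- One statement for the arc itself (`y = 0`) and for the points `s + δv` near a balance point. A
  -- shift of at most `τ/8` uses up half of the distance `τ/4` to the unit circle.
  have hpath : ∀ {ι : Type} {l : Filter ι} [l.IsCountablyGenerated] {u : ι → ℕ} {v : ι → ℝ}
      {y : ι → ℂ}, Tendsto u l atTop → (∀ᶠ i in l, v i ∈ I₀) →
      (∀ᶠ i in l, ‖y i‖ ≤ τ (u i) / 8) →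
      (∀ᶠ i in l, τ (u i) / 8 ≤ 1 - ‖σ (u i) (v i) + y i‖) ∧
      Tendsto (fun i => (1 - (σ (u i) (v i) + y i)) *
        remInt f (scale lam (n (u i))) (n (u i)) (σ (u i) (v i) + y i) /
        (saddleSize lam (n (u i)) * slow (b 0) (c 0) (scale lam (n (u i))))) l (𝓝 (A 0)) := by
    intro ι l _ u v y hu hv hy
    have h1 : ∀ᶠ i in l, 1 / 8 * τ (u i) ≤ 1 - ‖σ (u i) (v i) + y i‖ := by
      filter_upwards [hv, hy, hu.eventually hτhalf] with i h1 h2 h3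
      have h4 := norm_one_add_le (hτnonneg (u i)) h3 (cos_le_neg_half h1)
      have h5 := norm_add_le (σ (u i) (v i)) (y i)
      simp only [hσ] at h5 ⊢
      linarith
    refine ⟨by simpa only [one_div_mul_eq_div] using h1,
      hf.tendsto_remInt_near_one hlam hmu hθ hθπ hlamθ hε' hε'1 hdom
      (hn.comp hu) (C := 2) (by norm_num : (0 : ℝ) < 1 / 8) ?_
      (by simpa only [hτ] using h1)⟩
    filter_upwards [hy] with i h2
    have h3 : 1 - (σ (u i) (v i) + y i) = -(τ (u i) * Complex.exp (v i * Complex.I) + y i) := by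
      simp only [hσ]; ring
    rw [h3, norm_neg]
    refine (norm_add_le _ _).trans ?_
    rw [hnorm]
    have := hτnonneg (u i)
    simp only [hτ] at this h2 ⊢
    linarith
  have hbal : ∀ᶠ j in atTop, ∃ x ∈ I₀, ‖f (scale lam (n j) * σ j x)‖ =
      ‖f (scale lam (n j) * σ j x) - partialSum f (n j - 1) (scale lam (n j) * σ j x)‖ := by
    set l : Filter (ℕ × ℝ) := atTop ×ˢ 𝓟 I₀ with hl
    have hfst : Tendsto (Prod.fst : ℕ × ℝ → ℕ) l atTop := tendsto_fst
    have hmemI : ∀ᶠ p in l, p.2 ∈ I₀ := by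
      rw [hl, eventually_prod_principal_iff]
      exact Eventually.of_forall fun j v hv => hv
    have hlim : Tendsto (fun p : ℕ × ℝ => σ p.1 p.2) l (𝓝 1) := by
      simpa using (hw0 (fun p : ℕ × ℝ => p.2) hfst).const_add 1
    obtain ⟨hin, hR⟩ := hpath hfst hmemI (y := fun _ => 0) (by
      refine Eventually.of_forall fun p => ?_
      rw [norm_zero]; linarith [hτnonneg p.1])
    simp only [add_zero] at hin hR
    have hhalf := eventually_rpow_half_le hn (show 0 < 2 * ε' by linarith)
      (show 0 < 3 * lam / 16 by positivity)
    refine hf.exists_balance hlam hξ hξθ hn (by linarith) (fun j => by rw [hσ]; fun_prop) hlim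
      ?_ ?_ (show 0 < 2 * ε' / 2 by linarith) ?_ ?_
    · filter_upwards [hin, hfst.eventually hτpos] with p h1 h2
      linarith
    · have m1 := Moderate.of_tendsto (hn.comp hfst) hAne hR.norm
      have m2 := Moderate.slow hlam (hn.comp hfst) (b 0) (c 0)
      have m3 := Moderate.natCast_rpow (hn.comp hfst) (-1 / 2 + ε')
      refine ((m1.mul (hn.comp hfst) m2).div (hn.comp hfst) m3).congr' ?_
      filter_upwards [m2.pos (hn.comp hfst), hfst.eventually hτpos,
        hfst.eventually (hn.eventually_ge_atTop 1)] with p h1 h2 h3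
      have h4 := saddleSize_pos hlam h3
      have h5 : ‖1 - σ p.1 p.2‖ = τ p.1 := by
        rw [hσ]
        simp only
        rw [sub_add_cancel_left, norm_neg, hnorm]
      rw [norm_div, norm_mul, norm_mul, h5, Complex.norm_real, Real.norm_of_nonneg h4.le]
      simp only [Function.comp, hτ] at h1 h2 ⊢
      field_simp
    · filter_upwards [hphase (2 * Real.pi / 3), hhalf] with j h1 h2
      rw [show 2 * (2 * Real.pi / 3) = Real.pi / 3 + Real.pi by ring, Real.cos_add_pi,
        Real.cos_pi_div_three, abs_le] at h1
      linarith [h1.2]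
    · filter_upwards [hphase (5 * Real.pi / 6), hhalf] with j h1 h2
      rw [show 2 * (5 * Real.pi / 6) = 2 * Real.pi - Real.pi / 3 by ring, Real.cos_two_pi_sub,
        Real.cos_pi_div_three, abs_le] at h1
      linarith [h1.1]
  have hbal' : ∀ j, ∃ x ∈ I₀, (∃ x ∈ I₀, ‖f (scale lam (n j) * σ j x)‖ =
      ‖f (scale lam (n j) * σ j x) - partialSum f (n j - 1) (scale lam (n j) * σ j x)‖) →
      ‖f (scale lam (n j) * σ j x)‖ =
      ‖f (scale lam (n j) * σ j x) - partialSum f (n j - 1) (scale lam (n j) * σ j x)‖ := by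
    intro j
    by_cases h : ∃ x ∈ I₀, ‖f (scale lam (n j) * σ j x)‖ =
      ‖f (scale lam (n j) * σ j x) - partialSum f (n j - 1) (scale lam (n j) * σ j x)‖
    · obtain ⟨x, hx, hx'⟩ := h
      exact ⟨x, hx, fun _ => hx'⟩
    · exact ⟨2 * Real.pi / 3, ⟨le_rfl, by linarith⟩, fun h' => absurd h' h⟩
  choose x hxI hxbal using hbal'
  set s : ℕ → ℂ := fun j => σ j (x j) with hs
  have hslim : Tendsto s atTop (𝓝 1) := by
    simpa using (hw0 x tendsto_id).const_add 1
  have hdlow : ∀ᶠ j in atTop, lam / 2 * τ j ≤ ‖dphase lam (s j)‖ := by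
    filter_upwards [(hw0 x tendsto_id).eventually
      (eventually_norm_dphase_one_add_sub_le lam (half_pos hlam))] with j h1
    simp only [id] at h1
    have h2 := norm_sub_norm_le (lam * ((τ j : ℂ) * Complex.exp (x j * Complex.I)))
      (dphase lam (s j))
    rw [norm_sub_rev] at h2
    have h3 := h2.trans h1
    rw [norm_mul, Complex.norm_real, Real.norm_of_nonneg hlam.le, hnorm] at h3
    linarith
  set δ : ℕ → ℂ := fun j => (n j * dphase lam (s j))⁻¹ with hδ
  -- Since `|Φ'(s)| ≥ λτ/2` and `n τ² = n^{2ε'}`, the spacing is smaller than `τ` by a power of `n`.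
  have hδτ : ∀ᶠ j in atTop, ‖δ j‖ ≤ 2 / lam * (n j : ℝ) ^ (-2 * ε') * τ j := by
    filter_upwards [hdlow, hτpos, hnpos, hτsq] with j h1 h2 h3 h4
    rw [neg_mul, Real.rpow_neg h3.le, ← h4, hδ]
    simp only
    rw [norm_inv, norm_mul, Complex.norm_natCast]
    calc (n j * ‖dphase lam (s j)‖)⁻¹ ≤ (n j * (lam / 2 * τ j))⁻¹ := by gcongr
      _ = _ := by field_simp
  have hδτ0 : Tendsto (fun j => ‖δ j‖ / τ j) atTop (𝓝 0) := by
    have h1 : Tendsto (fun j => 2 / lam * (n j : ℝ) ^ (-2 * ε')) atTop (𝓝 0) := by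
      simpa using (hpow0 (-2 * ε') (by linarith)).const_mul (2 / lam)
    refine squeeze_zero' (Eventually.of_forall fun j => by have := hτnonneg j; positivity) ?_ h1
    filter_upwards [hδτ, hτpos] with j h2 h3
    rwa [div_le_iff₀ h3]
  have hδ0 : Tendsto δ atTop (𝓝 0) := by
    rw [tendsto_zero_iff_norm_tendsto_zero]
    have h1 := hδτ0.mul hτ0
    rw [mul_zero] at h1
    refine h1.congr' ?_
    filter_upwards [hτpos] with j hj
    field_simp
  have hδ1 : ∀ᶠ j in atTop, n j * (dphase lam (s j) * δ j) = 1 := by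
    filter_upwards [hdlow, hτpos, hnpos] with j h1 h2 h3
    have h4 : (n j : ℂ) ≠ 0 := by exact_mod_cast h3.ne'
    have h5 : dphase lam (s j) ≠ 0 := norm_pos_iff.1 (lt_of_lt_of_le (by positivity) h1)
    rw [hδ]
    simp only
    field_simp
  have hδ2 : Tendsto (fun j => (n j : ℝ) * ‖δ j‖ ^ 2) atTop (𝓝 0) := by
    have h1 : Tendsto (fun j => (2 / lam) ^ 2 * (n j : ℝ) ^ (-2 * ε')) atTop (𝓝 0) := by
      simpa using (hpow0 (-2 * ε') (by linarith)).const_mul ((2 / lam) ^ 2)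
    refine squeeze_zero' (Eventually.of_forall fun j => by positivity) ?_ h1
    filter_upwards [hδτ, hτsq, hnpos] with j h2 h3 h4
    calc (n j : ℝ) * ‖δ j‖ ^ 2 ≤ n j * (2 / lam * (n j : ℝ) ^ (-2 * ε') * τ j) ^ 2 := by gcongr
      _ = (2 / lam) ^ 2 * (n j : ℝ) ^ (-2 * ε') * ((n j : ℝ) ^ (-2 * ε') * (n j * τ j ^ 2)) := by
        ring
      _ = _ := by
        rw [h3, ← Real.rpow_add h4]; simp
  clear_value δ
  have hsmall : ∀ B : ℝ, ∀ᶠ p : ℕ × ℂ in atTop ×ˢ 𝓟 (closedBall 0 B),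
      ‖δ p.1 * p.2‖ ≤ τ p.1 / 8 := by
    intro B
    rw [eventually_prod_principal_iff]
    have h1 : Tendsto (fun j => ‖δ j‖ / τ j * B) atTop (𝓝 0) := by simpa using hδτ0.mul_const B
    filter_upwards [h1.eventually_le_const (show (0 : ℝ) < 1 / 8 by norm_num), hτpos]
      with j h2 h3 v hv
    rw [mem_closedBall_zero_iff] at hv
    rw [div_mul_eq_mul_div, div_le_iff₀ h3] at h2
    rw [norm_mul]
    calc ‖δ j‖ * ‖v‖ ≤ ‖δ j‖ * B := by gcongr
      _ ≤ _ := by linarith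
  have hone : ∀ j, ‖1 - s j‖ = τ j := by
    intro j
    rw [hs, hσ]
    simp only
    rw [sub_add_cancel_left, norm_neg, hnorm]
  have hR : ∀ B : ℝ, Tendsto (fun p : ℕ × ℂ =>
      remInt f (scale lam (n p.1)) (n p.1) (s p.1 + δ p.1 * p.2) /
        remInt f (scale lam (n p.1)) (n p.1) (s p.1)) (atTop ×ˢ 𝓟 (closedBall 0 B)) (𝓝 1) := by
    intro B
    obtain ⟨l, hl, hlc⟩ : ∃ l : Filter (ℕ × ℂ), l = atTop ×ˢ 𝓟 (closedBall 0 B) ∧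
        l.IsCountablyGenerated := ⟨_, rfl, inferInstance⟩
    have hsm := hsmall B
    rw [← hl] at hsm ⊢
    have hfst : Tendsto (Prod.fst : ℕ × ℂ → ℕ) l atTop := hl ▸ tendsto_fst
    have hball : ∀ᶠ p in l, ‖p.2‖ ≤ B := by
      rw [hl, eventually_prod_principal_iff]
      exact Eventually.of_forall fun j v hv => by simpa using hv
    obtain ⟨hin1, hR1⟩ := hpath hfst (v := fun p : ℕ × ℂ => x p.1)
      (Eventually.of_forall fun p => hxI p.1) (y := fun p : ℕ × ℂ => δ p.1 * p.2) hsm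
    obtain ⟨-, hR2⟩ := hpath hfst (v := fun p : ℕ × ℂ => x p.1)
      (Eventually.of_forall fun p => hxI p.1) (y := fun _ => 0) (by
      refine Eventually.of_forall fun p => ?_
      rw [norm_zero]; linarith [hτnonneg p.1])
    simp only [add_zero] at hR2
    have hq : Tendsto (fun p : ℕ × ℂ => (1 - (s p.1 + δ p.1 * p.2)) / (1 - s p.1)) l (𝓝 1) := by
      have h1 : Tendsto (fun p : ℕ × ℂ => 1 - δ p.1 * p.2 / (1 - s p.1)) l (𝓝 (1 - 0)) := by
        have h2 : Tendsto (fun p : ℕ × ℂ => ‖δ p.1‖ / τ p.1 * B) l (𝓝 0) := by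
          simpa [Function.comp_def] using (hδτ0.mul_const B).comp hfst
        refine (squeeze_zero_norm' ?_ h2).const_sub 1
        filter_upwards [hball, hfst.eventually hτpos] with p h3 h4
        rw [norm_div, norm_mul, hone, mul_div_right_comm]
        gcongr
      rw [sub_zero] at h1
      refine h1.congr' ?_
      filter_upwards [hfst.eventually hτpos] with p h3
      have h4 : 1 - s p.1 ≠ 0 := norm_pos_iff.1 (by rw [hone]; exact h3)
      field_simp
      ring
    have hdiv := (hR1.div hR2 (hf.coeff_ne 0)).div hq one_ne_zero
    rw [div_self (hf.coeff_ne 0), div_one] at hdiv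
    refine hdiv.congr' ?_
    filter_upwards [hfst.eventually hτpos, hfst.eventually (hn.eventually_ge_atTop 1),
      hfst.eventually ((tendsto_scale hlam hn).eventually_gt_atTop 1), hin1] with p h1 h2 h3 h4
    have h5 : 1 - s p.1 ≠ 0 := norm_pos_iff.1 (by rw [hone]; exact h1)
    have h6 : 1 - (s p.1 + δ p.1 * p.2) ≠ 0 := by
      intro h
      have h7 : s p.1 + δ p.1 * p.2 = 1 := (sub_eq_zero.1 h).symm
      change τ p.1 / 8 ≤ 1 - ‖s p.1 + δ p.1 * p.2‖ at h4
      rw [h7, norm_one] at h4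
      linarith
    have h8 : (saddleSize lam (n p.1) : ℂ) ≠ 0 := by exact_mod_cast (saddleSize_pos hlam h2).ne'
    have h9 : slow (b 0) (c 0) (scale lam (n p.1)) ≠ 0 := slow_ne_zero (by
      rw [Complex.norm_real, Real.norm_of_nonneg (by linarith)]; exact h3) _ _
    simp only [Pi.div_apply]
    change (1 - (s p.1 + δ p.1 * p.2)) *
      remInt f (scale lam (n p.1)) (n p.1) (s p.1 + δ p.1 * p.2) / _ /
      ((1 - s p.1) * remInt f (scale lam (n p.1)) (n p.1) (s p.1) / _) / _ = _
    field_simp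
  have hin : ∀ B : ℝ, ∀ᶠ p : ℕ × ℂ in atTop ×ˢ 𝓟 (closedBall 0 B),
      ‖s p.1 + δ p.1 * p.2‖ < 1 := by
    intro B
    obtain ⟨hin1, -⟩ := hpath (u := Prod.fst) (v := fun p : ℕ × ℂ => x p.1)
      (l := (atTop : Filter ℕ) ×ˢ 𝓟 (closedBall (0 : ℂ) B)) tendsto_fst
      (Eventually.of_forall fun p => hxI p.1) (y := fun p : ℕ × ℂ => δ p.1 * p.2) (hsmall B)
    filter_upwards [hin1, (tendsto_fst (f := (atTop : Filter ℕ))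
      (g := 𝓟 (closedBall (0 : ℂ) B))).eventually hτpos] with p h1 h2
    change τ p.1 / 8 ≤ 1 - ‖s p.1 + δ p.1 * p.2‖ at h1
    linarith
  have hmany := hf.many_zeros hlam hξ hξθ hn hslim hδ0 hδ1 hδ2
    (by filter_upwards [hbal] with j hj; exact hxbal j hj) hR hin
  refine Filter.tendsto_atTop.2 fun N => ?_
  obtain ⟨B, hB, hev⟩ := hmany N
  have hfin : Tendsto (fun j => (τ j + ‖δ j‖ * B) / (n j : ℝ) ^ (-1 / 2 + ε)) atTop (𝓝 0) := by
    have h1 := (hpow0 (ε' - ε) (by linarith)).mul ((hδτ0.mul_const B).const_add 1)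
    rw [zero_mul] at h1
    refine h1.congr' ?_
    filter_upwards [hnpos, hτpos] with j hj hj'
    have h2 : (n j : ℝ) ^ (ε' - ε) = τ j / (n j : ℝ) ^ (-1 / 2 + ε) := by
      rw [hτ]
      simp only
      rw [← Real.rpow_sub hj]
      congr 1; ring
    rw [h2]
    field_simp
  filter_upwards [hev, hfin.eventually_le_const one_pos, hnpos, hτpos,
    (tendsto_scale hlam hn).eventually_gt_atTop 0] with j h1 h2 h3 h4 h5
  refine h1 _ _ (closedBall_subset_closedBall' ?_)
  have h6 : (scale lam (n j) : ℂ) * s j - scale lam (n j) = -(scale lam (n j) * (1 - s j)) := by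
    ring
  rw [dist_eq_norm]
  change _ + ‖(scale lam (n j) : ℂ) * s j - scale lam (n j)‖ ≤ _
  rw [h6, norm_neg, norm_mul, hone, Complex.norm_real, Real.norm_of_nonneg h5.le]
  rw [div_le_iff₀ (by positivity), one_mul] at h2
  calc _ = scale lam (n j) * (τ j + ‖δ j‖ * B) := by ring
    _ ≤ _ := by gcongr

end Growth


/-! ### Reduction of the growth hypotheses, and geometry of the limit curve. -/

lemma tendsto_ray {θ : ℝ} (hθ : 0 < θ) {ζ : ℂ} (hζ : ‖ζ‖ = 1) :
    Tendsto (fun x : ℝ => (x : ℂ) * ζ) atTop (Bornology.cobounded ℂ ⊓ 𝓟 (sector θ ζ)) := by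
  refine tendsto_inf.2 ⟨?_, tendsto_principal.2 ?_⟩
  · rw [← tendsto_norm_atTop_iff_cobounded]
    refine tendsto_abs_atTop_atTop.congr fun x => ?_
    rw [norm_mul, hζ, mul_one, Complex.norm_real, Real.norm_eq_abs]
  · filter_upwards [eventually_gt_atTop 0] with x hx
    have hζ0 : ζ ≠ 0 := norm_pos_iff.1 (by rw [hζ]; exact one_pos)
    rw [ofReal_mul_mem_sector_iff hx]
    refine ⟨hζ0, ?_⟩
    rw [div_self hζ0]
    simpa using hθ.le

lemma eventually_one_lt_norm_div {θ : ℝ} {ζ : ℂ} (hζ : ‖ζ‖ = 1) :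
    ∀ᶠ z in Bornology.cobounded ℂ ⊓ 𝓟 (sector θ ζ), 1 < ‖z / ζ‖ := by
  refine Eventually.filter_mono inf_le_left ?_
  filter_upwards [tendsto_norm_cobounded_atTop.eventually_gt_atTop 1] with z hz
  rwa [norm_div, hζ, div_one]

theorem OneDirection.growth {f : ℂ → ℂ} {a b : ℂ} {lam mu θ : ℝ}
    (h : OneDirection f a b lam mu θ) :
    Growth f (m := 0) (fun _ => 1) (fun _ => a) (fun _ => b) (fun _ => 1) lam mu θ where
  entire := h.entire
  coeff_ne _ := one_ne_zero
  dir_zero := rfl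
  dir_norm _ := norm_one
  disjoint j k hjk := absurd (Fin.ext (by omega)) hjk
  main _ := by
    have h1 : ∀ᶠ z in Bornology.cobounded ℂ ⊓ 𝓟 (sector θ 1),
        z ^ a * Complex.log z ^ b * Complex.exp (z ^ (lam : ℂ)) ≠ 0 := by
      filter_upwards [eventually_one_lt_norm_div norm_one] with z hz
      rw [div_one] at hz
      exact mul_ne_zero (slow_ne_zero hz a b) (Complex.exp_ne_zero _)
    have h2 := (isEquivalent_iff_tendsto_one h1).1 h.main
    simp only [div_one]
    exact h2
  other := by
    rw [Set.iUnion_const]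
    exact h.other

/-- Equivalence to zero means being eventually zero. If `A k = 0`, then `f` vanishes far out on the
ray through `ζ k`, hence identically, which contradicts the direction with coefficient `1`. -/
theorem ManyDirections.coeff_ne {f : ℂ → ℂ} {m : ℕ} {A b ζ : Fin (m + 1) → ℂ} {lam mu θ : ℝ}
    (hθ : 0 < θ) (h : ManyDirections f A b ζ lam mu θ) (k : Fin (m + 1)) : A k ≠ 0 := by
  intro hk
  have hf : ∀ᶠ x : ℝ in atTop, f (x * ζ k) = 0 := by
    have h1 := h.main k
    simp only [hk, zero_mul] at h1
    exact (tendsto_ray hθ (h.dir_norm k)).eventually (isEquivalent_zero_iff_eventually_zero.1 h1)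
  obtain ⟨X, hX⟩ := eventually_atTop.1 hf
  have hζ0 : ζ k ≠ 0 := norm_pos_iff.1 (by rw [h.dir_norm k]; exact one_pos)
  have hray : Tendsto (fun x : ℝ => (x : ℂ) * ζ k) (𝓝[>] X) (𝓝[≠] (X * ζ k)) := by
    refine tendsto_nhdsWithin_iff.2 ⟨?_, ?_⟩
    · exact ((by fun_prop : Continuous fun x : ℝ => (x : ℂ) * ζ k).tendsto X).mono_left
        nhdsWithin_le_nhds
    · filter_upwards [self_mem_nhdsWithin] with x hx
      simp only [Set.mem_Ioi] at hx
      simp [hζ0, hx.ne']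
  have hfreq : ∃ᶠ z in 𝓝[≠] ((X : ℂ) * ζ k), f z = (fun _ => (0 : ℂ)) z := by
    refine hray.frequently (Eventually.frequently ?_)
    filter_upwards [self_mem_nhdsWithin] with x hx
    exact hX x (Set.mem_Ioi.1 hx).le
  have hzero := AnalyticOnNhd.eq_of_frequently_eq
    (Complex.analyticOnNhd_univ_iff_differentiable.2 h.entire) analyticOnNhd_const hfreq
  have h3 : ∀ᶠ z in Bornology.cobounded ℂ ⊓ 𝓟 (sector θ (ζ 0)),
      A 0 * (z / ζ 0) ^ (b 0) * Complex.exp ((z / ζ 0) ^ (lam : ℂ)) = 0 := by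
    have h1 := (h.main 0).symm
    rw [hzero] at h1
    exact isEquivalent_zero_iff_eventually_zero.1 h1
  obtain ⟨x, hx, hx'⟩ := (((tendsto_ray hθ (h.dir_norm 0)).eventually h3).and
    ((tendsto_ray hθ (h.dir_norm 0)).eventually (eventually_one_lt_norm_div (h.dir_norm 0)))).exists
  rw [h.coeff_zero, one_mul] at hx
  refine mul_ne_zero ?_ (Complex.exp_ne_zero _) hx
  simpa [slow] using slow_ne_zero hx' (b 0) 0

theorem ManyDirections.growth {f : ℂ → ℂ} {m : ℕ} {A b ζ : Fin (m + 1) → ℂ} {lam mu θ : ℝ}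
    (hθ : 0 < θ) (h : ManyDirections f A b ζ lam mu θ) :
    Growth f A b (fun _ => 0) ζ lam mu θ where
  entire := h.entire
  coeff_ne := h.coeff_ne hθ
  dir_zero := h.dir_zero
  dir_norm := h.dir_norm
  disjoint := h.disjoint
  main k := by
    have h0 := h.coeff_ne hθ k
    have h1 : ∀ᶠ z in Bornology.cobounded ℂ ⊓ 𝓟 (sector θ (ζ k)),
        A k * (z / ζ k) ^ (b k) * Complex.exp ((z / ζ k) ^ (lam : ℂ)) ≠ 0 := by
      filter_upwards [eventually_one_lt_norm_div (h.dir_norm k)] with z hz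
      refine mul_ne_zero (mul_ne_zero h0 ?_) (Complex.exp_ne_zero _)
      simpa [slow] using slow_ne_zero hz (b k) 0
    have h2 := ((isEquivalent_iff_tendsto_one h1).1 (h.main k)).const_mul (A k)
    rw [mul_one] at h2
    refine h2.congr fun z => ?_
    simp only [Pi.div_apply, slow, Complex.cpow_zero, mul_one]
    field_simp
  other := h.other

lemma norm_cpow_ofReal {lam : ℝ} {z : ℂ} (hz : z ≠ 0) : ‖z ^ (lam : ℂ)‖ = ‖z‖ ^ lam := by
  rw [Complex.norm_cpow_of_ne_zero hz]
  simp

lemma phase_re {lam : ℝ} {z : ℂ} (hz : z ≠ 0) : (phase lam z).re =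
    (‖z‖ ^ lam * Real.cos (lam * z.arg) - 1) / lam - Real.log ‖z‖ := by
  have h1 : (z ^ (lam : ℂ)).re = ‖z‖ ^ lam * Real.cos (lam * z.arg) := by
    rw [Complex.cpow_def_of_ne_zero hz, Complex.exp_re, Complex.re_mul_ofReal,
      Complex.im_mul_ofReal, Complex.log_re, Complex.log_im,
      Real.rpow_def_of_pos (norm_pos_iff.2 hz), mul_comm lam]
  rw [phase, Complex.sub_re, Complex.log_re, Complex.div_ofReal_re, Complex.sub_re, h1,
    Complex.one_re]

/-- The modulus defining the curve equals `exp(-λ Re Φ(z))`. -/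
lemma mem_limitCurve_iff {lam : ℝ} (hlam : 0 < lam) {z : ℂ} (hz : z ≠ 0) :
    z ∈ limitCurve lam ↔ (phase lam z).re = 0 ∧ ‖z‖ ≤ 1 := by
  have hz' := norm_pos_iff.2 hz
  have h1 : ‖z ^ (lam : ℂ) * Complex.exp (1 - z ^ (lam : ℂ))‖ =
      Real.exp (-(lam * (phase lam z).re)) := by
    rw [norm_mul, norm_cpow_ofReal hz, Complex.norm_exp, Real.rpow_def_of_pos hz', ← Real.exp_add,
      Complex.sub_re, phase, Complex.sub_re, Complex.log_re, Complex.div_ofReal_re, Complex.sub_re,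
      Complex.one_re]
    congr 1
    field_simp
    ring
  have h2 : z ∈ limitCurve lam ↔
      ‖z ^ (lam : ℂ) * Complex.exp (1 - z ^ (lam : ℂ))‖ = 1 ∧ ‖z‖ ≤ 1 := Iff.rfl
  rw [h2, h1, Real.exp_eq_one_iff, neg_eq_zero, mul_eq_zero, or_iff_right hlam.ne']

/-- On a ray this function is `Re Φ`, with `C` the cosine of `λ` times the argument. Monotonicity
reduces to `log x ≤ x - 1` at `x = (r / s)^λ`. -/
lemma strictAntiOn_phase_radius {lam C : ℝ} (hlam : 0 < lam) (hC : C < 1) :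
    StrictAntiOn (fun r : ℝ => (r ^ lam * C - 1) / lam - Real.log r) (Set.Ioc 0 1) := by
  intro r hr s hs hrs
  simp only
  have h1 : 0 < r ^ lam := Real.rpow_pos_of_pos hr.1 _
  have h2 : 0 < s ^ lam := Real.rpow_pos_of_pos hs.1 _
  have h3 : r ^ lam < s ^ lam := Real.rpow_lt_rpow hr.1.le hrs hlam
  have h4 : s ^ lam ≤ 1 := Real.rpow_le_one hs.1.le hs.2 hlam.le
  have h5 := Real.log_le_sub_one_of_pos (div_pos h1 h2)
  rw [Real.log_div h1.ne' h2.ne', Real.log_rpow hr.1, Real.log_rpow hs.1, div_sub_one h2.ne'] at h5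
  have h6 : (r ^ lam - s ^ lam) / s ^ lam ≤ r ^ lam - s ^ lam := by
    rw [div_le_iff₀ h2]
    nlinarith
  have h7 : (s ^ lam - r ^ lam) * C < s ^ lam - r ^ lam := by nlinarith
  have h8 : (s ^ lam * C - 1) / lam - Real.log s - ((r ^ lam * C - 1) / lam - Real.log r) =
      ((s ^ lam - r ^ lam) * C + (lam * Real.log r - lam * Real.log s)) / lam := by
    field_simp
    ring
  have h9 : ((s ^ lam - r ^ lam) * C + (lam * Real.log r - lam * Real.log s)) / lam < 0 :=
    div_neg_of_neg_of_pos (by linarith) hlam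
  linarith

theorem exists_unique_mem_limitCurve {lam θ : ℝ} (hlam : 0 < lam) (hθπ : θ < Real.pi)
    (hlamθ : lam * θ < 2 * Real.pi) {φ : ℝ} (hφ0 : 0 < |φ|) (hφ : |φ| < θ) :
    ∃ ξ ∈ limitCurve lam, ξ.arg = φ ∧ ξ ≠ 0 ∧ ‖ξ‖ < 1 ∧ (phase lam ξ).re = 0 ∧
      ∀ η ∈ limitCurve lam, η.arg = φ → η = ξ := by
  set C := Real.cos (lam * φ) with hC
  set G : ℝ → ℝ := fun r => (r ^ lam * C - 1) / lam - Real.log r with hG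
  have hC1 : C < 1 := by
    refine lt_of_le_of_ne (Real.cos_le_one _) fun h => ?_
    have h1 : |lam * φ| < 2 * Real.pi := by
      rw [abs_mul, abs_of_pos hlam]
      nlinarith
    rw [abs_lt] at h1
    have h2 := (Real.cos_eq_one_iff_of_lt_of_lt h1.1 h1.2).1 h
    have h3 := (mul_eq_zero.1 h2).resolve_left hlam.ne'
    rw [h3] at hφ0
    simp at hφ0
  have hanti := strictAntiOn_phase_radius hlam hC1
  have hG1 : G 1 < 0 := by
    simp only [hG, Real.one_rpow, one_mul, Real.log_one, sub_zero]
    exact div_neg_of_neg_of_pos (by linarith) hlam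
  -- Small enough that `-log r₀ = 3/λ` outweighs `(r₀^λ C - 1)/λ ≥ -2/λ`.
  set r₀ := Real.exp (-3 / lam) with hr₀
  have hr₀1 : r₀ ≤ 1 := Real.exp_le_one_iff.2 (div_nonpos_of_nonpos_of_nonneg (by norm_num) hlam.le)
  have hG0 : 0 ≤ G r₀ := by
    have h1 : r₀ ^ lam ≤ 1 := Real.rpow_le_one (Real.exp_pos _).le hr₀1 hlam.le
    have h2 : 0 < r₀ ^ lam := Real.rpow_pos_of_pos (Real.exp_pos _) _
    have h3 : -1 ≤ C := Real.neg_one_le_cos _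
    have h4 : G r₀ = (r₀ ^ lam * C + 2) / lam := by
      simp only [hG]
      rw [hr₀, Real.log_exp]
      field_simp
      ring
    rw [h4]
    refine div_nonneg ?_ hlam.le
    nlinarith
  have hcont : ContinuousOn G (Set.Icc r₀ 1) := by
    have hne : ∀ x ∈ Set.Icc r₀ 1, x ≠ 0 := fun x hx => ((Real.exp_pos _).trans_le hx.1).ne'
    refine ContinuousOn.sub (((ContinuousOn.mul ?_ continuousOn_const).sub
      continuousOn_const).div_const _) (continuousOn_id.log hne)
    exact continuousOn_id.rpow_const fun x hx => Or.inl (hne x hx)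
  obtain ⟨r, hr, hr'⟩ := intermediate_value_Icc' hr₀1 hcont ⟨hG1.le, hG0⟩
  have hrpos : 0 < r := (Real.exp_pos _).trans_le hr.1
  have hr1 : r < 1 := lt_of_le_of_ne hr.2 fun h => by rw [h] at hr'; exact hG1.ne hr'
  have hφmem : φ ∈ Set.Ioc (-Real.pi) Real.pi := by
    have := abs_lt.1 (hφ.trans hθπ)
    exact ⟨this.1, this.2.le⟩
  set ξ : ℂ := r * (Complex.cos φ + Complex.sin φ * Complex.I) with hξ
  have hnorm : ‖ξ‖ = r := by
    rw [hξ, ← Complex.exp_mul_I, norm_mul, Complex.norm_exp_ofReal_mul_I, Complex.norm_real,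
      Real.norm_of_nonneg hrpos.le, mul_one]
  have harg : ξ.arg = φ := Complex.arg_mul_cos_add_sin_mul_I hrpos hφmem
  have hξ0 : ξ ≠ 0 := norm_pos_iff.1 (by rw [hnorm]; exact hrpos)
  have hre : (phase lam ξ).re = 0 := by rw [phase_re hξ0, hnorm, harg]; exact hr'
  refine ⟨ξ, (mem_limitCurve_iff hlam hξ0).2 ⟨hre, by rw [hnorm]; exact hr.2⟩, harg, hξ0,
    by rw [hnorm]; exact hr1, hre, fun η hη hηarg => ?_⟩
  have hη0 : η ≠ 0 := by
    rintro rfl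
    rw [Complex.arg_zero] at hηarg
    rw [← hηarg] at hφ0
    simp at hφ0
  have h1 := (mem_limitCurve_iff hlam hη0).1 hη
  rw [phase_re hη0, hηarg] at h1
  refine Complex.ext_norm_arg ?_ (hηarg.trans harg.symm)
  rw [hnorm]
  exact hanti.injOn ⟨norm_pos_iff.2 hη0, h1.2⟩ ⟨hrpos, hr.2⟩ (h1.1.trans hr'.symm)

lemma scale_isBigO {lam : ℝ} (hlam : 0 < lam) {p : ℝ} (hp : 1 / lam ≤ p) :
    scale lam =O[atTop] (fun n : ℕ => (n : ℝ) ^ p) := by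
  refine IsBigO.of_bound ((1 / lam) ^ (1 / lam)) ?_
  filter_upwards [eventually_ge_atTop 1] with n hn
  have h1 : (1 : ℝ) ≤ n := by exact_mod_cast hn
  rw [Real.norm_of_nonneg (scale_pos hlam hn).le, Real.norm_of_nonneg (by positivity), scale,
    div_eq_mul_one_div, Real.mul_rpow (by positivity) (by positivity), mul_comm]
  gcongr

/-! ### Assembly of parts (a) and (b). -/

namespace Growth

variable {f : ℂ → ℂ} {m : ℕ} {A b c ζ : Fin (m + 1) → ℂ} {lam mu θ : ℝ}

theorem partA (hf : Growth f A b c ζ lam mu θ) (hlam : 0 < lam) (hmu : mu < 1) (hθ : 0 < θ)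
    (hθπ : θ < Real.pi) (hlamθ : lam * θ < 2 * Real.pi) : PartA f lam θ {n | 1 ≤ n} := by
  intro φ hφ0 hφ
  obtain ⟨ξ, hξmem, harg, hξ0, hξ1, hre, huniq⟩ :=
    exists_unique_mem_limitCurve hlam hθπ hlamθ hφ0 hφ
  have hξpos := norm_pos_iff.2 hξ0
  have hslit : ξ ∈ Complex.slitPlane := by
    rw [Complex.mem_slitPlane_iff_arg, harg]
    exact ⟨((le_abs_self φ).trans_lt (hφ.trans hθπ)).ne, hξ0⟩
  have hdp : dphase lam ξ ≠ 0 := by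
    refine div_ne_zero (sub_ne_zero.2 fun h => ?_) hξ0
    have h1 := congrArg norm h
    rw [norm_cpow_ofReal hξ0, norm_one] at h1
    exact (Real.rpow_lt_one hξpos.le hξ1 hlam).ne h1
  refine ⟨ξ, ⟨hξmem, harg⟩, huniq, fun n hn => mul_pos hξpos (scale_pos hlam hn),
    ((tendsto_scale hlam tendsto_id).const_mul_atTop hξpos).mono_left inf_le_left, ?_, ?_⟩
  · refine IsBigO.mono ?_ inf_le_left
    refine (scale_isBigO hlam ?_).const_mul_left _
    rw [Nat.cast_one, mul_one]
    gcongr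
    norm_num
  · intro ε hε
    refine Tendsto.mono_left ?_ inf_le_left
    have hcenter : ∀ n : ℕ, ((‖ξ‖ * scale lam n : ℝ) : ℂ) * Complex.exp (Complex.I * φ) =
        scale lam n * ξ := by
      intro n
      conv_rhs => rw [← Complex.norm_mul_exp_arg_mul_I ξ, harg]
      rw [mul_comm Complex.I]
      push_cast
      ring
    simp only [hcenter, Nat.cast_one, div_one]
    -- Strictly below `ε`, to leave room in the disk, and below `1/2`, to control the quadratic
    -- error of the phase.
    set ε' := min (ε / 2) (1 / 4) with hε'
    have hε'0 : 0 < ε' := lt_min (half_pos hε) (by norm_num)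
    have hε'1 : ε' ≤ 1 / 4 := min_le_right _ _
    have hε'2 : ε' ≤ ε / 2 := min_le_left _ _
    -- The magnified limit exists only along subsequences, but divergence along a further
    -- subsequence of every sequence gives divergence along all indices.
    refine tendsto_of_subseq_tendsto fun n hn => ?_
    obtain ⟨ψ, ν, T, hψ, hT, hν, hz⟩ :=
      hf.exists_zoom_remInt hlam hmu hθ hθπ hlamθ hξ0 hξ1 hn (show ε' < 1 by linarith)
    exact ⟨ψ, hf.tendsto_zeroCount_of_zoom hlam hslit (by rw [harg]; exact hφ) hξ1 hre hdp
      (hn.comp hψ.tendsto_atTop) hT hν hε'0 (by linarith) (by linarith) hz⟩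

theorem partB (hf : Growth f A b c ζ lam mu θ) (hlam : 0 < lam) (hmu : mu < 1) (hθ : 0 < θ)
    (hθπ : θ < Real.pi) (hlamθ : lam * θ < 2 * Real.pi)
    (hdom : ∀ᶠ e in 𝓝[>] (0 : ℝ), ∀ k, k ≠ 0 →
      Tendsto (fun N : ℕ => ‖slow (b k) (c k) (scale lam N)‖ /
        ‖slow (b 0) (c 0) (scale lam N)‖ * (N : ℝ) ^ (-1 / 2 + e)) atTop (𝓝 0)) :
    PartB f lam {n | 1 ≤ n} := by
  refine ⟨fun n hn => scale_pos hlam hn,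
    (tendsto_scale hlam tendsto_id).mono_left inf_le_left, ?_, ?_⟩
  · refine (scale_isBigO hlam ?_).mono inf_le_left
    rw [mul_comm lam, Nat.cast_two, ← div_div, div_self two_ne_zero]
  · intro ε hε
    refine Tendsto.mono_left ?_ inf_le_left
    simp only [Complex.ofReal_zero, mul_zero, Complex.exp_zero, mul_one, Nat.cast_ofNat]
    -- Shrinking the exponent is harmless, so it suffices that the dominance condition holds for all
    -- small `e > 0`.
    have hsmall : ∀ᶠ e in 𝓝[>] (0 : ℝ), e < min ε (1 / 2) :=
      Eventually.filter_mono nhdsWithin_le_nhds (eventually_lt_nhds (by positivity))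
    obtain ⟨ε', h1, h2, h3⟩ := (hdom.and (hsmall.and self_mem_nhdsWithin)).exists
    exact hf.tendsto_zeroCount_near_one hlam hmu hθ hθπ hlamθ h3 (h2.trans_le (min_le_right _ _))
      (h2.trans_le (min_le_left _ _)) h1 tendsto_id

end Growth

/-- As `r_n` is a constant times `n^{1/λ}`, the quotient is a constant times `n^{(Re b - Re a)/λ}`,
and the hypothesis makes the total exponent negative. -/
lemma tendsto_slow_ratio {lam : ℝ} (hlam : 0 < lam) {a b : ℂ} {e : ℝ}
    (he : (b.re - a.re) / lam + e < 1 / 2) :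
    Tendsto (fun N : ℕ => ‖slow b 0 (scale lam N)‖ / ‖slow a 0 (scale lam N)‖ *
      (N : ℝ) ^ (-1 / 2 + e)) atTop (𝓝 0) := by
  have h1 : Tendsto (fun N : ℕ => (1 / lam) ^ ((b.re - a.re) / lam) *
      (N : ℝ) ^ (-(1 / 2 - ((b.re - a.re) / lam + e)))) atTop (𝓝 0) := by
    simpa using ((tendsto_rpow_neg_atTop (sub_pos.2 he)).comp
      tendsto_natCast_atTop_atTop).const_mul ((1 / lam) ^ ((b.re - a.re) / lam))
  refine h1.congr' ?_
  filter_upwards [eventually_ge_atTop 1] with N hN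
  have hs := scale_pos hlam hN
  have hN' : (0 : ℝ) < N := by exact_mod_cast hN
  simp only [slow, Complex.cpow_zero, mul_one]
  rw [Complex.norm_cpow_eq_rpow_re_of_pos hs, Complex.norm_cpow_eq_rpow_re_of_pos hs,
    ← Real.rpow_sub hs, scale, ← Real.rpow_mul (by positivity), one_div_mul_eq_div,
    div_eq_mul_one_div (N : ℝ), Real.mul_rpow hN'.le (by positivity), mul_comm _ ((1 / lam) ^ _),
    mul_assoc, ← Real.rpow_add hN']
  congr 2
  ring

end SaffVarga

theorem mainTheorem9 (lam mu θ : ℝ) (hlam : 0 < lam) (hmu : mu < 1)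
    (hθ : 0 < θ) (hθπ : θ < Real.pi) (hlamθ : lam * θ < 2 * Real.pi) (f : ℂ → ℂ) :
    (∀ a b : ℂ, SaffVarga.OneDirection f a b lam mu θ →
      SaffVarga.PartA f lam θ {n | 1 ≤ n} ∧ SaffVarga.PartB f lam {n | 1 ≤ n}) ∧
    (∀ (m : ℕ) (A b ζ : Fin (m + 1) → ℂ), 1 ≤ m →
      SaffVarga.ManyDirections f A b ζ lam mu θ →
      (∃ M : Set ℕ, M ⊆ {n | 1 ≤ n} ∧ M.Infinite ∧ SaffVarga.PartA f lam θ M) ∧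
      ((∃ j, ∀ k, k ≠ j → (b k).re < (b j).re) → SaffVarga.PartA f lam θ {n | 1 ≤ n}) ∧
      ((∀ k, k ≠ 0 → (b k).re - (b 0).re < lam / 2) →
        SaffVarga.PartB f lam {n | 1 ≤ n})) := by
  refine ⟨fun a b h => ⟨h.growth.partA hlam hmu hθ hθπ hlamθ, h.growth.partB hlam hmu hθ hθπ hlamθ
    (Eventually.of_forall fun e k hk => absurd (Fin.ext (by omega)) hk)⟩,
    fun m A b ζ _ h => ?_⟩
  have hA := (h.growth hθ).partA hlam hmu hθ hθπ hlamθ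
  refine ⟨⟨_, subset_rfl, Set.infinite_of_forall_exists_gt fun n => ⟨n + 1, by simp, by simp⟩, hA⟩,
    fun _ => hA, fun hb => (h.growth hθ).partB hlam hmu hθ hθπ hlamθ ?_⟩
  rw [eventually_all]
  intro k
  by_cases hk : k = 0
  · exact Eventually.of_forall fun e hk' => absurd hk hk'
  -- The strict bound on the real parts is exactly what leaves room for some `e > 0`.
  · have h1 : 0 < 1 / 2 - ((b k).re - (b 0).re) / lam := by
      rw [sub_pos, div_lt_iff₀ hlam]
      linarith [hb k hk]
    filter_upwards [Eventually.filter_mono nhdsWithin_le_nhds (eventually_lt_nhds h1)] with e he _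
    exact SaffVarga.tendsto_slow_ratio hlam (by linarith)
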